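/- Let $\mathbf k$ be a field of characteristic zero, let $r,n\ge 0$ and $c\ge 1$ be integers, let $T=(\mathbf k^\times)^n$ and, for each $m$, let $G_m=\mathrm{GL}_m(\mathbf k)\times T$ act on the space $\mathbb A^{m\times n}$ of $m\times n$ matrices over $\mathbf k$ by $(g,t)\cdot v=g\,v\,t^{-1}$, where $t$ is viewed as a diagonal matrix. Grade $R_m=\mathbf k[x_{ij}:1\le i\le m,\,1\le j\le n]$ by $\mathbb Z^m\times\mathbb Z^n$ with $\deg x_{ij}=a_i+b_j$ ($a_i,b_j$ the standard basis vectors). For a $G_m$-stable closed subvariety (integral closed subscheme) $X\subseteq\mathbb A^{m\times n}$ with ideal $I$, let $\mathcal K(X;u,t)$ be the polynomial with $\mathrm{Hilb}(R_m/I;u,t)=\mathcal K(X;u,t)/\prod_{i,j}(1-u_it_j)$, and let the equivariant cohomology class $\mathcal C(X)\in H^*_{G_m}(\mathbb A^{m\times n})=\mathbb Z[u_1,\dots,u_m,t_1,\dots,t_n]^{\mathfrak S_m}$ be the part of $\mathcal K(X;1-u,1-t)$ of total degree $\operatorname{codim}X$. For a sequence $\mu$ of $m$ nonnegative integers let $$s_\mu(u_1,\dots,u_m)=\frac{\det(u_i^{\mu_j+m-j})_{i,j}}{\det(u_i^{m-j})_{i,j}}.$$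 For $k\ge 0$ and each $m$, let $\rho_k:\mathbb Z[u_1,\dots,u_m,t]^{\mathfrak S_m}\to\mathbb Z[u_1,\dots,u_{m+1},t]^{\mathfrak S_{m+1}}$ be the $\mathbb Z[t]$-linear operator with $\rho_k s_\lambda(u_1,\dots,u_m)=s_{(\lambda,k)}(u_1,\dots,u_{m+1})$ for every partition $\lambda=(\lambda_1\ge\dots\ge\lambda_m\ge0)$. Define $\rho_H^{(c)}:\mathbb Z[u_1,\dots,u_r,t]^{\mathfrak S_r}\to\mathbb Z[u_1,\dots,u_{r+c},t]^{\mathfrak S_{r+c}}$ by $$\rho_H^{(c)}=(-1)^{cr}\,e_{r+c}(u)^{-c}\sum_{k_1,\dots,k_c=0}^{n}e_{k_1}(t)\cdots e_{k_c}(t)\,\rho_{n+c-k_c}\cdots\rho_{n+c-k_1},$$ where $e_k$ denotes an elementary symmetric polynomial and $e_{r+c}(u)=u_1\cdots u_{r+c}$ (the division is exact). Let $X$ be a $G_r$-stable closed subvariety of $\mathbb A^{r\times n}$ that is not contained in the locus of matrices of rank at most $r-1$. Regard $\mathbb A^{r\times n}$ as a subspace of $\mathbb A^{(r+c)\times n}$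 by appending $c$ zero rows. Then $\rho(X)=\overline{\mathrm{GL}_{r+c}(\mathbf k)X}$ is the smallest $G_{r+c}$-stable closed subvariety of $\mathbb A^{(r+c)\times n}$ containing $X$, and $$\mathcal C(\rho(X))=\rho_H^{(c)}\,\mathcal C(X).$$ -/

import Mathlib

noncomputable section

namespace MatrixStabilization

open MvPolynomial

section Schur

variable {A : Type*} [CommRing A] {m : ℕ}

/-- The alternant `det (u_i ^ α_j)` in the variables `u_1, …, u_m`. -/
def alternant (α : Fin m → ℕ) : MvPolynomial (Fin m) A :=
  Matrix.det (Matrix.of fun i j => (X i : MvPolynomial (Fin m) A) ^ α j)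

/-- The exponents `m - 1, m - 2, …, 0` of the Vandermonde determinant `det (u_i ^ (m - j))`
(with `j` counted from `1`; here it is counted from `0`). -/
def delta (m : ℕ) (j : Fin m) : ℕ := m - 1 - j

theorem rename_alternant (σ : Equiv.Perm (Fin m)) (α : Fin m → ℕ) :
    rename σ (alternant α : MvPolynomial (Fin m) A) = (Equiv.Perm.sign σ : ℤ) • alternant α := by
  have h := Matrix.det_permute σ
    (Matrix.of fun i j => (X i : MvPolynomial (Fin m) A) ^ α j)
  rw [alternant, AlgHom.map_det, zsmul_eq_mul, ← h]
  congr 1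
  ext i j
  simp [Matrix.submatrix]

theorem alternant_delta_ne_zero [IsDomain A] : (alternant (delta m) : MvPolynomial (Fin m) A) ≠ 0 := by
  have h : (alternant (delta m) : MvPolynomial (Fin m) A)
      = ((Matrix.vandermonde (fun i => (X i : MvPolynomial (Fin m) A))).submatrix id Fin.revPerm).det := by
    rw [alternant]
    congr 1
    ext i j
    simp only [delta, Matrix.of_apply, Matrix.submatrix_apply, id_eq, Fin.revPerm_apply,
      Matrix.vandermonde_apply, Fin.val_rev]
    congr 2
    omega
  rw [h, Matrix.det_permute']
  have h2 := Matrix.det_vandermonde_ne_zero_iff.2 (X_injective (σ := Fin m) (R := A))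
  rcases Int.units_eq_one_or (Equiv.Perm.sign (Fin.revPerm : Equiv.Perm (Fin m))) with h | h <;>
    simp [h, h2]

theorem X_sub_X_dvd (i j : Fin m) (p : MvPolynomial (Fin m) A)
    (h : aeval (Function.update X i (X j) : Fin m → MvPolynomial (Fin m) A) p = 0) :
    (X i - X j) ∣ p := by
  rw [← Ideal.mem_span_singleton, ← Ideal.Quotient.eq_zero_iff_mem]
  set I : Ideal (MvPolynomial (Fin m) A) := Ideal.span {X i - X j}
  have key : (Ideal.Quotient.mkₐ A I).comp
      (aeval (Function.update X i (X j) : Fin m → MvPolynomial (Fin m) A))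
      = Ideal.Quotient.mkₐ A I := by
    apply MvPolynomial.algHom_ext
    intro l
    by_cases hl : l = i
    · subst hl
      simp only [AlgHom.comp_apply, aeval_X, Function.update_self, Ideal.Quotient.mkₐ_eq_mk]
      exact ((Ideal.Quotient.mk_eq_mk_iff_sub_mem _ _).2
        (Ideal.mem_span_singleton_self _)).symm
    · simp [hl]
  have := DFunLike.congr_fun key p
  simp only [AlgHom.comp_apply, h, map_zero] at this
  exact this.symm

theorem prod_dvd_of_subst [IsDomain A] (S : Finset (Fin m × Fin m)) (hS : ∀ q ∈ S, q.1 < q.2)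
    (p : MvPolynomial (Fin m) A)
    (h : ∀ q ∈ S, aeval (Function.update X q.2 (X q.1) : Fin m → MvPolynomial (Fin m) A) p = 0) :
    (∏ q ∈ S, (X q.2 - X q.1)) ∣ p := by
  classical
  induction S using Finset.induction_on with
  | empty => simp
  | insert a S ha ih =>
    obtain ⟨q, hq⟩ := ih (fun q hq => hS q (Finset.mem_insert_of_mem hq))
      (fun q hq => h q (Finset.mem_insert_of_mem hq))
    have h1 := h a (Finset.mem_insert_self _ _)
    rw [hq, map_mul, map_prod] at h1
    have h2 : aeval (Function.update X a.2 (X a.1) : Fin m → MvPolynomial (Fin m) A) q = 0 := by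
      refine (mul_eq_zero.1 h1).resolve_left ?_
      refine Finset.prod_ne_zero_iff.2 ?_
      intro b hb h0
      have hb' := hS b (Finset.mem_insert_of_mem hb)
      have ha' := hS a (Finset.mem_insert_self _ _)
      have hab : b ≠ a := fun e => ha (e ▸ hb)
      rw [map_sub, aeval_X, aeval_X, sub_eq_zero] at h0
      simp only [Function.update_apply] at h0
      apply hab
      split_ifs at h0 <;> have := X_injective h0 <;> ext <;> omega
    obtain ⟨s, hs⟩ := X_sub_X_dvd _ _ _ h2
    rw [Finset.prod_insert ha, hq, hs]
    exact ⟨s, by ring⟩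

theorem alternant_delta_dvd [IsDomain A] (α : Fin m → ℕ) :
    (alternant (delta m) : MvPolynomial (Fin m) A) ∣ alternant α := by
  have h : (alternant (delta m) : MvPolynomial (Fin m) A)
      = ((Matrix.vandermonde (fun i => (X i : MvPolynomial (Fin m) A))).submatrix id Fin.revPerm).det := by
    rw [alternant]
    congr 1
    ext i j
    simp only [delta, Matrix.of_apply, Matrix.submatrix_apply, id_eq, Fin.revPerm_apply,
      Matrix.vandermonde_apply, Fin.val_rev]
    congr 2
    omega
  have h2 : (Matrix.vandermonde (fun i => (X i : MvPolynomial (Fin m) A))).det ∣ alternant α := by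
    rw [Matrix.det_vandermonde]
    have e : ∏ i : Fin m, ∏ j ∈ Finset.Ioi i, ((X j : MvPolynomial (Fin m) A) - X i)
        = ∏ q ∈ (Finset.univ : Finset (Fin m × Fin m)).filter (fun q => q.1 < q.2),
          (X q.2 - X q.1) := by
      rw [Finset.prod_filter, Fintype.prod_prod_type]
      refine Finset.prod_congr rfl fun i _ => ?_
      rw [← Finset.prod_filter]
      refine Finset.prod_congr ?_ fun _ _ => rfl
      ext; simp
    rw [e]
    apply prod_dvd_of_subst
    · simp
    · intro q hq
      rw [Finset.mem_filter] at hq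
      rw [alternant, AlgHom.map_det]
      apply Matrix.det_zero_of_row_eq (i := q.1) (j := q.2) hq.2.ne
      ext j
      simp [hq.2.ne]
  rw [h, Matrix.det_permute']
  rcases Int.units_eq_one_or (Equiv.Perm.sign (Fin.revPerm : Equiv.Perm (Fin m))) with h | h <;>
    simpa [h] using h2

theorem exists_schur [IsDomain A] (μ : Fin m → ℕ) :
    ∃ s : symmetricSubalgebra (Fin m) A,
      (s : MvPolynomial (Fin m) A) * alternant (delta m) = alternant (μ + delta m) := by
  obtain ⟨s, hs⟩ := alternant_delta_dvd (A := A) (μ + delta m)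
  refine ⟨⟨s, fun σ => ?_⟩, by rw [hs, mul_comm]⟩
  have h := congrArg (rename σ) hs
  rw [map_mul, rename_alternant, rename_alternant, hs] at h
  have hne := alternant_delta_ne_zero (A := A) (m := m)
  apply mul_left_cancel₀ hne
  rcases Int.units_eq_one_or (Equiv.Perm.sign σ) with h' | h' <;> simpa [h', hne, eq_comm] using h

variable (A) in
/-- The polynomial `s_μ(u_1, …, u_m) = det (u_i ^ (μ_j + m - j)) / det (u_i ^ (m - j))`, for any
sequence `μ` of `m` nonnegative integers, which need not be decreasing. It is the exact quotient
of the two alternants, see `schurPoly_mul`. For a partition `μ` it is the Schur polynomial. -/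
def schurPoly [IsDomain A] (μ : Fin m → ℕ) : symmetricSubalgebra (Fin m) A :=
  (exists_schur μ).choose

theorem schurPoly_mul [IsDomain A] (μ : Fin m → ℕ) :
    (schurPoly A μ : MvPolynomial (Fin m) A) * alternant (delta m) = alternant (μ + delta m) :=
  (exists_schur μ).choose_spec

theorem coeff_alternant (α β : Fin m → ℕ) (hα : StrictAnti α) (hβ : StrictAnti β) :
    coeff (Finsupp.equivFunOnFinite.symm α) (alternant β : MvPolynomial (Fin m) A)
      = if α = β then 1 else 0 := by
  classical
  have hmon : ∀ σ : Equiv.Perm (Fin m), ∏ i, (X (σ i) : MvPolynomial (Fin m) A) ^ β i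
      = monomial (Finsupp.equivFunOnFinite.symm (β ∘ σ.symm)) 1 := by
    intro σ
    rw [monomial_eq, Finsupp.prod_fintype _ _ (by simp), C_1, one_mul]
    rw [← Equiv.prod_comp σ (fun i => (X i : MvPolynomial (Fin m) A) ^ _)]
    simp
  rw [alternant, Matrix.det_apply, coeff_sum, Finset.sum_eq_single 1]
  · simp only [Matrix.of_apply, Equiv.Perm.sign_one, one_smul]
    rw [hmon 1, coeff_monomial]
    have : β ∘ (Equiv.symm (1 : Equiv.Perm (Fin m))) = β := rfl
    simp [this, eq_comm]
  · intro σ _ hσ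
    simp only [Matrix.of_apply]
    rw [hmon σ, ← smul_eq_zero_iff_eq (Equiv.Perm.sign σ)⁻¹]
    rw [Units.smul_def, Units.smul_def, ← coeff_smul]
    rcases Int.units_eq_one_or (Equiv.Perm.sign σ) with h' | h' <;> 
    · simp only [h', coeff_smul, coeff_monomial]
      rw [if_neg]
      · simp
      intro h
      apply hσ
      have h : β ∘ σ.symm = α := Finsupp.equivFunOnFinite.symm.injective h
      have h3 : StrictMono σ.symm := by
        intro a b hab
        have := hα hab
        rw [← h] at this
        exact hβ.lt_iff_gt.1 this
      have h4 : (σ.symm : Fin m → Fin m) = id := by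
        exact (StrictMono.range_inj h3 strictMono_id).1 (by simp)
      ext i
      have := congrFun h4 (σ i)
      simp at this
      simp [← this]
  · simp

/-- Partitions with at most `r` nonzero parts, padded by zeros to length `r`. -/
abbrev Par (r : ℕ) : Type := {μ : Fin r → ℕ // Antitone μ}

theorem Par.strictAnti (μ : Par m) : StrictAnti (μ.1 + delta m) := by
  intro i j h
  have := μ.2 h.le
  simp only [Pi.add_apply, delta]
  have h2 : (i : ℕ) < j := h
  omega

variable (A) in
/-- The top elementary symmetric polynomial `e_m(u_1, …, u_m)`. -/
def eTop (m : ℕ) : symmetricSubalgebra (Fin m) A :=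
  ⟨esymm (Fin m) A m, esymm_isSymmetric _ _ _⟩

theorem coe_eTop : (eTop A m : MvPolynomial (Fin m) A) = ∏ i, X i := by
  have h : Finset.powersetCard m (Finset.univ : Finset (Fin m)) = {Finset.univ} := by
    simpa using Finset.powersetCard_self (Finset.univ : Finset (Fin m))
  simp only [eTop, esymm, h, Finset.sum_singleton]

variable [IsDomain A]

theorem coeff_schur (μ ν : Par m) :
    coeff (Finsupp.equivFunOnFinite.symm (ν.1 + delta m))
      ((schurPoly A μ.1 : MvPolynomial (Fin m) A) * alternant (delta m)) = if ν = μ then 1 else 0 := by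
  rw [schurPoly_mul, coeff_alternant _ _ ν.strictAnti μ.strictAnti]
  simp [Subtype.ext_iff]

theorem linearIndependent_schur : LinearIndependent A (fun μ : Par m => schurPoly A μ.1) := by
  classical
  rw [linearIndependent_iff']
  intro s g hg μ hμ
  have h := congrArg (fun f : symmetricSubalgebra (Fin m) A =>
    coeff (Finsupp.equivFunOnFinite.symm (μ.1 + delta m))
      ((f : MvPolynomial (Fin m) A) * alternant (delta m))) hg
  simp only [AddSubmonoidClass.coe_finsetSum, Finset.sum_mul, coeff_sum, SetLike.val_smul,
    smul_mul_assoc, coeff_smul, coeff_schur, ZeroMemClass.coe_zero, zero_mul, coeff_zero] at h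
  simpa [hμ] using h

theorem exists_par (α : Fin m → ℕ) (hα : StrictAnti α) : ∃ μ : Par m, μ.1 + delta m = α := by
  have key : ∀ d : ℕ, ∀ i j : Fin m, (j : ℕ) = i + d → α j + d ≤ α i := by
    intro d
    induction d with
    | zero => intro i j h; have : j = i := by ext; omega
              simp [this]
    | succ d ih =>
      intro i j h
      have := ih i ⟨i + d, by omega⟩ rfl
      have h2 : α j < α ⟨i + d, by omega⟩ := hα (by rw [Fin.lt_def]; simp; omega)
      omega
  refine ⟨⟨fun j => α j - delta m j, ?_⟩, ?_⟩
  · intro i j h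
    have h1 := key (j - i) i j (by have : (i : ℕ) ≤ j := h; omega)
    have : (i : ℕ) ≤ j := h
    simp only [delta]
    omega
  · ext j
    have hj := j.2
    have h1 := key (m - 1 - j) j ⟨m - 1, by omega⟩ (by simp; omega)
    simp only [Pi.add_apply, delta]
    omega

theorem alternating_eq_zero [CharZero A] (q : MvPolynomial (Fin m) A)
    (hq : ∀ σ : Equiv.Perm (Fin m), rename σ q = (Equiv.Perm.sign σ : ℤ) • q)
    (h0 : ∀ α : Fin m → ℕ, StrictAnti α → coeff (Finsupp.equivFunOnFinite.symm α) q = 0) :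
    q = 0 := by
  classical
  have hc : ∀ (σ : Equiv.Perm (Fin m)) (α : Fin m → ℕ),
      coeff (Finsupp.equivFunOnFinite.symm α) q
        = (Equiv.Perm.sign σ : ℤ) • coeff (Finsupp.equivFunOnFinite.symm (α ∘ σ.symm)) q := by
    intro σ α
    have h1 := coeff_rename_mapDomain σ σ.injective q (Finsupp.equivFunOnFinite.symm α)
    have h2 : Finsupp.mapDomain σ (Finsupp.equivFunOnFinite.symm α)
        = Finsupp.equivFunOnFinite.symm (α ∘ σ.symm) := by
      ext i
      rw [← Finsupp.equivMapDomain_eq_mapDomain]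
      simp
    rw [h2, hq σ, coeff_smul] at h1
    exact h1.symm
  ext d
  obtain ⟨α, rfl⟩ := Finsupp.equivFunOnFinite.symm.surjective d
  rw [coeff_zero]
  by_cases hα : Function.Injective α
  · set β : Fin m → ℕᵒᵈ := fun i => OrderDual.toDual (α i)
    have hs := Tuple.monotone_sort β
    have hs' : StrictMono (β ∘ Tuple.sort β) :=
      hs.strictMono_of_injective (hα.comp (Tuple.sort β).injective)
    rw [hc (Tuple.sort β).symm α, h0, smul_zero]
    intro i j h
    exact hs' h
  · rw [Function.Injective] at hα
    push Not at hα
    obtain ⟨i, j, hij, hne⟩ := hα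
    have h1 := hc (Equiv.swap i j) α
    have h2 : α ∘ (Equiv.swap i j).symm = α := by
      ext l
      simp only [Equiv.symm_swap, Function.comp_apply, Equiv.swap_apply_def]
      split_ifs <;> simp_all
    rw [h2, Equiv.Perm.sign_swap hne] at h1
    simp at h1
    exact self_eq_neg.1 h1

theorem span_schur [CharZero A] :
    ⊤ ≤ Submodule.span A (Set.range (fun μ : Par m => schurPoly A μ.1)) := by
  classical
  rintro f -
  set p := (f : MvPolynomial (Fin m) A) * alternant (delta m) with hp
  let inj : Par m → (Fin m →₀ ℕ) := fun μ => Finsupp.equivFunOnFinite.symm (μ.1 + delta m)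
  have hinj : Function.Injective inj := by
    intro μ ν h
    have := Finsupp.equivFunOnFinite.symm.injective h
    exact Subtype.ext (add_right_cancel this)
  let S : Finset (Par m) := p.support.preimage inj hinj.injOn
  have hf : f = ∑ μ ∈ S, coeff (inj μ) p • schurPoly A μ.1 := by
    rw [← sub_eq_zero]
    set d := f - ∑ μ ∈ S, coeff (inj μ) p • schurPoly A μ.1 with hd
    have hz : (d : MvPolynomial (Fin m) A) * alternant (delta m) = 0 := by
      apply alternating_eq_zero
      · intro σ
        rw [map_mul, rename_alternant, d.2 σ, mul_smul_comm]
      · intro α hα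
        obtain ⟨ν, rfl⟩ := exists_par α hα
        rw [hd, AddSubgroupClass.coe_sub, sub_mul, coeff_sub, ← hp]
        simp only [AddSubmonoidClass.coe_finsetSum, Finset.sum_mul, coeff_sum, SetLike.val_smul,
          smul_mul_assoc, coeff_smul, coeff_schur]
        rw [sub_eq_zero]
        by_cases hν : coeff (inj ν) p = 0
        · have : ν ∉ S := by simp [S, hν]
          simp [this]
          exact hν
        · have : ν ∈ S := by simp [S, hν]
          simp [this]
          rfl
    exact Subtype.ext ((mul_eq_zero.1 hz).resolve_right alternant_delta_ne_zero)
  rw [hf]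
  exact Submodule.sum_mem _ fun μ _ => Submodule.smul_mem _ _ (Submodule.subset_span ⟨μ, rfl⟩)

variable (A) in
/-- The Schur polynomials of partitions with at most `m` parts, as an `A`-basis of the ring of
symmetric polynomials in `m` variables over `A`. -/
def schurBasis [CharZero A] (m : ℕ) : Module.Basis (Par m) A (symmetricSubalgebra (Fin m) A) :=
  Module.Basis.mk linearIndependent_schur span_schur

variable (A) in
/-- The `A`-linear raising operator `ρ_k`, from symmetric polynomials in `r` variables to symmetric
polynomials in `r + 1` variables: `ρ_k s_λ = s_(λ, k)` for partitions `λ` with `r` parts. -/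
def rhoOp [CharZero A] (r k : ℕ) :
    symmetricSubalgebra (Fin r) A →ₗ[A] symmetricSubalgebra (Fin (r + 1)) A :=
  (schurBasis A r).constr A fun μ => schurPoly A (Fin.snoc μ.1 k : Fin (r + 1) → ℕ)

theorem schurBasis_apply [CharZero A] (μ : Par m) : schurBasis A m μ = schurPoly A μ.1 := by
  simp [schurBasis]

theorem rhoOp_schur [CharZero A] (r k : ℕ) (μ : Par r) :
    rhoOp A r k (schurPoly A μ.1) = schurPoly A (Fin.snoc μ.1 k : Fin (r + 1) → ℕ) := by
  rw [← schurBasis_apply, rhoOp, Module.Basis.constr_basis]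

variable (A) in
/-- The composite `ρ_(a_c) ⋯ ρ_(a_1)`, in which `ρ_(a_1)` is applied first. -/
def rhoComp [CharZero A] (r : ℕ) : (c : ℕ) → (Fin c → ℕ) →
    symmetricSubalgebra (Fin r) A →ₗ[A] symmetricSubalgebra (Fin (r + c)) A
  | 0, _ => LinearMap.id
  | c + 1, a => (rhoOp A (r + c) (a (Fin.last c))).comp (rhoComp r c fun i => a i.castSucc)

theorem eTop_pow_mul_schur (p : ℕ) (μ : Fin m → ℕ) :
    eTop A m ^ p * schurPoly A μ = schurPoly A (fun j => μ j + p) := by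
  apply Subtype.ext
  apply mul_right_cancel₀ (alternant_delta_ne_zero (A := A) (m := m))
  rw [schurPoly_mul, MulMemClass.coe_mul, mul_assoc, schurPoly_mul, SubmonoidClass.coe_pow, coe_eTop,
    ← Finset.prod_pow, alternant, ← Matrix.det_mul_column, alternant]
  congr 1
  ext i j
  simp [pow_add]
  ring_nf

theorem eTop_pow_dvd_schur (p : ℕ) (μ : Fin m → ℕ) (h : ∀ j, p ≤ μ j + delta m j) :
    eTop A m ^ p ∣ schurPoly A μ := by
  have hV := alternant_delta_ne_zero (A := A) (m := m)
  -- the quotient of the two alternants, divided by a power of the product of the variables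
  obtain ⟨s, hs⟩ := alternant_delta_dvd (A := A) (fun j => μ j + delta m j - p)
  have h1 : (alternant (μ + delta m) : MvPolynomial (Fin m) A)
      = (∏ i, X i) ^ p * alternant (fun j => μ j + delta m j - p) := by
    rw [← Finset.prod_pow, alternant, alternant, ← Matrix.det_mul_column]
    congr 1
    ext i j
    simp only [Matrix.of_apply, Pi.add_apply, ← pow_add]
    congr 2
    have := h j
    omega
  have h2 : (schurPoly A μ : MvPolynomial (Fin m) A) = (∏ i, X i) ^ p * s := by
    apply mul_right_cancel₀ hV
    rw [schurPoly_mul, h1, hs]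
    ring
  have hE : (∏ i, X i : MvPolynomial (Fin m) A) ^ p ≠ 0 :=
    pow_ne_zero _ (Finset.prod_ne_zero_iff.2 fun i _ => X_ne_zero i)
  refine ⟨⟨s, fun σ => ?_⟩, ?_⟩
  · have h3 := (schurPoly A μ).2 σ
    rw [h2, map_mul, map_pow, map_prod] at h3
    simp only [rename_X] at h3
    rw [Equiv.prod_comp σ (fun i => (X i : MvPolynomial (Fin m) A))] at h3
    exact mul_left_cancel₀ hE h3
  · apply Subtype.ext
    rw [MulMemClass.coe_mul, SubmonoidClass.coe_pow, coe_eTop]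
    exact h2

theorem eTop_pow_dvd_rhoOp [CharZero A] {r k p : ℕ} (hk : p + 1 ≤ k)
    (f : symmetricSubalgebra (Fin r) A) (h : eTop A r ^ p ∣ f) :
    eTop A (r + 1) ^ (p + 1) ∣ rhoOp A r k f := by
  obtain ⟨g, rfl⟩ := h
  have hg := (schurBasis A r).mem_span g
  induction hg using Submodule.span_induction with
  | zero => simp
  | add x y _ _ hx hy => rw [mul_add, map_add]; exact dvd_add hx hy
  | smul a x _ hx =>
    rw [mul_smul_comm, map_smul, Algebra.smul_def]
    exact dvd_mul_of_dvd_right hx _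
  | mem x hx =>
    obtain ⟨μ, rfl⟩ := hx
    have h1 : eTop A r ^ p * schurBasis A r μ
        = schurPoly A (fun j => μ.1 j + p) := by
      rw [schurBasis_apply, eTop_pow_mul_schur]
    rw [h1, rhoOp_schur r k ⟨fun j => μ.1 j + p, fun i j h => Nat.add_le_add_right (μ.2 h) p⟩]
    apply eTop_pow_dvd_schur
    intro j
    refine Fin.lastCases ?_ (fun j => ?_) j
    · simp; omega
    · have := j.2
      simp only [Fin.snoc_castSucc, delta, Fin.val_castSucc]
      omega

theorem eTop_pow_dvd_rhoComp [CharZero A] (r : ℕ) : ∀ (c : ℕ) (a : Fin c → ℕ),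
    (∀ i, c ≤ a i) → ∀ f : symmetricSubalgebra (Fin r) A,
    eTop A (r + c) ^ c ∣ rhoComp A r c a f
  | 0, _, _, f => by simp
  | c + 1, a, h, f => eTop_pow_dvd_rhoOp (h _) _
      (eTop_pow_dvd_rhoComp r c _ (fun i => (Nat.le_succ c).trans (h _)) f)

end Schur

section Operator

variable {r : ℕ} (n c : ℕ)

/-- The sum `∑ e_(k_1)(t) ⋯ e_(k_c)(t) ρ_(n+c-k_c) ⋯ ρ_(n+c-k_1) f` over all `k_1, …, k_c` in
`{0, …, n}` (the other `e_k(t)` vanish). Symmetric polynomials in `u` have coefficients in `ℤ[t]`. -/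
def rhoHSum (f : symmetricSubalgebra (Fin r) (MvPolynomial (Fin n) ℤ)) :
    symmetricSubalgebra (Fin (r + c)) (MvPolynomial (Fin n) ℤ) :=
  ∑ κ : Fin c → Fin (n + 1), (∏ i, esymm (Fin n) ℤ (κ i)) •
    rhoComp (MvPolynomial (Fin n) ℤ) r c (fun i => n + c - κ i) f

theorem exists_rhoH (f : symmetricSubalgebra (Fin r) (MvPolynomial (Fin n) ℤ)) :
    ∃ g : symmetricSubalgebra (Fin (r + c)) (MvPolynomial (Fin n) ℤ),
      eTop (MvPolynomial (Fin n) ℤ) (r + c) ^ c * g = (-1) ^ (c * r) * rhoHSum n c f := by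
  obtain ⟨g, hg⟩ : eTop (MvPolynomial (Fin n) ℤ) (r + c) ^ c ∣ (-1) ^ (c * r) * rhoHSum n c f := by
    refine dvd_mul_of_dvd_right (Finset.dvd_sum fun κ _ => ?_) _
    rw [Algebra.smul_def]
    exact dvd_mul_of_dvd_right (eTop_pow_dvd_rhoComp r c _ (fun i => by omega) f) _
  exact ⟨g, hg.symm⟩

/-- The operator `ρ_H^(c) : ℤ[u,t]^(S_r) → ℤ[u,t]^(S_(r+c))`,
`f ↦ (-1)^(cr) e_(r+c)(u)^(-c) ∑ e_(k_1)(t) ⋯ e_(k_c)(t) ρ_(n+c-k_c) ⋯ ρ_(n+c-k_1) f`.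
The division by `e_(r+c)(u)^c` is exact, see `eTop_pow_mul_rhoH`, and the ring is a domain, so the
quotient is unique. -/
def rhoH (f : symmetricSubalgebra (Fin r) (MvPolynomial (Fin n) ℤ)) :
    symmetricSubalgebra (Fin (r + c)) (MvPolynomial (Fin n) ℤ) :=
  (exists_rhoH n c f).choose

theorem eTop_pow_mul_rhoH (f : symmetricSubalgebra (Fin r) (MvPolynomial (Fin n) ℤ)) :
    eTop (MvPolynomial (Fin n) ℤ) (r + c) ^ c * rhoH n c f = (-1) ^ (c * r) * rhoHSum n c f :=
  (exists_rhoH n c f).choose_spec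

end Operator

section Geometry

variable {k : Type*} [Field k]

/-- The coordinate ring `k[x_ij]` of the space of `r × n` matrices. -/
abbrev CoordRing (k : Type*) [Field k] (r n : ℕ) : Type _ := MvPolynomial (Fin r × Fin n) k

/-- The affine space of `r × n` matrices over `k`, as a topological space: the prime spectrum of
its coordinate ring. Closed irreducible subsets are the closed subvarieties. -/
abbrev MatSpace (k : Type*) [Field k] (r n : ℕ) : Type _ := PrimeSpectrum (CoordRing k r n)

/-- The pullback of functions along `v ↦ g v t⁻¹`, that is `x_ij ↦ ∑ l, g_il x_lj t_j⁻¹`. -/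
def actHom {r n : ℕ} (g : Matrix.GeneralLinearGroup (Fin r) k) (t : Fin n → kˣ) :
    CoordRing k r n →ₐ[k] CoordRing k r n :=
  aeval fun p => ∑ l, C (g.1 p.1 l * ((t p.2)⁻¹ : kˣ)) * X (l, p.2)

/-- The action `v ↦ g v t⁻¹` of `(g, t)` in `GL_r(k) × (kˣ)^n` on the space of matrices. -/
def act {r n : ℕ} (g : Matrix.GeneralLinearGroup (Fin r) k) (t : Fin n → kˣ) :
    MatSpace k r n → MatSpace k r n :=
  PrimeSpectrum.comap (actHom g t).toRingHom

/-- Stability under the group `G_r = GL_r(k) × (kˣ)^n`. -/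
def IsStable {r n : ℕ} (X : Set (MatSpace k r n)) : Prop :=
  ∀ (g : Matrix.GeneralLinearGroup (Fin r) k) (t : Fin n → kˣ), act g t '' X ⊆ X

/-- The locus of matrices of rank at most `r - 1`: all `r × r` minors vanish. -/
def lowRankLocus (k : Type*) [Field k] (r n : ℕ) : Set (MatSpace k r n) :=
  PrimeSpectrum.zeroLocus (Set.range fun f : Fin r → Fin n =>
    (Matrix.of fun i j => (X (i, f j) : CoordRing k r n)).det)

/-- Restriction of functions along the inclusion that appends `c` zero rows to an `r × n` matrix. -/
def embedHom (k : Type*) [Field k] (r n c : ℕ) : CoordRing k (r + c) n →ₐ[k] CoordRing k r n :=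
  aeval fun p => Fin.addCases (fun i => X (i, p.2)) (fun _ => 0) p.1

/-- The inclusion of `r × n` matrices into `(r + c) × n` matrices, appending `c` zero rows. -/
def embed {r n : ℕ} (c : ℕ) : MatSpace k r n → MatSpace k (r + c) n :=
  PrimeSpectrum.comap (embedHom k r n c).toRingHom

/-- The closure of `GL_(r+c)(k) X` in the space of `(r + c) × n` matrices. -/
def raise {r n : ℕ} (c : ℕ) (X : Set (MatSpace k r n)) : Set (MatSpace k (r + c) n) :=
  closure (⋃ g : Matrix.GeneralLinearGroup (Fin (r + c)) k, act g 1 '' (embed c '' X))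

/-- The degree `a_i + b_j` of the variable `x_ij` in the grading by `ℤ^r × ℤ^n`. -/
def varDegree (r n : ℕ) (p : Fin r × Fin n) : (Fin r ⊕ Fin n) →₀ ℕ :=
  Finsupp.single (Sum.inl p.1) 1 + Finsupp.single (Sum.inr p.2) 1

/-- The multigraded Hilbert series of `k[x_ij] / I`, in which the variables indexed by `Sum.inl i`
are the `u_i` and those indexed by `Sum.inr j` are the `t_j`. -/
def hilb {r n : ℕ} (I : Ideal (CoordRing k r n)) : MvPowerSeries (Fin r ⊕ Fin n) ℤ :=
  fun d => (Module.finrank k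
    ((weightedHomogeneousSubmodule k (varDegree r n) d).map
      (Ideal.Quotient.mkₐ k I).toLinearMap) : ℤ)

/-- `K` is the `K`-polynomial of `k[x_ij] / I`: `Hilb = K / ∏ (1 - u_i t_j)`. -/
def IsKPolynomial {r n : ℕ} (I : Ideal (CoordRing k r n))
    (K : MvPolynomial (Fin r ⊕ Fin n) ℤ) : Prop :=
  (K : MvPowerSeries (Fin r ⊕ Fin n) ℤ) =
    hilb I * ∏ p : Fin r × Fin n,
      (1 - MvPowerSeries.X (Sum.inl p.1) * MvPowerSeries.X (Sum.inr p.2))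

/-- `γ` is the equivariant cohomology class `C(X)`, an element of `ℤ[u,t]^(S_r)`: the part of total
degree `codim X` of `K(X; 1 - u, 1 - t)`, where `K` is the `K`-polynomial of the reduced closed
subscheme `X`. Such a `γ` is unique, see `IsEquivariantClass.unique`. -/
def IsEquivariantClass {r n : ℕ} (X : Set (MatSpace k r n))
    (γ : symmetricSubalgebra (Fin r) (MvPolynomial (Fin n) ℤ)) : Prop :=
  ∃ (K : MvPolynomial (Fin r ⊕ Fin n) ℤ) (d : ℕ),
    IsKPolynomial (PrimeSpectrum.vanishingIdeal X) K ∧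
    (PrimeSpectrum.vanishingIdeal X).height = d ∧
    (γ : MvPolynomial (Fin r) (MvPolynomial (Fin n) ℤ)) =
      sumAlgEquiv ℤ (Fin r) (Fin n) (homogeneousComponent d
        (aeval (fun s => 1 - (MvPolynomial.X s : MvPolynomial (Fin r ⊕ Fin n) ℤ)) K))

theorem IsEquivariantClass.unique {r n : ℕ} {X : Set (MatSpace k r n)}
    {γ γ' : symmetricSubalgebra (Fin r) (MvPolynomial (Fin n) ℤ)}
    (h : IsEquivariantClass X γ) (h' : IsEquivariantClass X γ') : γ = γ' := by
  obtain ⟨K, d, hK, hd, h⟩ := h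
  obtain ⟨K', d', hK', hd', h'⟩ := h'
  have e1 : K = K' := MvPolynomial.coe_injective _ _ (hK.trans hK'.symm)
  have e2 : d = d' := by exact_mod_cast hd.symm.trans hd'
  subst e1 e2
  exact Subtype.ext (h.trans h'.symm)

end Geometry

end MatrixStabilization

end

open MvPolynomial MatrixStabilization

/-! Let `I` be the ideal of `X`, let `Q = k[x] / I`, and let `J_m` be the kernel of the comorphism
`mulHom` of `(a, x) ↦ a x`, where `a` is a generic `m × r` matrix and `x` the coordinate matrix over
`Q`. Stability of `X` and density of `GL` give `J_r = I` and identify `J_(r+c)` with the ideal of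
`ρ(X)`. It remains to compare the Hilbert series `H_m` of the rings `R_m / J_m` as `m` grows by one.

Adjoin an odd row `θ x`, with anticommuting `θ_1, …, θ_r`, to `m + 1` even rows `a x`. The part of
odd degree `p` is spanned by products of some `f(a x)` with `p × p` minors of `x` (`oddComp`); let
`O_p` be its Hilbert series, so that `O_0 = H_(m+1)`. For each row `i`, contraction (`θ ↦ a_i`) and
exterior derivative (`a_i ↦ θ`) preserve these spaces and satisfy Cartan's formula (`homotopy`). In
characteristic zero the contraction complex is therefore exact, except in odd degree `0`, where what
survives is the ring without row `i`. Thus `∑_p (-u_i)^p O_p` is `H_m` in the variables other than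
`u_i`. As `O_p = 0` for `p > r`, these are, for `r ≤ m`, `m + 1` equations in `O_0, …, O_m` with a
Vandermonde matrix. Cramer's rule gives `O_0`: with `V` the Vandermonde determinant, `V · K_(m+1) =
(-1)^m ∑_i (-1)^i ∏_b (1 - u_i t_b) · (u_0 ⋯ û_i ⋯ u_m · V · K_m)(û_i)` (`vdm_mul_kPolynomial`).

Expanding an alternant along its last column shows that `ρ_k` has the same form, with the weight
`u_i^k` in place of `∏_b (1 - u_i t_b)` (`vdm_mul_flat_rhoOp`). Both sides of the theorem are thus
iterates of row insertion operators `rowOp G`, which anticommute. Anticommutation collects the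
products of variables in the innermost place (`rowIter_eq`) and, after `u ↦ 1 - u`, trades the
weights `(1 - u)^i` for `u^i` (`rowComp_one_sub`). The lowest part of `1 - (1 - u)(1 - t) = u + t -
u t` is `u + t`, so passing to lowest terms turns one iterate into the other (`vdm_mul_lowest`,
`vdm_mul_flat_rhoH`).

Two facts make the relevant degree the codimension. Modulo `I`, `K(1 - u, 1 - t)` has no terms of
degree below `codim X`, by a decomposition of the standard monomials into cells
(`exists_kPolynomial`). And the codimension grows by `c (n - r)`, since on the locus of rank `r` the
generic point of `ρ(X)` is a point of `X` with `c` arbitrary combinations of its rows appended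
(`height_ker_mulHom`). -/

noncomputable section

namespace MatrixStabilization

/-! ### Even rows with one odd row: contraction, exterior derivative, Cartan's formula -/

section OddRow

variable {k : Type*} [Field k] {Q : Type*} [CommRing Q] [Algebra k Q] {m r n : ℕ}
  (x : Fin r → Fin n → Q)

/-- The comorphism of the multiplication map `(a, x) ↦ a x` for an `m × r` matrix `a` of
indeterminates and a fixed `r × n` matrix `x` over `Q`. -/
def mulHom (k : Type*) [Field k] {Q : Type*} [CommRing Q] [Algebra k Q] (m : ℕ) {r n : ℕ}
    (x : Fin r → Fin n → Q) : CoordRing k m n →ₐ[k] MvPolynomial (Fin m × Fin r) Q :=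
  aeval fun p => ∑ l, C (x l p.2) * X (p.1, l)

theorem mulHom_X (p : Fin m × Fin n) :
    mulHom k m x (X p) = ∑ l, C (x l p.2) * X (p.1, l) := by
  simp [mulHom]

/-- Chain rule for `(a, x) ↦ a x`: differentiating along `a_is` polarizes row `i` of the argument in
the direction of row `s` of `x`. -/
theorem pderiv_mulHom (i : Fin m) (s : Fin r) (f : CoordRing k m n) :
    pderiv (i, s) (mulHom k m x f) = ∑ b, mulHom k m x (pderiv (i, b) f) * C (x s b) := by
  induction f using MvPolynomial.induction_on with
  | C a =>
    have : mulHom k m x (C a) = C (algebraMap k Q a) := by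
      rw [← algebraMap_eq, AlgHom.commutes]; rfl
    rw [this]
    simp
  | add p q hp hq => simp [hp, hq, add_mul, Finset.sum_add_distrib]
  | mul_X p q hp =>
    rw [map_mul, Derivation.leibniz, hp, mulHom_X]
    simp only [Derivation.leibniz, map_add, smul_eq_mul, map_mul, add_mul, Finset.sum_add_distrib,
      map_sum, pderiv_X, pderiv_C, mul_zero, add_zero, mulHom_X]
    congr 1
    · obtain ⟨j, b⟩ := q
      by_cases h : j = i
      · subst h
        simp [Pi.single_apply, Finset.sum_ite_eq]
      · simp [h]
    · rw [Finset.mul_sum]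
      simp only [mul_assoc, Finset.sum_mul]

/-- The row degree part of Euler's identity. -/
theorem sum_X_mul_pderiv_row {D : (Fin m ⊕ Fin n) →₀ ℕ} {f : CoordRing k m n}
    (hf : f.IsWeightedHomogeneous (varDegree m n) D) (i : Fin m) :
    ∑ b, X (i, b) * pderiv (i, b) f = D (Sum.inl i) • f := by
  have h : f.IsWeightedHomogeneous (fun p : Fin m × Fin n => if p.1 = i then 1 else 0)
      (D (Sum.inl i)) := by
    intro d hd
    rw [← hf hd, Finsupp.weight_apply, Finsupp.weight_apply, Finsupp.sum, Finsupp.sum,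
      Finsupp.finsetSum_apply]
    refine Finset.sum_congr rfl fun p _ => ?_
    simp [varDegree, Finsupp.single_apply]
  rw [← h.sum_weight_X_mul_pderiv, Fintype.sum_prod_type]
  rw [Finset.sum_eq_single i]
  · simp
  · intro j _ hj; simp [hj]
  · simp

theorem sum_X_mul_pderiv_mulHom {D : (Fin m ⊕ Fin n) →₀ ℕ} {f : CoordRing k m n}
    (hf : f.IsWeightedHomogeneous (varDegree m n) D) (i : Fin m) :
    ∑ s, X (i, s) * pderiv (i, s) (mulHom k m x f) = D (Sum.inl i) • mulHom k m x f := by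
  rw [← map_nsmul, ← sum_X_mul_pderiv_row hf i, map_sum]
  simp only [pderiv_mulHom, Finset.mul_sum, map_mul, mulHom_X, Finset.sum_mul]
  rw [Finset.sum_comm]
  refine Finset.sum_congr rfl fun b _ => Finset.sum_congr rfl fun l _ => ?_
  ring

/-- The minors of `x`, with rows indexed by `l` and columns by `b`. -/
def minor {p : ℕ} (b : Fin p → Fin n) (l : Fin p → Fin r) : Q :=
  (Matrix.of fun i j => x (l i) (b j)).det

theorem minor_cons_row {p : ℕ} (b : Fin (p + 1) → Fin n) (s : Fin r) (l : Fin p → Fin r) :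
    minor x b (Fin.cons s l : Fin (p + 1) → Fin r)
      = ∑ j : Fin (p + 1), (-1) ^ (j : ℕ) * x s (b j) * minor x (b ∘ j.succAbove) l := by
  rw [minor, Matrix.det_succ_row_zero]
  rfl

theorem minor_cons_col {p : ℕ} (c : Fin n) (b : Fin p → Fin n) (l : Fin (p + 1) → Fin r) :
    minor x (Fin.cons c b : Fin (p + 1) → Fin n) l
      = ∑ j : Fin (p + 1), (-1) ^ (j : ℕ) * x (l j) c * minor x b (l ∘ j.succAbove) := by
  rw [minor, Matrix.det_succ_column_zero]
  rfl

/-- Moving row `J` to the front is a cycle of sign `(-1) ^ J`. This is the form of alternation that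
the homotopy computation needs. -/
theorem minor_cons_succAbove {p : ℕ} (b : Fin (p + 1) → Fin n) (l : Fin (p + 1) → Fin r)
    (J : Fin (p + 1)) :
    minor x b (Fin.cons (l J) (l ∘ J.succAbove) : Fin (p + 1) → Fin r)
      = (-1) ^ (J : ℕ) * minor x b l := by
  have h : (Fin.cons (l J) (l ∘ J.succAbove) : Fin (p + 1) → Fin r) = l ∘ J.cycleRange.symm := by
    funext i
    refine Fin.cases ?_ (fun i => ?_) i
    · simp
    · simp [Fin.cycleRange_symm_succ]
  rw [h, minor, minor]
  have := Matrix.det_permute J.cycleRange.symm (Matrix.of fun i j => x (l i) (b j))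
  rw [Equiv.Perm.sign_symm, Fin.sign_cycleRange] at this
  rw [show (Matrix.of fun i j => x ((l ∘ J.cycleRange.symm) i) (b j)) = (Matrix.of fun i j => x (l i) (b j)).submatrix J.cycleRange.symm id from rfl, this]
  simp

/-- The `k`-space of degree `W` and odd degree `p` in the coordinate ring of `m` even rows and one
odd row, in coordinates: it is spanned by `l ↦ f(a x) · minor_{l, b}(x)`. -/
def oddComp (k : Type*) [Field k] {Q : Type*} [CommRing Q] [Algebra k Q] (m : ℕ) {r n : ℕ}
    (x : Fin r → Fin n → Q) (p : ℕ) (W : (Fin m ⊕ Fin n) →₀ ℕ) :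
    Submodule k ((Fin p → Fin r) → MvPolynomial (Fin m × Fin r) Q) :=
  Submodule.span k {ω | ∃ (b : Fin p → Fin n) (D : (Fin m ⊕ Fin n) →₀ ℕ) (f : CoordRing k m n),
    f.IsWeightedHomogeneous (varDegree m n) D ∧
    D + ∑ j, Finsupp.single (Sum.inr (b j)) 1 = W ∧
    ω = fun l => mulHom k m x f * C (minor x b l)}

/-- Contraction with row `i`. -/
def contract (k : Type*) [Field k] {Q : Type*} [CommRing Q] [Algebra k Q] {m r : ℕ} (p : ℕ)
    (i : Fin m) :
    ((Fin (p + 1) → Fin r) → MvPolynomial (Fin m × Fin r) Q) →ₗ[k]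
      ((Fin p → Fin r) → MvPolynomial (Fin m × Fin r) Q) where
  toFun ω l := ∑ s, X (i, s) * ω (Fin.cons s l)
  map_add' ω ω' := by
    funext l; simp [mul_add, Finset.sum_add_distrib]
  map_smul' a ω := by
    funext l; simp [Finset.smul_sum]

/-- The exterior derivative with respect to row `i`. -/
def extDeriv (k : Type*) [Field k] {Q : Type*} [CommRing Q] [Algebra k Q] {m r : ℕ} (p : ℕ)
    (i : Fin m) :
    ((Fin p → Fin r) → MvPolynomial (Fin m × Fin r) Q) →ₗ[k]
      ((Fin (p + 1) → Fin r) → MvPolynomial (Fin m × Fin r) Q) where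
  toFun ω l := ∑ j : Fin (p + 1), (-1) ^ (j : ℕ) * pderiv (i, l j) (ω (l ∘ j.succAbove))
  map_add' ω ω' := by
    funext l; simp [mul_add, Finset.sum_add_distrib]
  map_smul' a ω := by
    funext l
    simp only [Pi.smul_apply, RingHom.id_apply, Finset.smul_sum]
    refine Finset.sum_congr rfl fun j _ => ?_
    rw [← mul_smul_comm]
    congr 1
    exact LinearMap.map_smul_of_tower (pderiv (i, l j)).toLinearMap a (ω _)

/-- Laplace expansion of the minor along its first row: contraction replaces the odd variable in
column `b_j` by the even variable `x_(i, b_j)`. Since `W` does not count the odd row, the degree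
gains exactly one `u_i`. -/
theorem contract_mem {p : ℕ} {W : (Fin m ⊕ Fin n) →₀ ℕ} (i : Fin m)
    {ω : (Fin (p + 1) → Fin r) → MvPolynomial (Fin m × Fin r) Q}
    (hω : ω ∈ oddComp k m x (p + 1) W) :
    contract k p i ω ∈ oddComp k m x p (W + Finsupp.single (Sum.inl i) 1) := by
  induction hω using Submodule.span_induction with
  | zero => simp
  | add a b _ _ ha hb => rw [map_add]; exact add_mem ha hb
  | smul c a _ ha => rw [map_smul]; exact Submodule.smul_mem _ _ ha
  | mem ω hω =>
    obtain ⟨b, D, f, hf, hW, rfl⟩ := hω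
    have h : contract k p i (fun l : Fin (p + 1) → Fin r => mulHom k m x f * C (minor x b l))
        = ∑ j : Fin (p + 1), (-1 : k) ^ (j : ℕ) •
          fun l => mulHom k m x (X (i, b j) * f) * C (minor x (b ∘ j.succAbove) l) := by
      funext l
      simp only [contract, LinearMap.coe_mk, AddHom.coe_mk, minor_cons_row, Finset.sum_apply,
        Pi.smul_apply, map_sum, map_mul, mulHom_X, Finset.sum_mul, Finset.mul_sum, Finset.smul_sum]
      rw [Finset.sum_comm]
      refine Finset.sum_congr rfl fun j _ => Finset.sum_congr rfl fun s _ => ?_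
      simp only [map_pow, map_neg, map_one]
      -- The parity cases only identify the sign taken as a scalar in `k` with the sign in the
      -- polynomial ring.
      rcases neg_one_pow_eq_or k (j : ℕ) with h | h <;> 
      rcases neg_one_pow_eq_or (MvPolynomial (Fin m × Fin r) Q) (j : ℕ) with h' | h' <;>
      rcases Nat.even_or_odd (j : ℕ) with he | he <;>
      simp only [he.neg_one_pow] <;> simp <;> ring
    rw [h]
    refine Submodule.sum_mem _ fun j _ => Submodule.smul_mem _ _ (Submodule.subset_span ?_)
    refine ⟨_, _, _, (isWeightedHomogeneous_X k (varDegree m n) (i, b j)).mul hf, ?_, rfl⟩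
    rw [← hW, Fin.sum_univ_succAbove _ j]
    simp only [varDegree, Function.comp]
    abel

theorem pderiv_eq_zero_of_not_le {D : (Fin m ⊕ Fin n) →₀ ℕ} {f : CoordRing k m n}
    (hf : f.IsWeightedHomogeneous (varDegree m n) D) {p : Fin m × Fin n}
    (hp : ¬ varDegree m n p ≤ D) : pderiv p f = 0 := by
  apply pderiv_eq_zero_of_notMem_vars
  rw [mem_vars_iff_mem_support]
  rintro ⟨d, hd, hb⟩
  apply hp
  rw [← hf (mem_support_iff.1 hd), Finsupp.weight_apply]
  refine le_trans ?_ (Finset.single_le_sum (f := fun a => d a • varDegree m n a)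
    (fun _ _ => zero_le) hb)
  have : 1 ≤ d p := Nat.one_le_iff_ne_zero.2 (Finsupp.mem_support_iff.1 hb)
  calc varDegree m n p = 1 • varDegree m n p := (one_smul _ _).symm
    _ ≤ _ := nsmul_le_nsmul_left zero_le this

theorem isWeightedHomogeneous_pderiv {D D' : (Fin m ⊕ Fin n) →₀ ℕ} {f : CoordRing k m n}
    (hf : f.IsWeightedHomogeneous (varDegree m n) D) {p : Fin m × Fin n}
    (hp : D' + varDegree m n p = D) :
    (pderiv p f).IsWeightedHomogeneous (varDegree m n) D' := by
  intro d hd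
  rw [coeff_pderiv] at hd
  have h := hf (left_ne_zero_of_mul hd)
  rw [map_add, Finsupp.weight_single, one_smul, ← hp] at h
  exact add_right_cancel h

theorem pderiv_eq_zero_of_row_degree {D : (Fin m ⊕ Fin n) →₀ ℕ} {f : CoordRing k m n}
    (hf : f.IsWeightedHomogeneous (varDegree m n) D) {i : Fin m} (hi : D (Sum.inl i) = 0)
    (b : Fin n) : pderiv (i, b) f = 0 := by
  refine pderiv_eq_zero_of_not_le hf fun h => ?_
  have h3 := h (Sum.inl i)
  simp [varDegree, hi] at h3

/-- The minors of `x` are constants for a derivative in `a`, so only `f` is differentiated; the new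
factor `(θ x)_c` enters by Laplace expansion along a new first column. -/
theorem extDeriv_mulHom {p : ℕ} (i : Fin m) (f : CoordRing k m n) (b : Fin p → Fin n) :
    extDeriv k p i (fun l : Fin p → Fin r => mulHom k m x f * C (minor x b l))
        = ∑ c : Fin n, fun l => mulHom k m x (pderiv (i, c) f) *
          C (minor x (Fin.cons c b : Fin (p + 1) → Fin n) l) := by
  funext l
  simp only [extDeriv, LinearMap.coe_mk, AddHom.coe_mk, minor_cons_col, Finset.sum_apply,
    Derivation.leibniz, pderiv_C, smul_zero, zero_add, pderiv_mulHom, map_sum, map_mul,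
    Finset.smul_sum, Finset.mul_sum]
  rw [Finset.sum_comm]
  refine Finset.sum_congr rfl fun j _ => Finset.sum_congr rfl fun s _ => ?_
  simp only [map_pow, map_neg, map_one, smul_eq_mul]
  ring

theorem extDeriv_mem {p : ℕ} {W : (Fin m ⊕ Fin n) →₀ ℕ} (i : Fin m)
    {ω : (Fin p → Fin r) → MvPolynomial (Fin m × Fin r) Q}
    (hω : ω ∈ oddComp k m x p (W + Finsupp.single (Sum.inl i) 1)) :
    extDeriv k p i ω ∈ oddComp k m x (p + 1) W := by
  induction hω using Submodule.span_induction with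
  | zero => simp
  | add a b _ _ ha hb => rw [map_add]; exact add_mem ha hb
  | smul c a _ ha => rw [map_smul]; exact Submodule.smul_mem _ _ ha
  | mem ω hω =>
    obtain ⟨b, D, f, hf, hW, rfl⟩ := hω
    rw [extDeriv_mulHom]
    refine Submodule.sum_mem _ fun c _ => ?_
    -- When `x_ic` does not fit into the degree `D`, the truncated difference is meaningless, but
    -- then the derivative vanishes.
    by_cases hc : varDegree m n (i, c) ≤ D
    · have hD := tsub_add_cancel_of_le hc
      obtain ⟨D', hD'⟩ : ∃ D', D' = D - varDegree m n (i, c) := ⟨_, rfl⟩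
      rw [← hD'] at hD
      have hp : (pderiv (i, c) f).IsWeightedHomogeneous (varDegree m n) D' :=
        isWeightedHomogeneous_pderiv hf hD
      refine Submodule.subset_span ⟨Fin.cons c b, D', pderiv (i, c) f, hp, ?_, rfl⟩
      rw [Fin.sum_univ_succ]
      simp only [Fin.cons_zero, Fin.cons_succ]
      apply add_right_cancel (b := Finsupp.single (Sum.inl i) 1)
      rw [← hW, ← hD]
      simp only [varDegree]
      abel
    · simp only [pderiv_eq_zero_of_not_le hf hc, map_zero, zero_mul]
      exact zero_mem _

theorem extDeriv_eq_zero {p : ℕ} {W : (Fin m ⊕ Fin n) →₀ ℕ} {i : Fin m} (hi : W (Sum.inl i) = 0)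
    {ω : (Fin p → Fin r) → MvPolynomial (Fin m × Fin r) Q}
    (hω : ω ∈ oddComp k m x p W) : extDeriv k p i ω = 0 := by
  induction hω using Submodule.span_induction with
  | zero => simp
  | add a b _ _ ha hb => rw [map_add, ha, hb, add_zero]
  | smul c a _ ha => rw [map_smul, ha, smul_zero]
  | mem ω hω =>
    obtain ⟨b, D, f, hf, rfl, rfl⟩ := hω
    rw [extDeriv_mulHom]
    have hD : D (Sum.inl i) = 0 := by
      have : D (Sum.inl i) ≤ _ := le_self_add.trans hi.le
      simpa using this
    simp only [pderiv_eq_zero_of_row_degree hf hD, map_zero, zero_mul]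
    exact Finset.sum_const_zero

theorem oddComp_cons_succAbove {p : ℕ} {W : (Fin m ⊕ Fin n) →₀ ℕ}
    {ω : (Fin (p + 1) → Fin r) → MvPolynomial (Fin m × Fin r) Q}
    (hω : ω ∈ oddComp k m x (p + 1) W) (l : Fin (p + 1) → Fin r) (j : Fin (p + 1)) :
    ω (Fin.cons (l j) (l ∘ j.succAbove)) = (-1) ^ (j : ℕ) * ω l := by
  induction hω using Submodule.span_induction with
  | zero => simp
  | add a b _ _ ha hb => simp only [Pi.add_apply, ha, hb, mul_add]
  | smul c a _ ha => simp only [Pi.smul_apply, ha, mul_smul_comm]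
  | mem ω hω =>
    obtain ⟨b, D, f, hf, rfl, rfl⟩ := hω
    simp only [minor_cons_succAbove, map_mul, map_pow, map_neg, map_one]
    ring

/-- More than `r` rows chosen among `r` must repeat. This bounds the complex, and hence the number
of unknown series by `r + 1`. -/
theorem oddComp_eq_bot {p : ℕ} (hp : r < p) (W : (Fin m ⊕ Fin n) →₀ ℕ) :
    oddComp k m x p W = ⊥ := by
  rw [oddComp, Submodule.span_eq_bot]
  rintro _ ⟨b, D, f, hf, rfl, rfl⟩
  funext l
  have : minor x b l = 0 := by
    obtain ⟨i, j, hij, hl⟩ := Fintype.exists_ne_map_eq_of_card_lt l (by simpa using hp)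
    exact Matrix.det_zero_of_row_eq hij (by funext c; simp [hl])
  simp [this]

theorem euler_oddComp {p : ℕ} {W : (Fin m ⊕ Fin n) →₀ ℕ} (i : Fin m)
    {ω : (Fin p → Fin r) → MvPolynomial (Fin m × Fin r) Q}
    (hω : ω ∈ oddComp k m x p W) (l : Fin p → Fin r) :
    ∑ s, X (i, s) * pderiv (i, s) (ω l) = W (Sum.inl i) • ω l := by
  induction hω using Submodule.span_induction with
  | zero => simp
  | add a b _ _ ha hb =>
    simp only [Pi.add_apply, map_add, mul_add, Finset.sum_add_distrib, ha, hb, smul_add]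
  | smul c a _ ha =>
    simp only [Pi.smul_apply]
    rw [smul_comm, ← ha, Finset.smul_sum]
    refine Finset.sum_congr rfl fun j _ => ?_
    rw [← mul_smul_comm]
    congr 1
    exact LinearMap.map_smul_of_tower (pderiv (i, j)).toLinearMap c (a l)
  | mem ω hω =>
    obtain ⟨b, D, f, hf, rfl, rfl⟩ := hω
    have h := sum_X_mul_pderiv_mulHom x hf i
    simp only [Derivation.leibniz, pderiv_C, smul_eq_mul]
    have e : (D + ∑ j, Finsupp.single (Sum.inr (b j)) 1 : (Fin m ⊕ Fin n) →₀ ℕ) (Sum.inl i)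
        = D (Sum.inl i) := by simp
    rw [e, ← smul_mul_assoc, ← h, Finset.sum_mul]
    refine Finset.sum_congr rfl fun j _ => ?_
    ring

theorem contract_extDeriv_zero {W : (Fin m ⊕ Fin n) →₀ ℕ} (i : Fin m)
    {ω : (Fin 0 → Fin r) → MvPolynomial (Fin m × Fin r) Q} (hω : ω ∈ oddComp k m x 0 W) :
    contract k 0 i (extDeriv k 0 i ω) = W (Sum.inl i) • ω := by
  funext l
  rw [Pi.smul_apply, ← euler_oddComp x i hω l]
  simp only [contract, extDeriv, LinearMap.coe_mk, AddHom.coe_mk]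
  refine Finset.sum_congr rfl fun s _ => ?_
  simp

/-- Cartan's formula for the Euler field of row `i`. Its eigenvalue is the polynomial degree `W_i`
plus the form degree `p + 1`, hence never zero. -/
theorem homotopy {p : ℕ} {W : (Fin m ⊕ Fin n) →₀ ℕ} (i : Fin m)
    {ω : (Fin (p + 1) → Fin r) → MvPolynomial (Fin m × Fin r) Q}
    (hω : ω ∈ oddComp k m x (p + 1) W) :
    contract k (p + 1) i (extDeriv k (p + 1) i ω) + extDeriv k p i (contract k p i ω)
      = (W (Sum.inl i) + (p + 1)) • ω := by
  funext l
  -- The term `j = 0` of the derivative is the Euler operator on `ω l`; the others form a double sum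
  -- that occurs with the opposite sign in `h2`.
  have h1 : contract k (p + 1) i (extDeriv k (p + 1) i ω) l = ∑ s, X (i, s) * pderiv (i, s) (ω l)
      - ∑ s, ∑ j : Fin (p + 1), (-1) ^ (j : ℕ) * (X (i, s) *
          pderiv (i, l j) (ω (Fin.cons s (l ∘ j.succAbove)))) := by
    simp only [contract, extDeriv, LinearMap.coe_mk, AddHom.coe_mk]
    rw [← Finset.sum_sub_distrib]
    refine Finset.sum_congr rfl fun s _ => ?_
    rw [Fin.sum_univ_succ, mul_add, sub_eq_add_neg]
    congr 1
    · simp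
    · rw [Finset.mul_sum, ← Finset.sum_neg_distrib]
      refine Finset.sum_congr rfl fun j _ => ?_
      have : (Fin.cons s l : Fin (p + 2) → Fin r) ∘ j.succ.succAbove
          = Fin.cons s (l ∘ j.succAbove) := by
        funext t
        refine Fin.cases ?_ (fun t => ?_) t <;> simp
      rw [this]
      simp only [Fin.val_succ, Fin.cons_succ, pow_succ]
      ring
  -- The derivative may hit the coefficient `a_is`, which forces `s = l j`; by alternation each of
  -- the `p + 1` values of `j` then contributes one copy of `ω l`.
  have h2 : extDeriv k p i (contract k p i ω) l = (p + 1) • ω l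
      + ∑ s, ∑ j : Fin (p + 1), (-1) ^ (j : ℕ) * (X (i, s) *
          pderiv (i, l j) (ω (Fin.cons s (l ∘ j.succAbove)))) := by
    simp only [contract, extDeriv, LinearMap.coe_mk, AddHom.coe_mk]
    have hc : (p + 1) • ω l = ∑ _j : Fin (p + 1), ω l := by simp
    rw [Finset.sum_comm, hc, ← Finset.sum_add_distrib]
    refine Finset.sum_congr rfl fun j _ => ?_
    rw [map_sum]
    simp only [Derivation.leibniz, pderiv_X, smul_eq_mul, Finset.sum_add_distrib, mul_add]
    rw [add_comm]
    congr 1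
    · rw [Finset.sum_eq_single (l j)]
      · simp only [Pi.single_eq_same, mul_one]
        rw [oddComp_cons_succAbove x hω, ← mul_assoc, ← mul_pow]
        simp
      · intro s _ hs
        rw [Pi.single_eq_of_ne (by simpa using hs), mul_zero]
      · simp
    · rw [Finset.mul_sum]
  rw [Pi.add_apply, h1, h2, euler_oddComp x i hω l, Pi.smul_apply, add_smul]
  ring

/-- The symmetric product `a_is a_it` is paired with a form alternating in `s` and `t`, so the sum
equals its own negative. -/
theorem contract_contract [CharZero k] {p : ℕ} {W : (Fin m ⊕ Fin n) →₀ ℕ} (i : Fin m)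
    {ω : (Fin (p + 2) → Fin r) → MvPolynomial (Fin m × Fin r) Q}
    (hω : ω ∈ oddComp k m x (p + 2) W) : contract k p i (contract k (p + 1) i ω) = 0 := by
  funext l
  have h : contract k p i (contract k (p + 1) i ω) l
      = - contract k p i (contract k (p + 1) i ω) l := by
    simp only [contract, LinearMap.coe_mk, AddHom.coe_mk, Finset.mul_sum]
    conv_lhs => rw [Finset.sum_comm]
    rw [← Finset.sum_neg_distrib]
    refine Finset.sum_congr rfl fun s _ => ?_
    rw [← Finset.sum_neg_distrib]
    refine Finset.sum_congr rfl fun t _ => ?_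
    -- Moving the entry at position `1` to the front swaps the first two indices.
    have h := oddComp_cons_succAbove x hω (Fin.cons t (Fin.cons s l)) 1
    have e : (Fin.cons t (Fin.cons s l) : Fin (p + 2) → Fin r) ∘ (1 : Fin (p + 2)).succAbove
        = Fin.cons t l := by
      funext j
      refine Fin.cases ?_ (fun j => ?_) j
      · simp
      · rw [Function.comp, ← Fin.succ_zero_eq_one, Fin.succ_succAbove_succ, Fin.cons_succ]
        simp
    rw [e] at h
    have e1 : (Fin.cons t (Fin.cons s l) : Fin (p + 2) → Fin r) 1 = s := by
      rw [← Fin.succ_zero_eq_one, Fin.cons_succ, Fin.cons_zero]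
    rw [e1] at h
    rw [h]
    simp
    ring
  have h2 : (2 : k) • contract k p i (contract k (p + 1) i ω) l = 0 := by
    rw [two_smul]
    nth_rw 1 [h]
    simp
  exact (smul_eq_zero.1 h2).resolve_left two_ne_zero

end OddRow

/-! ### Exactness of the contraction complex and its Euler characteristic -/

section OddRowSeries

theorem finrank_map_eq_of_ker {k V M M' : Type*} [Field k] [AddCommGroup V] [Module k V]
    [AddCommGroup M] [Module k M] [AddCommGroup M'] [Module k M'] (S : Submodule k V)
    (f : V →ₗ[k] M) (g : V →ₗ[k] M') (h : ∀ v ∈ S, f v = 0 ↔ g v = 0) :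
    Module.finrank k (S.map f) = Module.finrank k (S.map g) := by
  rw [← LinearMap.range_domRestrict, ← LinearMap.range_domRestrict]
  refine LinearEquiv.finrank_eq ((LinearMap.quotKerEquivRange _).symm.trans
    ((Submodule.quotEquivOfEq _ _ ?_).trans (LinearMap.quotKerEquivRange _)))
  ext v
  simpa using h v.1 v.2

theorem finite_weight_le {m n : ℕ} (W : (Fin m ⊕ Fin n) →₀ ℕ) :
    {d : Fin m × Fin n →₀ ℕ | Finsupp.weight (varDegree m n) d ≤ W}.Finite := by
  refine (Set.finite_Iic (Finsupp.equivFunOnFinite.symm fun p : Fin m × Fin n =>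
    W (Sum.inl p.1))).subset fun d hd p => ?_
  have h := hd (Sum.inl p.1)
  rw [Finsupp.weight_apply, Finsupp.sum, Finsupp.finsetSum_apply] at h
  refine le_trans ?_ h
  by_cases hp : p ∈ d.support
  · refine le_trans ?_ (Finset.single_le_sum (f := fun a => (d a • varDegree m n a) (Sum.inl p.1))
      (fun _ _ => zero_le) hp)
    simp [varDegree]
  · simp [Finsupp.notMem_support_iff.1 hp]

variable {k : Type*} [Field k] {Q : Type*} [CommRing Q] [Algebra k Q] {m r n : ℕ}
  (x : Fin r → Fin n → Q)

instance finiteDimensional_oddComp (p : ℕ) (W : (Fin m ⊕ Fin n) →₀ ℕ) :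
    FiniteDimensional k (oddComp k m x p W) := by
  have hfin : Set.Finite ((fun q : (Fin p → Fin n) × (Fin m × Fin n →₀ ℕ) =>
      fun l : Fin p → Fin r => mulHom k m x (monomial q.2 1) * C (minor x q.1 l)) ''
      (Set.univ ×ˢ {d | Finsupp.weight (varDegree m n) d ≤ W})) :=
    (Set.finite_univ.prod (finite_weight_le W)).image _
  have := FiniteDimensional.span_of_finite k hfin
  refine Submodule.finiteDimensional_of_le (S₂ := Submodule.span k
    ((fun q : (Fin p → Fin n) × (Fin m × Fin n →₀ ℕ) =>
      fun l : Fin p → Fin r => mulHom k m x (monomial q.2 1) * C (minor x q.1 l)) ''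
      (Set.univ ×ˢ {d | Finsupp.weight (varDegree m n) d ≤ W}))) (Submodule.span_le.2 ?_)
  rintro _ ⟨b, D, f, hf, rfl, rfl⟩
  have h : (fun l => mulHom k m x f * C (minor x b l)) = ∑ d ∈ f.support, coeff d f •
      fun l : Fin p → Fin r => mulHom k m x (monomial d 1) * C (minor x b l) := by
    funext l
    conv_lhs => rw [f.as_sum]
    simp only [map_sum, Finset.sum_mul, Finset.sum_apply, Pi.smul_apply]
    refine Finset.sum_congr rfl fun d _ => ?_
    rw [← smul_mul_assoc, ← map_smul, smul_monomial, smul_eq_mul, mul_one]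
  rw [h]
  refine Submodule.sum_mem _ fun d hd => Submodule.smul_mem _ _ (Submodule.subset_span ?_)
  refine ⟨(b, d), ⟨Set.mem_univ _, ?_⟩, rfl⟩
  rw [Set.mem_ofPred_eq, hf (mem_support_iff.1 hd)]
  exact le_self_add

/-- The generating function of the dimensions of the components of odd degree `p`. -/
def oddSeries (k : Type*) [Field k] {Q : Type*} [CommRing Q] [Algebra k Q] (m : ℕ) {r n : ℕ}
    (x : Fin r → Fin n → Q) (p : ℕ) : MvPowerSeries (Fin m ⊕ Fin n) ℤ :=
  fun W => (Module.finrank k (oddComp k m x p W) : ℤ)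

/-- The generating function of the ranks of the contractions with row `i`. -/
def rankSeries (k : Type*) [Field k] {Q : Type*} [CommRing Q] [Algebra k Q] {m : ℕ} {r n : ℕ}
    (x : Fin r → Fin n → Q) (i : Fin m) (p : ℕ) : MvPowerSeries (Fin m ⊕ Fin n) ℤ :=
  fun W => (Module.finrank k ((oddComp k m x (p + 1) W).map (contract k p i)) : ℤ)

theorem oddComp_zero (W : (Fin m ⊕ Fin n) →₀ ℕ) :
    oddComp k m x 0 W = (weightedHomogeneousSubmodule k (varDegree m n) W).map
      ((LinearMap.pi fun _ => LinearMap.id : MvPolynomial (Fin m × Fin r) Q →ₗ[k]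
        ((Fin 0 → Fin r) → MvPolynomial (Fin m × Fin r) Q)).comp (mulHom k m x).toLinearMap) := by
  apply le_antisymm
  · refine Submodule.span_le.2 ?_
    rintro _ ⟨b, D, f, hf, hW, rfl⟩
    simp only [Finset.univ_eq_empty, Finset.sum_empty, add_zero] at hW
    subst hW
    exact ⟨f, hf, by funext l; simp [minor]⟩
  · rintro _ ⟨f, hf, rfl⟩
    exact Submodule.subset_span ⟨Fin.elim0, W, f, hf, by simp, by funext l; simp [minor]⟩

theorem oddSeries_zero : oddSeries k m x 0 = hilb (RingHom.ker (mulHom k m x)) := by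
  funext W
  rw [oddSeries, hilb, oddComp_zero]
  congr 1
  apply finrank_map_eq_of_ker
  intro f _
  simp only [LinearMap.comp_apply, AlgHom.toLinearMap_apply, Ideal.Quotient.mkₐ_eq_mk,
    Ideal.Quotient.eq_zero_iff_mem, RingHom.mem_ker]
  constructor
  · intro h; exact congrFun h Fin.elim0
  · intro h; funext l; exact h

theorem mem_of_nsmul_eq [CharZero k] {V : Type*} [AddCommGroup V] [Module k V] {N : ℕ} (hN : N ≠ 0) {v w : V}
    (h : w = N • v) (S : Submodule k V) (hw : w ∈ S) : v ∈ S := by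
  have hN' : (N : k) ≠ 0 := Nat.cast_ne_zero.2 hN
  rw [← Nat.cast_smul_eq_nsmul k] at h
  have : v = (N : k)⁻¹ • w := by rw [h, smul_smul, inv_mul_cancel₀ hN', one_smul]
  rw [this]
  exact S.smul_mem _ hw

/-- Rank-nullity for the contraction, whose kernel is the image of the previous contraction. That
image comes from a degree lower by one `u_i`, whence the factor. -/
theorem oddSeries_succ [CharZero k] (i : Fin m) (p : ℕ) :
    oddSeries k m x (p + 1) = rankSeries k x i p
      + MvPowerSeries.X (Sum.inl i) * rankSeries k x i (p + 1) := by
  ext W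
  rw [map_add, MvPowerSeries.X, MvPowerSeries.coeff_monomial_mul, one_mul]
  change (Module.finrank k (oddComp k m x (p + 1) W) : ℤ)
    = (Module.finrank k ((oddComp k m x (p + 1) W).map (contract k p i)) : ℤ) + _
  have hrn := LinearMap.finrank_range_add_finrank_ker
    ((contract k p i).domRestrict (oddComp k m x (p + 1) W))
  rw [LinearMap.range_domRestrict] at hrn
  rw [← hrn, Nat.cast_add]
  congr 1
  have hker : Module.finrank k (LinearMap.ker
      ((contract k p i).domRestrict (oddComp k m x (p + 1) W)))
      = Module.finrank k ((LinearMap.ker (contract k p i) ⊓ oddComp k m x (p + 1) W :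
        Submodule k _)) := by
    rw [LinearMap.ker_domRestrict]
    have := (Submodule.equivSubtypeMap (oddComp k m x (p + 1) W)
      (Submodule.comap (oddComp k m x (p + 1) W).subtype (LinearMap.ker (contract k p i)))).finrank_eq
    rw [Submodule.map_comap_subtype, inf_comm] at this
    exact this
  rw [hker]
  split_ifs with hi
  · change _ = (Module.finrank k ((oddComp k m x (p + 1 + 1)
      (W - Finsupp.single (Sum.inl i) 1)).map (contract k (p + 1) i)) : ℤ)
    have hW := tsub_add_cancel_of_le hi
    set W' := W - Finsupp.single (Sum.inl i) 1
    rw [← hW]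
    refine congrArg (fun S : Submodule k _ => (Module.finrank k S : ℤ)) ?_
    apply le_antisymm
    -- For a cycle, `homotopy` loses its second term: up to a nonzero integer it is the contraction
    -- of its own derivative.
    · rintro ω ⟨h0, hω⟩
      have h := homotopy x i hω
      rw [LinearMap.mem_ker.1 h0, map_zero, add_zero] at h
      exact mem_of_nsmul_eq (k := k) (by omega) h _
        (Submodule.mem_map_of_mem (extDeriv_mem x i hω))
    · rintro _ ⟨ω, hω, rfl⟩
      exact ⟨contract_contract x i hω, contract_mem x i hω⟩
  · have hi' : W (Sum.inl i) = 0 := by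
      by_contra h
      exact hi (Finsupp.single_le_iff.2 (Nat.one_le_iff_ne_zero.2 h))
    rw [Nat.cast_eq_zero]
    -- In degree zero in row `i` there is nothing to differentiate, so both terms of `homotopy`
    -- vanish on a cycle.
    have : LinearMap.ker (contract k p i) ⊓ oddComp k m x (p + 1) W = ⊥ := by
      rw [eq_bot_iff]
      rintro ω ⟨h0, hω⟩
      have h := homotopy x i hω
      rw [LinearMap.mem_ker.1 h0, map_zero, extDeriv_eq_zero x hi' hω, map_zero, add_zero] at h
      exact mem_of_nsmul_eq (k := k) (by omega) h _ (zero_mem _)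
    rw [this, finrank_bot]

/-- The embedding of the variables that leaves out `u_i`. -/
def skip (n : ℕ) {m : ℕ} (i : Fin (m + 1)) : Fin m ⊕ Fin n ↪ Fin (m + 1) ⊕ Fin n :=
  i.succAboveEmb.sumMap (Function.Embedding.refl _)

@[simp] theorem skip_inl (i : Fin (m + 1)) (j : Fin m) :
    skip n i (Sum.inl j) = Sum.inl (i.succAbove j) := rfl

@[simp] theorem skip_inr (i : Fin (m + 1)) (j : Fin n) : skip n i (Sum.inr j) = Sum.inr j := rfl

theorem embDomain_skip_inl (i : Fin (m + 1)) (W : (Fin m ⊕ Fin n) →₀ ℕ) :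
    Finsupp.embDomain (skip n i) W (Sum.inl i) = 0 :=
  Finsupp.embDomain_of_notMem_range _ _ _ (by rintro ⟨a | a, ha⟩ <;> simp at ha)

theorem weight_mapDomain_succAbove (i : Fin (m + 1)) (d : Fin m × Fin n →₀ ℕ) :
    Finsupp.weight (varDegree (m + 1) n)
      (Finsupp.mapDomain (Prod.map i.succAbove id) d)
      = Finsupp.embDomain (skip n i) (Finsupp.weight (varDegree m n) d) := by
  rw [Finsupp.embDomain_eq_mapDomain]
  induction d using Finsupp.induction_linear with
  | zero => simp
  | add f g hf hg => rw [Finsupp.mapDomain_add, map_add, hf, hg, map_add, Finsupp.mapDomain_add]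
  | single p a =>
    simp only [Finsupp.mapDomain_single, Finsupp.weight_single, varDegree, Finsupp.mapDomain_smul,
      Finsupp.mapDomain_add, Prod.map_fst, Prod.map_snd, id, skip_inl, skip_inr]

theorem mulHom_rename (i : Fin (m + 1)) (f : CoordRing k m n) :
    mulHom k (m + 1) x (rename (Prod.map i.succAbove id) f)
      = rename (Prod.map i.succAbove id) (mulHom k m x f) := by
  have : (mulHom k (m + 1) x).comp (rename (Prod.map i.succAbove id))
      = ((rename (R := Q) (Prod.map i.succAbove id)).restrictScalars k).comp (mulHom k m x) := by
    apply algHom_ext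
    intro p
    simp [mulHom]
  exact DFunLike.congr_fun this f

theorem injective_succAbove_prod {α : Type*} (i : Fin (m + 1)) :
    Function.Injective (Prod.map i.succAbove id : Fin m × α → Fin (m + 1) × α) :=
  i.succAbove_right_injective.prodMap Function.injective_id

/-- A polynomial of degree zero in `u_i` does not involve row `i`, so it is a relabelled polynomial
in the `m` other rows, and `mulHom` commutes with the relabelling. -/
theorem finrank_oddComp_skip (i : Fin (m + 1)) (W : (Fin m ⊕ Fin n) →₀ ℕ) :
    Module.finrank k (oddComp k (m + 1) x 0 (Finsupp.embDomain (skip n i) W))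
      = Module.finrank k (oddComp k m x 0 W) := by
  have hinj := injective_succAbove_prod (α := Fin n) i
  have hR : weightedHomogeneousSubmodule k (varDegree (m + 1) n)
      (Finsupp.embDomain (skip n i) W)
      = (weightedHomogeneousSubmodule k (varDegree m n) W).map
        (rename (R := k) (Prod.map i.succAbove id)).toLinearMap := by
    apply le_antisymm
    · intro f hf
      have hf' : f.IsWeightedHomogeneous (varDegree (m + 1) n) _ := hf
      have hv : (f.vars : Set _) ⊆ Set.range
          (Prod.map i.succAbove id : Fin m × Fin n → Fin (m + 1) × Fin n) := by
        rintro ⟨j, b⟩ hj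
        have hji : j ≠ i := by
          rintro rfl
          rw [Finset.mem_coe, mem_vars_iff_mem_support] at hj
          obtain ⟨d, hd, hb⟩ := hj
          have h := congrArg (fun g => g (Sum.inl j)) (hf' (mem_support_iff.1 hd))
          rw [embDomain_skip_inl,
            Finsupp.weight_apply, Finsupp.sum, Finsupp.finsetSum_apply,
            Finset.sum_eq_zero_iff] at h
          have := h _ hb
          simp [varDegree] at this
          exact (Finsupp.mem_support_iff.1 hb) this
        obtain ⟨j', rfl⟩ := Fin.exists_succAbove_eq hji
        exact ⟨(j', b), rfl⟩
      obtain ⟨g, rfl⟩ := exists_rename_eq_of_vars_subset_range f _ hinj hv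
      refine ⟨g, ?_, rfl⟩
      intro d hd
      have h := hf' (d := Finsupp.mapDomain (Prod.map i.succAbove id) d)
        (by rwa [coeff_rename_mapDomain _ hinj])
      rw [weight_mapDomain_succAbove] at h
      exact Finsupp.embDomain_injective _ h
    · rintro _ ⟨g, hg, rfl⟩
      intro d hd
      obtain ⟨d', rfl, h⟩ := coeff_rename_ne_zero _ _ _ hd
      rw [weight_mapDomain_succAbove, hg h]
  rw [oddComp_zero, oddComp_zero, hR, ← Submodule.map_comp]
  apply finrank_map_eq_of_ker
  intro f _
  have hinj' := injective_succAbove_prod (α := Fin r) i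
  have key : mulHom k (m + 1) x (rename (Prod.map i.succAbove id) f) = 0 ↔ mulHom k m x f = 0 := by
    rw [mulHom_rename, map_eq_zero_iff _ (rename_injective _ hinj')]
  constructor
  · intro h
    funext l
    exact key.1 (congrFun h Fin.elim0)
  · intro h
    funext l
    exact key.2 (congrFun h Fin.elim0)

/-- The end of the complex: by Euler's identity every element of positive degree in row `i` is a
contraction. What remains has degree zero there and is the ring with row `i` removed. -/
theorem oddSeries_zero_row [CharZero k] (i : Fin (m + 1)) :
    oddSeries k (m + 1) x 0 = MvPowerSeries.rename (skip n i) (oddSeries k m x 0)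
      + MvPowerSeries.X (Sum.inl i) * rankSeries k x i 0 := by
  ext W
  rw [map_add, MvPowerSeries.X, MvPowerSeries.coeff_monomial_mul, one_mul]
  split_ifs with hi
  · rw [MvPowerSeries.coeff_rename_eq_zero, zero_add]
    · change (Module.finrank k (oddComp k (m + 1) x 0 W) : ℤ) = (Module.finrank k
        ((oddComp k (m + 1) x 1 (W - Finsupp.single (Sum.inl i) 1)).map (contract k 0 i)) : ℤ)
      have hW := tsub_add_cancel_of_le hi
      set W' := W - Finsupp.single (Sum.inl i) 1
      rw [← hW]
      refine congrArg (fun S : Submodule k _ => (Module.finrank k S : ℤ)) ?_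
      apply le_antisymm
      · intro ω hω
        have h := contract_extDeriv_zero x i hω
        exact mem_of_nsmul_eq (k := k) (by simp) h _
          (Submodule.mem_map_of_mem (extDeriv_mem x i hω))
      · rintro _ ⟨ω, hω, rfl⟩
        exact contract_mem x i hω
    · rintro ⟨V, rfl⟩
      rw [Finsupp.single_le_iff, ← Finsupp.embDomain_eq_mapDomain, embDomain_skip_inl] at hi
      exact absurd hi (by simp)
  · have hi' : W (Sum.inl i) = 0 := by
      by_contra h
      exact hi (Finsupp.single_le_iff.2 (Nat.one_le_iff_ne_zero.2 h))
    obtain ⟨V, rfl⟩ : ∃ V, Finsupp.embDomain (skip n i) V = W := by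
      refine ⟨Finsupp.comapDomain (skip n i) W (skip n i).injective.injOn, ?_⟩
      rw [Finsupp.embDomain_comapDomain]
      rintro (j | b) hj
      · have hji : j ≠ i := by
          rintro rfl
          exact (Finsupp.mem_support_iff.1 hj) hi'
        obtain ⟨j', rfl⟩ := Fin.exists_succAbove_eq hji
        exact ⟨Sum.inl j', rfl⟩
      · exact ⟨Sum.inr b, rfl⟩
    rw [add_zero, MvPowerSeries.coeff_embDomain_rename]
    change (Module.finrank k (oddComp k (m + 1) x 0 _) : ℤ) = (Module.finrank k _ : ℤ)
    rw [finrank_oddComp_skip]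

/-- The ranks telescope in the alternating sum; the last one is the error of truncation at `P`, and
it disappears once `P ≥ r`. -/
theorem sum_oddSeries [CharZero k] (i : Fin (m + 1)) (P : ℕ) :
    ∑ p ∈ Finset.range (P + 1), (-MvPowerSeries.X (Sum.inl i)) ^ p * oddSeries k (m + 1) x p
      = MvPowerSeries.rename (skip n i) (oddSeries k m x 0)
        - (-MvPowerSeries.X (Sum.inl i)) ^ (P + 1) * rankSeries k x i P := by
  induction P with
  | zero => rw [Finset.sum_range_one, oddSeries_zero_row x i]; ring
  | succ P ih => rw [Finset.sum_range_succ, ih, oddSeries_succ x i]; ring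

theorem sum_oddSeries_eq [CharZero k] (i : Fin (m + 1)) {P : ℕ} (hP : r ≤ P) :
    ∑ p ∈ Finset.range (P + 1), (-MvPowerSeries.X (Sum.inl i)) ^ p * oddSeries k (m + 1) x p
      = MvPowerSeries.rename (skip n i) (oddSeries k m x 0) := by
  have h : rankSeries k x i P = 0 := by
    ext W
    change (Module.finrank k ((oddComp k (m + 1) x (P + 1) W).map (contract k P i)) : ℤ) = 0
    rw [oddComp_eq_bot x (by omega), Submodule.map_bot, finrank_bot, Nat.cast_zero]
  rw [sum_oddSeries, h, mul_zero, sub_zero]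

end OddRowSeries

/-! ### The recursion for Hilbert series by Cramer's rule -/

section Interpolation

/-- The Vandermonde determinant `det (u_i ^ (m - j))` as a polynomial in `u` and `t`. -/
def vdm (m n : ℕ) : MvPolynomial (Fin m ⊕ Fin n) ℤ :=
  Matrix.det (Matrix.of fun i j => X (Sum.inl i) ^ delta m j)

/-- The product of the variables `u_i`. -/
def prodU (m n : ℕ) : MvPolynomial (Fin m ⊕ Fin n) ℤ := ∏ i, X (Sum.inl i)

/-- The operator `p ↦ ∑ (-1)^i g_i p(u_0, …, u_(i-1), u_(i+1), …, u_m)`. -/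
def insertOp {m n : ℕ} (g : Fin (m + 1) → MvPolynomial (Fin (m + 1) ⊕ Fin n) ℤ)
    (p : MvPolynomial (Fin m ⊕ Fin n) ℤ) : MvPolynomial (Fin (m + 1) ⊕ Fin n) ℤ :=
  ∑ i : Fin (m + 1), (-1) ^ (i : ℕ) * g i * rename (skip n i) p

theorem delta_castSucc {m : ℕ} (j : Fin m) : delta (m + 1) j.castSucc = delta m j + 1 := by
  simp only [delta, Fin.val_castSucc]; omega

theorem delta_last (m : ℕ) : delta (m + 1) (Fin.last m) = 0 := by simp [delta]

theorem rename_prodU_mul_vdm (m n : ℕ) (i : Fin (m + 1)) :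
    rename (skip n i) (prodU m n * vdm m n)
      = Matrix.det (Matrix.of fun a b : Fin m =>
        (X (Sum.inl (i.succAbove a)) : MvPolynomial (Fin (m + 1) ⊕ Fin n) ℤ) ^ (delta m b + 1)) := by
  rw [vdm, prodU, ← Matrix.det_mul_column, AlgHom.map_det]
  congr 1
  ext1 a b
  simp [pow_succ']

theorem coe_det {m : ℕ} {σ : Type*} (M : Matrix (Fin m) (Fin m) (MvPolynomial σ ℤ)) :
    ((M.det : MvPolynomial σ ℤ) : MvPowerSeries σ ℤ)
      = (M.map fun p => (p : MvPowerSeries σ ℤ)).det := by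
  have := RingHom.map_det (coeToMvPowerSeries.ringHom (σ := σ) (R := ℤ)) M
  exact this

variable {k : Type*} [Field k] {Q : Type*} [CommRing Q] [Algebra k Q] {m r n : ℕ}
  (x : Fin r → Fin n → Q)

/-- Each of the `m + 1` rows gives one linear equation for the odd series of degrees `0, …, m`, with
matrix `u_i ^ p`; `r ≤ m` excludes further unknowns. Cramer's rule isolates the series of odd degree
zero. -/
theorem vdm_mul_hilb [CharZero k] (hr : r ≤ m) :
    (vdm (m + 1) n : MvPowerSeries (Fin (m + 1) ⊕ Fin n) ℤ) *
      hilb (RingHom.ker (mulHom k (m + 1) x)) = (-1) ^ m * ∑ i : Fin (m + 1), (-1) ^ (i : ℕ) *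
        MvPowerSeries.rename (skip n i) (((prodU m n * vdm m n : MvPolynomial (Fin m ⊕ Fin n) ℤ) :
          MvPowerSeries (Fin m ⊕ Fin n) ℤ) * hilb (RingHom.ker (mulHom k m x))) := by
  set A : Matrix (Fin (m + 1)) (Fin (m + 1)) (MvPowerSeries (Fin (m + 1) ⊕ Fin n) ℤ) :=
    Matrix.of fun i j => MvPowerSeries.X (Sum.inl i) ^ delta (m + 1) j with hA
  -- The unknowns are listed in decreasing odd degree to match `delta`, with the signs of `(-u_i) ^
  -- p` absorbed; the wanted one is last, with sign `+`.
  set v : Fin (m + 1) → MvPowerSeries (Fin (m + 1) ⊕ Fin n) ℤ :=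
    fun j => (-1) ^ delta (m + 1) j * oddSeries k (m + 1) x (delta (m + 1) j) with hv
  have hAv : A.mulVec v = fun i => MvPowerSeries.rename (skip n i) (oddSeries k m x 0) := by
    funext i
    rw [← sum_oddSeries_eq x i hr, ← Fin.sum_univ_eq_sum_range
      (fun p => (-MvPowerSeries.X (Sum.inl i)) ^ p * oddSeries k (m + 1) x p),
      ← Equiv.sum_comp Fin.revPerm, Matrix.mulVec, dotProduct]
    refine Finset.sum_congr rfl fun j _ => ?_
    have : ((Fin.revPerm j : Fin (m + 1)) : ℕ) = delta (m + 1) j := by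
      simp only [Fin.revPerm_apply, Fin.val_rev, delta]; omega
    rw [this, neg_pow]
    simp only [hA, hv, Matrix.of_apply]
    ring
  have hcr : (A.updateCol (Fin.last m) (A.mulVec v)).det
      = A.det * oddSeries k (m + 1) x 0 := by
    rw [← Matrix.cramer_apply, Matrix.cramer_eq_adjugate_mulVec, Matrix.mulVec_mulVec,
      Matrix.adjugate_mul, Matrix.smul_mulVec, Matrix.one_mulVec, Pi.smul_apply, hv]
    simp [delta_last]
  have hdet : (vdm (m + 1) n : MvPowerSeries (Fin (m + 1) ⊕ Fin n) ℤ) = A.det := by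
    rw [vdm, coe_det]
    congr 1
    ext1 i j
    simp [hA]
  rw [← oddSeries_zero, ← oddSeries_zero, hdet, ← hcr, hAv,
    Matrix.det_succ_column _ (Fin.last m), Finset.mul_sum]
  refine Finset.sum_congr rfl fun i _ => ?_
  rw [Matrix.updateCol_self, map_mul, MvPowerSeries.rename_coe, rename_prodU_mul_vdm, coe_det,
    Fin.val_last, pow_add]
  -- Deleting row `i` and the last column leaves the Vandermonde matrix of the other variables with
  -- all exponents raised by one, which accounts for the factor `prodU`.
  have : (A.updateCol (Fin.last m) fun i => MvPowerSeries.rename (skip n i)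
      (oddSeries k m x 0)).submatrix i.succAbove (Fin.last m).succAbove
      = (Matrix.of fun a b : Fin m => (X (Sum.inl (i.succAbove a)) :
        MvPolynomial (Fin (m + 1) ⊕ Fin n) ℤ) ^ (delta m b + 1)).map fun p =>
          (p : MvPowerSeries (Fin (m + 1) ⊕ Fin n) ℤ) := by
    ext1 a b
    simp [hA, (Fin.castSucc_lt_last b).ne, delta_castSucc]
  rw [this]
  ring

/-- Clearing denominators in `vdm_mul_hilb`: the factors `1 - u_i t_b` of the omitted row are those
that the denominator for the remaining `m` rows lacks. -/
theorem vdm_mul_kPolynomial [CharZero k] (hr : r ≤ m)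
    {K : MvPolynomial (Fin m ⊕ Fin n) ℤ} {K' : MvPolynomial (Fin (m + 1) ⊕ Fin n) ℤ}
    (hK : IsKPolynomial (RingHom.ker (mulHom k m x)) K)
    (hK' : IsKPolynomial (RingHom.ker (mulHom k (m + 1) x)) K') :
    vdm (m + 1) n * K' = (-1) ^ m * insertOp
      (fun i => ∏ b, (1 - X (Sum.inl i) * X (Sum.inr b))) (prodU m n * (vdm m n * K)) := by
  apply MvPolynomial.coe_injective
  have hX : ∀ s, coeToMvPowerSeries.ringHom (X s : MvPolynomial (Fin (m + 1) ⊕ Fin n) ℤ)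
      = MvPowerSeries.X s := fun s => coe_X s
  obtain ⟨p, hp⟩ : ∃ p, p = prodU m n * (vdm m n * K) := ⟨_, rfl⟩
  have hren : ∀ i : Fin (m + 1), coeToMvPowerSeries.ringHom
      (rename (skip n i) p)
      = MvPowerSeries.rename (skip n i) (((prodU m n * vdm m n : MvPolynomial (Fin m ⊕ Fin n) ℤ) :
          MvPowerSeries (Fin m ⊕ Fin n) ℤ) * hilb (RingHom.ker (mulHom k m x)) *
        ∏ p : Fin m × Fin n,
      (1 - MvPowerSeries.X (Sum.inl p.1) * MvPowerSeries.X (Sum.inr p.2))) := by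
    intro i
    rw [coeToMvPowerSeries.ringHom_apply, ← MvPowerSeries.rename_coe, hp, ← mul_assoc (prodU m n),
      coe_mul, hK, ← mul_assoc]
  rw [← hp, coe_mul, hK', ← mul_assoc, vdm_mul_hilb x hr, ← coeToMvPowerSeries.ringHom_apply
    (φ := (-1) ^ m * _), insertOp, mul_assoc, Finset.sum_mul]
  simp only [map_mul, map_pow, map_neg, map_one, map_sum, map_prod, map_sub, hX, hren]
  congr 1
  refine Finset.sum_congr rfl fun i _ => ?_
  rw [Fintype.prod_prod_type, Fin.prod_univ_succAbove _ i]
  simp only [Fintype.prod_prod_type, MvPowerSeries.rename_X, skip_inl, skip_inr]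
  ring

end Interpolation

/-! ### Decomposition of lower sets of exponents into cells -/

section Cells

variable {σ : Type*}

/-- The translate by `v` of the monoid of exponents supported in `B`. -/
def cell (v : σ →₀ ℕ) (B : Finset σ) : Set (σ →₀ ℕ) := {a | v ≤ a ∧ ∀ i ∉ B, a i = v i}

theorem mem_cell {v a : σ →₀ ℕ} {B : Finset σ} :
    a ∈ cell v B ↔ ∀ i, v i ≤ a i ∧ (i ∉ B → a i = v i) := by
  rw [forall_and]; rfl

theorem self_mem_cell (v : σ →₀ ℕ) (B : Finset σ) : v ∈ cell v B := ⟨le_rfl, fun _ _ => rfl⟩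

theorem mem_cell_add_single [DecidableEq σ] {v a : σ →₀ ℕ} {B : Finset σ} {p : σ} (hv : v p = 0)
    (hB : p ∉ B) (j : ℕ) :
    a ∈ cell (v + Finsupp.single p j) B ↔ a p = j ∧ a.erase p ∈ cell v B := by
  simp only [mem_cell]
  constructor
  · intro h
    have hp := (h p).2 hB
    refine ⟨by simpa [hv] using hp, fun i => ?_⟩
    by_cases hi : i = p
    · subst hi; simp [hv]
    · simpa [Finsupp.erase_ne hi, Finsupp.single_eq_of_ne hi] using h i
  · rintro ⟨hp, h⟩ i
    by_cases hi : i = p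
    · subst hi; simp [hv, hp]
    · simpa [Finsupp.erase_ne hi, Finsupp.single_eq_of_ne hi] using h i

theorem mem_cell_add_single_insert [DecidableEq σ] {v a : σ →₀ ℕ} {B : Finset σ} {p : σ}
    (hv : v p = 0) (j : ℕ) :
    a ∈ cell (v + Finsupp.single p j) (insert p B) ↔ j ≤ a p ∧ a.erase p ∈ cell v B := by
  simp only [mem_cell]
  constructor
  · intro h
    refine ⟨by simpa [hv] using (h p).1, fun i => ?_⟩
    by_cases hi : i = p
    · subst hi; simp [hv]
    · simpa [Finsupp.erase_ne hi, Finsupp.single_eq_of_ne hi, hi] using h i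
  · rintro ⟨hp, h⟩ i
    by_cases hi : i = p
    · subst hi; simp [hv, hp]
    · simpa [Finsupp.erase_ne hi, Finsupp.single_eq_of_ne hi, hi] using h i

/-- A decreasing sequence of lower sets of exponents is eventually constant (Dickson's lemma). -/
theorem exists_stable_lowerSet [Finite σ] (L : ℕ → Set (σ →₀ ℕ)) (hL : ∀ j, IsLowerSet (L j))
    (hanti : Antitone L) : ∃ j₀, ∀ j, j₀ ≤ j → L j = L j₀ := by
  classical
  -- The complements of the `L j` span an ascending chain of monomial ideals, which is stationary
  -- because the polynomial ring is Noetherian. The field `ℚ` plays no other role.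
  let f : ℕ →o Ideal (MvPolynomial σ ℚ) :=
    { toFun := fun j => Ideal.span ((fun s => monomial s (1 : ℚ)) '' (L j)ᶜ)
      monotone' := fun i j h => Ideal.span_mono (Set.image_mono (Set.compl_subset_compl.2 (hanti h))) }
  have hmem : ∀ j a, monomial a (1 : ℚ) ∈ f j ↔ a ∉ L j := by
    intro j a
    change monomial a (1 : ℚ) ∈ Ideal.span ((fun s => monomial s (1 : ℚ)) '' (L j)ᶜ) ↔ _
    rw [mem_ideal_span_monomial_image]
    constructor
    · intro h ha
      obtain ⟨b, hb, hba⟩ := h a (by rw [mem_support_iff, coeff_monomial, if_pos rfl]; exact one_ne_zero)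
      exact hb (hL j hba ha)
    · intro h b hb
      have : b = a := by
        rw [mem_support_iff, coeff_monomial] at hb
        by_contra h'
        exact hb (if_neg (Ne.symm h'))
      exact ⟨a, h, this.ge⟩
  obtain ⟨j₀, hj⟩ := monotone_stabilizes_iff_noetherian.mpr
    (inferInstance : IsNoetherian (MvPolynomial σ ℚ) (MvPolynomial σ ℚ)) f
  refine ⟨j₀, fun j h => ?_⟩
  ext a
  rw [← not_iff_not, ← hmem, ← hmem, ← hj j h]

/-- A lower set of exponents is a finite disjoint union of cells. -/
theorem exists_cells [Finite σ] (s : Finset σ) : ∀ L : Set (σ →₀ ℕ), IsLowerSet L →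
    (∀ a ∈ L, a.support ⊆ s) → ∃ (ι : Type) (_ : Fintype ι) (v : ι → σ →₀ ℕ) (B : ι → Finset σ),
      (∀ q, cell (v q) (B q) ⊆ L) ∧ ∀ a ∈ L, ∃! q, a ∈ cell (v q) (B q) := by
  classical
  induction s using Finset.induction_on with
  | empty =>
    intro L _ hs
    by_cases h0 : (0 : σ →₀ ℕ) ∈ L
    · refine ⟨Unit, inferInstance, fun _ => 0, fun _ => ∅, fun _ a ha => ?_, fun a ha => ?_⟩
      · have : a = 0 := by ext i; simpa using (mem_cell.1 ha i).2
        rwa [this]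
      · have : a = 0 := by simpa using hs a ha
        subst this
        exact ⟨(), self_mem_cell _ _, fun _ _ => rfl⟩
    · refine ⟨Empty, inferInstance, Empty.elim, Empty.elim, fun q => q.elim, fun a ha => ?_⟩
      have : a = 0 := by simpa using hs a ha
      exact absurd (this ▸ ha) h0
  | insert p s hp ih =>
    intro L hL hs
    -- Slice `L` by the exponent `j` of `p`. The slices decrease and become constant at some `j₀`:
    -- slices below `j₀` give cells with `p` frozen, and the stable slice gives cells in which `p`
    -- runs freely from `j₀` on.
    let M : ℕ → Set (σ →₀ ℕ) := fun j => {a | a.support ⊆ s ∧ a + Finsupp.single p j ∈ L}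
    have hM : ∀ j, IsLowerSet (M j) := fun j a b hba ha =>
      ⟨(Finsupp.support_mono hba).trans ha.1, hL (add_le_add_left hba _) ha.2⟩
    have hanti : Antitone M := fun i j hij a ha =>
      ⟨ha.1, hL (add_le_add_right (Finsupp.single_mono hij) _) ha.2⟩
    obtain ⟨j₀, hj₀⟩ := exists_stable_lowerSet M hM hanti
    have hmem : ∀ a ∈ L, a.erase p ∈ M (a p) := by
      intro a ha
      refine ⟨?_, ?_⟩
      · intro i hi
        rw [Finsupp.support_erase, Finset.mem_erase] at hi
        exact (Finset.mem_insert.1 (hs a ha hi.2)).resolve_left hi.1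
      · rwa [Finsupp.erase_add_single]
    choose ι hι v B hsub huniq using fun j => ih (M j) (hM j) fun a ha => ha.1
    have hp0 : ∀ j a, a ∈ M j → a p = 0 := fun j a ha =>
      Finsupp.notMem_support_iff.1 fun h => hp (ha.1 h)
    have hv : ∀ j q, v j q p = 0 := fun j q => hp0 j _ (hsub j q (self_mem_cell _ _))
    have hB : ∀ j q, p ∉ B j q := by
      intro j q h
      have h1 : v j q + Finsupp.single p 1 ∈ cell (v j q) (B j q) := by
        rw [mem_cell]
        intro i
        refine ⟨by simp, fun hi => ?_⟩
        have : i ≠ p := fun e => hi (e ▸ h)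
        simp [this]
      have := hp0 j _ (hsub j q h1)
      simp at this
    have hL' : ∀ a j, a p = j → a.erase p ∈ M j → a ∈ L := by
      rintro a j rfl h
      have := h.2
      rwa [Finsupp.erase_add_single] at this
    refine ⟨(Σ j : Fin j₀, ι j) ⊕ ι j₀, inferInstance,
      Sum.elim (fun q => v q.1 q.2 + Finsupp.single p (q.1 : ℕ))
        (fun q => v j₀ q + Finsupp.single p j₀),
      Sum.elim (fun q => B q.1 q.2) (fun q => insert p (B j₀ q)), ?_, ?_⟩
    · rintro (⟨j, q⟩ | q) a ha
      · have h := (mem_cell_add_single (hv _ _) (hB _ _) _).1 ha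
        exact hL' a j h.1 (hsub _ _ h.2)
      · have h := (mem_cell_add_single_insert (hv _ _) _).1 ha
        refine hL' a _ rfl ?_
        rw [hj₀ _ h.1]
        exact hsub _ _ h.2
    · intro a ha
      by_cases hj : a p < j₀
      · obtain ⟨q, hq, hq'⟩ := huniq _ _ (hmem a ha)
        refine ⟨Sum.inl ⟨⟨a p, hj⟩, q⟩,
          (mem_cell_add_single (hv _ _) (hB _ _) _).2 ⟨rfl, hq⟩, ?_⟩
        rintro (⟨⟨j, hj'⟩, q₂⟩ | q₂) h
        · have h := (mem_cell_add_single (hv _ _) (hB _ _) _).1 h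
          obtain rfl : a p = j := h.1
          rw [hq' q₂ h.2]
        · have h := (mem_cell_add_single_insert (hv _ _) _).1 h
          omega
      · have hj := not_lt.1 hj
        have h0 := hmem a ha
        rw [hj₀ _ hj] at h0
        obtain ⟨q, hq, hq'⟩ := huniq _ _ h0
        refine ⟨Sum.inr q, (mem_cell_add_single_insert (hv _ _) _).2 ⟨hj, hq⟩, ?_⟩
        rintro (⟨⟨j, hj'⟩, q₂⟩ | q₂) h
        · have h := (mem_cell_add_single (hv _ _) (hB _ _) _).1 h
          have h1 : a p = j := h.1
          omega
        · have h := (mem_cell_add_single_insert (hv _ _) _).1 h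
          rw [hq' q₂ h.2]

end Cells

/-! ### Generating functions of cells -/

section CellSeries

variable {m n : ℕ}

/-- The exponents of the monomials of degree `W`. -/
def fiber (W : (Fin m ⊕ Fin n) →₀ ℕ) : Finset (Fin m × Fin n →₀ ℕ) :=
  ((finite_weight_le W).subset (fun _ h => le_of_eq h :
    {d | Finsupp.weight (varDegree m n) d = W} ⊆ _)).toFinset

theorem mem_fiber {W : (Fin m ⊕ Fin n) →₀ ℕ} {a : Fin m × Fin n →₀ ℕ} :
    a ∈ fiber W ↔ Finsupp.weight (varDegree m n) a = W := by
  simp [fiber]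

open Classical in
/-- The generating function of the degrees of the monomials with exponents in `S`. -/
def setSeries (S : Set (Fin m × Fin n →₀ ℕ)) : MvPowerSeries (Fin m ⊕ Fin n) ℤ :=
  fun W => ∑ a ∈ fiber W, if a ∈ S then 1 else 0

theorem coeff_setSeries (S : Set (Fin m × Fin n →₀ ℕ)) (W : (Fin m ⊕ Fin n) →₀ ℕ) :
    MvPowerSeries.coeff W (setSeries S) = {a | a ∈ S ∧ Finsupp.weight (varDegree m n) a = W}.ncard := by
  classical
  change (∑ a ∈ fiber W, if a ∈ S then (1 : ℤ) else 0) = _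
  rw [Finset.sum_boole]
  congr 1
  rw [← Set.ncard_coe_finset]
  congr 1
  ext a
  simp [mem_fiber, and_comm]

theorem setSeries_union {S T : Set (Fin m × Fin n →₀ ℕ)} (h : Disjoint S T) :
    setSeries (S ∪ T) = setSeries S + setSeries T := by
  classical
  funext W
  change _ = setSeries S W + setSeries T W
  simp only [setSeries]
  rw [← Finset.sum_add_distrib]
  refine Finset.sum_congr rfl fun a _ => ?_
  have h3 : a ∈ S → a ∉ T := fun h' => Set.disjoint_left.1 h h'
  by_cases h1 : a ∈ S <;> by_cases h2 : a ∈ T <;> simp_all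

theorem setSeries_image_add (S : Set (Fin m × Fin n →₀ ℕ)) (b : Fin m × Fin n →₀ ℕ) :
    setSeries ((· + b) '' S)
      = MvPowerSeries.monomial (Finsupp.weight (varDegree m n) b) 1 * setSeries S := by
  ext W
  rw [MvPowerSeries.coeff_monomial_mul, one_mul, coeff_setSeries]
  split_ifs with h
  · rw [coeff_setSeries, ← Set.ncard_image_of_injective {a | a ∈ S ∧
      Finsupp.weight (varDegree m n) a = W - Finsupp.weight (varDegree m n) b}
      (add_left_injective b)]
    refine congrArg (fun S : Set _ => (S.ncard : ℤ)) (Set.ext fun a => ?_)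
    constructor
    · rintro ⟨⟨a, ha, rfl⟩, rfl⟩
      exact ⟨a, ⟨ha, by simp⟩, rfl⟩
    · rintro ⟨a, ⟨ha, h'⟩, rfl⟩
      exact ⟨⟨a, ha, rfl⟩, by rw [map_add, h', tsub_add_cancel_of_le h]⟩
  · rw [Nat.cast_eq_zero, Set.ncard_eq_zero ((finite_weight_le W).subset (by
      rintro a ⟨_, h⟩; exact h.le)), Set.eq_empty_iff_forall_notMem]
    rintro _ ⟨⟨a, ha, rfl⟩, rfl⟩
    exact h (by rw [map_add]; exact le_add_self)

theorem setSeries_cell_mul (v : Fin m × Fin n →₀ ℕ) (B : Finset (Fin m × Fin n)) :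
    setSeries (cell v B) * ∏ p ∈ B,
      (1 - MvPowerSeries.X (Sum.inl p.1) * MvPowerSeries.X (Sum.inr p.2))
      = MvPowerSeries.monomial (Finsupp.weight (varDegree m n) v) 1 := by
  classical
  induction B using Finset.induction_on with
  | empty =>
    rw [Finset.prod_empty, mul_one]
    ext W
    rw [coeff_setSeries, MvPowerSeries.coeff_monomial]
    have hc : cell v ∅ = {v} := by
      ext a
      rw [mem_cell, Set.mem_singleton_iff]
      exact ⟨fun h => by ext i; exact (h i).2 (by simp), by rintro rfl; simp⟩
    rw [hc]
    split_ifs with h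
    · rw [show {a | a ∈ ({v} : Set _) ∧ Finsupp.weight (varDegree m n) a = W} = {v} by
        ext a; simp only [Set.mem_singleton_iff, Set.mem_ofPred_eq]; constructor
        · exact fun h => h.1
        · rintro rfl; exact ⟨rfl, h.symm⟩]
      simp
    · rw [show {a | a ∈ ({v} : Set _) ∧ Finsupp.weight (varDegree m n) a = W} = ∅ by
        ext a; simp only [Set.mem_singleton_iff, Set.mem_ofPred_eq, Set.mem_empty_iff_false, iff_false]
        rintro ⟨rfl, h'⟩; exact h h'.symm]
      simp
  | insert p B hp ih =>
    -- The geometric series in `u t` for the variable `p`: the cell is its bottom layer in direction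
    -- `p` together with its own translate by one step.
    have hset : cell v (insert p B) = cell v B ∪ (· + Finsupp.single p 1) '' cell v (insert p B) := by
      ext a
      simp only [Set.mem_union, Set.mem_image, mem_cell]
      constructor
      · intro h
        by_cases hap : a p = v p
        · left
          intro i
          refine ⟨(h i).1, fun hi => ?_⟩
          by_cases hip : i = p
          · rw [hip, hap]
          · exact (h i).2 (by simp [hi, hip])
        · right
          have h1 : 1 ≤ a p := by have := (h p).1; omega
          have h2 : Finsupp.single p 1 ≤ a := Finsupp.single_le_iff.2 h1
          refine ⟨a - Finsupp.single p 1, fun i => ?_, tsub_add_cancel_of_le h2⟩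
          have := h i
          by_cases hip : i = p
          · subst hip
            simp
            omega
          · simpa [hip, Finsupp.single_eq_of_ne hip] using this
      · rintro (h | ⟨a, h, rfl⟩) i
        · exact ⟨(h i).1, fun hi => (h i).2 fun h' => hi (Finset.mem_insert_of_mem h')⟩
        · refine ⟨(h i).1.trans (by simp), fun hi => ?_⟩
          have hip : i ≠ p := fun e => hi (by simp [e])
          simpa [hip] using (h i).2 hi
    have hdis : Disjoint (cell v B) ((· + Finsupp.single p 1) '' cell v (insert p B)) := by
      rw [Set.disjoint_left]
      rintro _ h1 ⟨a, h2, rfl⟩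
      have e1 := (mem_cell.1 h1 p).2 hp
      have e2 := (mem_cell.1 h2 p).1
      simp at e1
      omega
    have hs : setSeries (cell v (insert p B)) = setSeries (cell v B)
        + MvPowerSeries.X (Sum.inl p.1) * MvPowerSeries.X (Sum.inr p.2) *
          setSeries (cell v (insert p B)) := by
      conv_lhs => rw [hset, setSeries_union hdis, setSeries_image_add]
      rw [Finsupp.weight_single, one_smul, varDegree, MvPowerSeries.X, MvPowerSeries.X,
        MvPowerSeries.monomial_mul_monomial, one_mul]
    rw [Finset.prod_insert hp, ← ih, ← mul_assoc]
    congr 1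
    linear_combination hs

end CellSeries

/-! ### Order at the origin and lowest homogeneous components -/

section Order

variable {σ : Type*} {A : Type*} [CommRing A]

/-- All terms of `p` have total degree at least `d`. -/
def OrdGe (d : ℕ) (p : MvPolynomial σ A) : Prop := ∀ s : σ →₀ ℕ, s.degree < d → coeff s p = 0

theorem OrdGe.add {d : ℕ} {p q : MvPolynomial σ A} (hp : OrdGe d p) (hq : OrdGe d q) :
    OrdGe d (p + q) := fun s hs => by rw [coeff_add, hp s hs, hq s hs, add_zero]

theorem OrdGe.sum {ι : Type*} {d : ℕ} (s : Finset ι) {p : ι → MvPolynomial σ A}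
    (hp : ∀ i ∈ s, OrdGe d (p i)) : OrdGe d (∑ i ∈ s, p i) := fun a ha => by
  rw [coeff_sum]; exact Finset.sum_eq_zero fun i hi => hp i hi a ha

theorem OrdGe.mul {d e : ℕ} {p q : MvPolynomial σ A} (hp : OrdGe d p) (hq : OrdGe e q) :
    OrdGe (d + e) (p * q) := fun s hs => by
  classical
  rw [coeff_mul]
  refine Finset.sum_eq_zero fun x hx => ?_
  rw [Finset.HasAntidiagonal.mem_antidiagonal] at hx
  rw [← hx, map_add] at hs
  by_cases h : x.1.degree < d
  · rw [hp _ h, zero_mul]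
  · rw [hq x.2 (by omega), mul_zero]

theorem OrdGe.zero (p : MvPolynomial σ A) : OrdGe 0 p := fun s hs => absurd hs (by simp)

theorem OrdGe.mono {d e : ℕ} (h : e ≤ d) {p : MvPolynomial σ A} (hp : OrdGe d p) : OrdGe e p :=
  fun s hs => hp s (hs.trans_le h)

theorem OrdGe.prod {ι : Type*} (s : Finset ι) {d : ι → ℕ} {p : ι → MvPolynomial σ A}
    (hp : ∀ i ∈ s, OrdGe (d i) (p i)) : OrdGe (∑ i ∈ s, d i) (∏ i ∈ s, p i) := by
  classical
  induction s using Finset.induction_on with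
  | empty => exact OrdGe.zero _
  | insert a s ha ih =>
    rw [Finset.sum_insert ha, Finset.prod_insert ha]
    exact (hp a (Finset.mem_insert_self _ _)).mul
      (ih fun i hi => hp i (Finset.mem_insert_of_mem hi))

theorem _root_.MvPolynomial.IsHomogeneous.ordGe {d : ℕ} {p : MvPolynomial σ A}
    (hp : p.IsHomogeneous d) : OrdGe d p := fun _ hs =>
  hp.coeff_eq_zero hs.ne

/-- The lowest component of a product is the product of the lowest components. -/
theorem homogeneousComponent_mul {d e : ℕ} {p q : MvPolynomial σ A} (hp : OrdGe d p)
    (hq : OrdGe e q) : homogeneousComponent (d + e) (p * q)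
      = homogeneousComponent d p * homogeneousComponent e q := by
  classical
  ext s
  rw [coeff_homogeneousComponent, coeff_mul, coeff_mul]
  split_ifs with h
  · refine Finset.sum_congr rfl fun x hx => ?_
    rw [Finset.HasAntidiagonal.mem_antidiagonal] at hx
    rw [← hx, map_add] at h
    rw [coeff_homogeneousComponent, coeff_homogeneousComponent]
    rcases lt_trichotomy x.1.degree d with h1 | h1 | h1
    · rw [hp _ h1, if_neg h1.ne]; simp
    · rw [if_pos h1, if_pos (by omega)]
    · rw [if_neg h1.ne', hq x.2 (by omega), mul_zero, zero_mul]
  · symm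
    refine Finset.sum_eq_zero fun x hx => ?_
    rw [Finset.HasAntidiagonal.mem_antidiagonal] at hx
    rw [← hx, map_add] at h
    rw [coeff_homogeneousComponent, coeff_homogeneousComponent]
    by_cases h1 : x.1.degree = d
    · rw [if_neg (c := x.2.degree = e) (by omega), mul_zero]
    · rw [if_neg h1, zero_mul]

theorem ordGe_iff_homogeneousComponent {d : ℕ} {p : MvPolynomial σ A} :
    OrdGe d p ↔ ∀ j < d, homogeneousComponent j p = 0 := by
  constructor
  · intro h j hj
    ext s
    rw [coeff_homogeneousComponent, coeff_zero]
    split_ifs with hs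
    · exact h s (by omega)
    · rfl
  · intro h s hs
    have := congrArg (coeff s) (h _ hs)
    rwa [coeff_homogeneousComponent, if_pos rfl, coeff_zero] at this

end Order

/-! ### Standard monomials and the order of the `K`-polynomial -/

section Macaulay

universe u

theorem exists_monomialOrder (σ : Type u) [Finite σ] : Nonempty (MonomialOrder.{u, u} σ) := by
  have := Fintype.ofFinite σ
  let e := Fintype.equivFin σ
  let : LinearOrder σ := LinearOrder.lift' e e.injective
  exact ⟨MonomialOrder.lex⟩

variable {k : Type*} [Field k] {m n : ℕ} (I : Ideal (CoordRing k m n))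
  (μ : MonomialOrder (Fin m × Fin n))

/-- The exponents that are not leading exponents of homogeneous elements of `I`. -/
def standardExponents : Set (Fin m × Fin n →₀ ℕ) :=
  {a | ∀ f ∈ I, f.IsWeightedHomogeneous (varDegree m n) (Finsupp.weight (varDegree m n) a) →
    f ≠ 0 → μ.degree f ≠ a}

theorem isLowerSet_standardExponents : IsLowerSet (standardExponents I μ) := by
  intro b a hab hb f hf hw h0 hd
  obtain ⟨c, rfl⟩ := exists_add_of_le hab
  have hm : (monomial c (1 : k)) ≠ 0 := by simp
  refine hb (monomial c 1 * f) (I.mul_mem_left _ hf) ?_ (mul_ne_zero hm h0) ?_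
  · rw [add_comm a c, map_add]
    exact (isWeightedHomogeneous_monomial _ _ _ rfl).mul hw
  · classical
    rw [μ.degree_mul hm h0, hd, μ.degree_monomial, if_neg one_ne_zero, add_comm]

/-- Reduction modulo leading terms. A nonstandard monomial is the leading term of an element of `I`
homogeneous of the same degree, so it is rewritten by smaller monomials of that degree; the monomial
order is well founded. -/
theorem map_mk_eq_span (D : (Fin m ⊕ Fin n) →₀ ℕ) :
    (weightedHomogeneousSubmodule k (varDegree m n) D).map (Ideal.Quotient.mkₐ k I).toLinearMap
      = Submodule.span k (Set.range fun a : {a // a ∈ standardExponents I μ ∧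
        Finsupp.weight (varDegree m n) a = D} => Ideal.Quotient.mkₐ k I (monomial a.1 1)) := by
  apply le_antisymm
  · set S := Submodule.span k (Set.range fun a : {a // a ∈ standardExponents I μ ∧
        Finsupp.weight (varDegree m n) a = D} => Ideal.Quotient.mkₐ k I (monomial a.1 1)) with hS
    have key : ∀ s : μ.syn, ∀ d, μ.toSyn d = s → Finsupp.weight (varDegree m n) d = D →
        Ideal.Quotient.mkₐ k I (monomial d 1) ∈ S := by
      intro s
      induction s using WellFoundedLT.induction with
      | ind s ih =>
        rintro d rfl hd
        by_cases hL : d ∈ standardExponents I μ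
        · exact Submodule.subset_span ⟨⟨d, hL, hd⟩, rfl⟩
        · simp only [standardExponents, Set.mem_ofPred_eq, not_forall, not_not] at hL
          obtain ⟨f, hf, hw, h0, hdeg⟩ := hL
          have hc : coeff d f ≠ 0 := by rw [← hdeg]; exact μ.coeff_degree_ne_zero_iff.2 h0
          have hsum : ∑ e ∈ f.support, coeff e f • Ideal.Quotient.mkₐ k I (monomial e 1) = 0 := by
            have h1 : Ideal.Quotient.mkₐ k I f = 0 := Ideal.Quotient.eq_zero_iff_mem.2 hf
            rw [f.as_sum, map_sum] at h1
            rw [← h1]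
            refine Finset.sum_congr rfl fun e _ => ?_
            rw [← map_smul, smul_monomial, smul_eq_mul, mul_one]
          rw [← Finset.add_sum_erase _ _ (mem_support_iff.2 hc)] at hsum
          have h2 : Ideal.Quotient.mkₐ k I (monomial d 1) = (coeff d f)⁻¹ •
              -∑ e ∈ f.support.erase d, coeff e f • Ideal.Quotient.mkₐ k I (monomial e 1) := by
            rw [← eq_neg_of_add_eq_zero_left hsum, smul_smul, inv_mul_cancel₀ hc, one_smul]
          rw [h2]
          refine S.smul_mem _ (S.neg_mem (S.sum_mem fun e he => S.smul_mem _ ?_))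
          rw [Finset.mem_erase] at he
          refine ih (μ.toSyn e) (lt_of_le_of_ne ?_ ?_) e rfl ((hw (mem_support_iff.1 he.2)).trans hd)
          · rw [← hdeg]; exact μ.le_degree he.2
          · exact fun h => he.1 (μ.toSyn.injective h)
    rintro _ ⟨f, hf, rfl⟩
    have hf' : f.IsWeightedHomogeneous (varDegree m n) D := hf
    rw [f.as_sum, AlgHom.toLinearMap_apply, map_sum]
    refine S.sum_mem fun e he => ?_
    have : monomial e (coeff e f) = coeff e f • monomial e (1 : k) := by
      rw [smul_monomial, smul_eq_mul, mul_one]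
    rw [this, map_smul]
    exact S.smul_mem _ (key _ e rfl (hf' (mem_support_iff.1 he)))
  · rw [Submodule.span_le]
    rintro _ ⟨a, rfl⟩
    exact ⟨monomial a.1 1, isWeightedHomogeneous_monomial _ _ _ a.2.2, rfl⟩

/-- Macaulay's theorem: standard monomials span by `map_mk_eq_span`, and a dependence among those of
one degree would be a homogeneous element of `I` with a standard leading exponent. -/
theorem hilb_eq_setSeries : hilb I = setSeries (standardExponents I μ) := by
  ext D
  have hfin : {a | a ∈ standardExponents I μ ∧ Finsupp.weight (varDegree m n) a = D}.Finite :=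
    (finite_weight_le D).subset (by rintro a ⟨_, h⟩; exact h.le)
  have : Fintype {a // a ∈ standardExponents I μ ∧ Finsupp.weight (varDegree m n) a = D} :=
    hfin.fintype
  rw [coeff_setSeries]
  change (Module.finrank k ((weightedHomogeneousSubmodule k (varDegree m n) D).map
      (Ideal.Quotient.mkₐ k I).toLinearMap) : ℤ) = _
  have hli : LinearIndependent k fun a : {a // a ∈ standardExponents I μ ∧
        Finsupp.weight (varDegree m n) a = D} => Ideal.Quotient.mkₐ k I (monomial a.1 1) := by
    rw [linearIndependent_iff']
    intro s g hg
    set f : CoordRing k m n := ∑ a ∈ s, g a • monomial a.1 1 with hf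
    have hcoeff : ∀ d, coeff d f ≠ 0 → ∃ a ∈ s, a.1 = d := by
      intro d hd
      by_contra! h
      apply hd
      rw [hf, coeff_sum]
      refine Finset.sum_eq_zero fun a ha => ?_
      classical
      rw [coeff_smul, coeff_monomial, if_neg (h a ha), smul_zero]
    have hfI : f ∈ I := by
      rw [← Ideal.Quotient.eq_zero_iff_mem, ← Ideal.Quotient.mkₐ_eq_mk k, hf, map_sum, ← hg]
      exact Finset.sum_congr rfl fun a _ => map_smul _ _ _
    have hf0 : f = 0 := by
      by_contra h0
      obtain ⟨a, ha, had⟩ := hcoeff _ (μ.coeff_degree_ne_zero_iff.2 h0)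
      refine a.2.1 f hfI ?_ h0 had.symm
      intro d hd
      obtain ⟨b, hb, rfl⟩ := hcoeff d hd
      rw [b.2.2, a.2.2]
    intro a ha
    have := congrArg (coeff a.1) hf0
    classical
    rw [hf, coeff_sum, Finset.sum_eq_single a] at this
    · simpa [coeff_monomial] using this
    · intro b _ hb
      rw [coeff_smul, coeff_monomial, if_neg (fun h => hb (Subtype.ext h)), smul_zero]
    · exact fun h => absurd ha h
  rw [map_mk_eq_span I μ D, finrank_span_eq_card hli, ← Nat.card_eq_fintype_card]
  rfl

/-- The substitution `u ↦ 1 - u`, `t ↦ 1 - t`. -/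
def oneSub (m n : ℕ) : MvPolynomial (Fin m ⊕ Fin n) ℤ →ₐ[ℤ] MvPolynomial (Fin m ⊕ Fin n) ℤ :=
  aeval fun s => 1 - X s

theorem ordGe_one_X (s : Fin m ⊕ Fin n) : OrdGe 1 (X s : MvPolynomial (Fin m ⊕ Fin n) ℤ) :=
  (isHomogeneous_X _ _).ordGe

theorem ordGe_oneSub (p : Fin m × Fin n) :
    OrdGe 1 (oneSub m n (1 - X (Sum.inl p.1) * X (Sum.inr p.2))) := by
  have : oneSub m n (1 - X (Sum.inl p.1) * X (Sum.inr p.2))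
      = X (Sum.inl p.1) + (1 - X (Sum.inl p.1)) * X (Sum.inr p.2) := by
    simp [oneSub]; ring
  rw [this]
  refine (ordGe_one_X _).add ?_
  simpa using (OrdGe.zero (1 - X (Sum.inl p.1) : MvPolynomial (Fin m ⊕ Fin n) ℤ)).mul
    (ordGe_one_X (Sum.inr p.2))

/-- The `K`-polynomial exists; its order at `1` is at least `d` if no more than `m n - d` of the
variables are algebraically independent modulo the homogeneous ideal `I`. -/
theorem exists_kPolynomial : ∃ K, IsKPolynomial I K ∧
    ∀ d : ℕ, (∀ f ∈ I, ∀ D, weightedHomogeneousComponent (varDegree m n) D f ∈ I) →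
      (∀ B : Finset (Fin m × Fin n),
        AlgebraicIndependent k (fun p : B => Ideal.Quotient.mk I (X p.1)) → B.card + d ≤ m * n) →
      OrdGe d (oneSub m n K) := by
  classical
  obtain ⟨μ⟩ := exists_monomialOrder (Fin m × Fin n)
  obtain ⟨ι, _, v, B, hsub, huniq⟩ := exists_cells Finset.univ (standardExponents I μ)
    (isLowerSet_standardExponents I μ) (fun _ _ => Finset.subset_univ _)
  have hsum : setSeries (standardExponents I μ) = ∑ q, setSeries (cell (v q) (B q)) := by
    funext W
    have e : (∑ q, setSeries (cell (v q) (B q))) W = ∑ q, setSeries (cell (v q) (B q)) W := by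
      exact Finset.sum_apply W Finset.univ _
    rw [e]
    simp only [setSeries]
    rw [Finset.sum_comm]
    refine Finset.sum_congr rfl fun a _ => ?_
    split_ifs with ha
    · obtain ⟨q, hq, hq'⟩ := huniq a ha
      rw [Finset.sum_eq_single q]
      · rw [if_pos hq]
      · intro q' _ h; exact if_neg fun h' => h (hq' q' h')
      · simp
    · symm
      exact Finset.sum_eq_zero fun q _ => if_neg fun h => ha (hsub q h)
  -- The cell `v + ℕ^B` has the series `u^v / ∏_(p ∈ B) (1 - u t)`, so over the full denominator its
  -- numerator keeps the factors with `p ∉ B`.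
  refine ⟨∑ q, monomial (Finsupp.weight (varDegree m n) (v q)) 1 *
    ∏ p ∈ (B q)ᶜ, (1 - X (Sum.inl p.1) * X (Sum.inr p.2)), ?_, ?_⟩
  · rw [IsKPolynomial, hilb_eq_setSeries I μ, hsum, ← coeToMvPowerSeries.ringHom_apply]
    simp only [map_mul, map_one, map_sum, map_prod, map_sub]
    simp only [coeToMvPowerSeries.ringHom_apply, coe_X, coe_monomial]
    rw [Finset.sum_mul]
    refine Finset.sum_congr rfl fun q _ => ?_
    rw [← setSeries_cell_mul, mul_assoc, Finset.prod_mul_prod_compl]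
  · intro d hI hd
    rw [map_sum]
    refine OrdGe.sum _ fun q _ => ?_
    -- A relation among the variables in `B` would have a homogeneous component in `I` whose leading
    -- exponent is supported in `B`. Added to `v q`, this exponent stays in the cell, hence is
    -- standard, and so is the exponent itself by the lower set property: a contradiction.
    have hind : AlgebraicIndependent k (fun p : B q => Ideal.Quotient.mk I (X p.1)) := by
      rw [AlgebraicIndependent, injective_iff_map_eq_zero]
      intro f hf
      by_contra hf0
      set g : CoordRing k m n := rename Subtype.val f with hg
      have hg0 : g ≠ 0 := fun h => hf0 (rename_injective _ Subtype.val_injective (h.trans (map_zero _).symm))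
      have hgI : g ∈ I := by
        rw [← Ideal.Quotient.eq_zero_iff_mem, ← hf, hg]
        have : (Ideal.Quotient.mkₐ k I).comp (rename Subtype.val)
            = aeval (fun p : B q => Ideal.Quotient.mk I (X p.1)) := by
          apply algHom_ext
          intro p
          simp
        exact DFunLike.congr_fun this f
      obtain ⟨e, he⟩ := ne_zero_iff.1 hg0
      set D := Finsupp.weight (varDegree m n) e
      set h := weightedHomogeneousComponent (varDegree m n) D g with hh
      have hne : h ≠ 0 := by
        rw [ne_zero_iff]
        exact ⟨e, by rw [hh, coeff_weightedHomogeneousComponent, if_pos rfl]; exact he⟩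
      have hL : μ.degree h ∈ standardExponents I μ := by
        have hc := μ.coeff_degree_ne_zero_iff.2 hne
        rw [hh, coeff_weightedHomogeneousComponent] at hc
        have hc' := (ite_ne_right_iff.1 hc).2
        obtain ⟨s, hs, hs'⟩ := coeff_rename_ne_zero _ _ _ hc'
        refine isLowerSet_standardExponents I μ (a := v q + μ.degree h) le_add_self ?_
        refine hsub q (mem_cell.2 fun i => ⟨by simp, fun hi => ?_⟩)
        rw [Finsupp.add_apply, ← hs, Finsupp.mapDomain_of_notMem_range, add_zero]
        rintro ⟨a, rfl⟩
        exact hi a.2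
      refine hL h (hI g hgI D) ?_ hne rfl
      have hw := weightedHomogeneousComponent_isWeightedHomogeneous (w := varDegree m n) D g
      rwa [hw (μ.coeff_degree_ne_zero_iff.2 hne)]
    have hcard := hd (B q) hind
    rw [map_mul, map_prod]
    have h1 := (OrdGe.zero (oneSub m n (monomial (Finsupp.weight (varDegree m n) (v q)) 1))).mul
      (OrdGe.prod (B q)ᶜ (d := fun _ => 1) fun p _ => ordGe_oneSub p)
    refine h1.mono ?_
    rw [Finset.sum_const, smul_eq_mul, mul_one, Finset.card_compl, Fintype.card_prod,
      Fintype.card_fin, Fintype.card_fin]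
    omega

end Macaulay

/-! ### Height and transcendence degree of primes in polynomial rings -/

section Dimension

universe u v w

/-- Induction on the number of variables: since the ring is Jacobson, a maximal ideal of `K[A][X]`
contracts to a maximal ideal of `K[A]`, and the height grows by one. -/
theorem height_of_isMaximal {K : Type u} [Field K] {A : Type v} [Finite A] :
    ∀ (P : Ideal (MvPolynomial A K)) [P.IsMaximal], P.height = Nat.card A := by
  induction A using Finite.induction_empty_option with
  | of_equiv e H =>
    intro P hP
    have e' := (renameEquiv K e).toRingEquiv
    rw [← RingEquiv.height_comap e' P, ← Nat.card_congr e]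
    have : (P.comap e').IsMaximal := Ideal.comap_isMaximal_of_equiv e'
    exact H _
  | h_empty =>
    intro P hP
    have e := (isEmptyAlgEquiv K PEmpty.{v+1}).toRingEquiv
    have hm : (P.comap e.symm).IsMaximal := Ideal.comap_isMaximal_of_equiv e.symm
    rw [← RingEquiv.height_comap e.symm P, Ideal.eq_bot_of_prime (P.comap e.symm),
      Ideal.height_bot]
    simp
  | @h_option A _ H =>
    intro P hP
    have e := (optionEquivLeft K A).symm.toRingEquiv
    set P' := P.comap e with hP'
    have : P'.IsMaximal := Ideal.comap_isMaximal_of_equiv e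
    have hc : (P'.comap Polynomial.C).IsMaximal :=
      Polynomial.isMaximal_comap_C_of_isJacobsonRing P'
    rw [← RingEquiv.height_comap e P, ← hP']
    have : P'.LiesOver (P'.comap Polynomial.C) := ⟨rfl⟩
    rw [Polynomial.height_eq_height_add_one (P'.comap Polynomial.C) P', H]
    simp

/-- Inverting the nonzero constants of `D` preserves the height, as `P` avoids them. Over the
fraction field every variable is algebraic modulo `P`, so the extended ideal is maximal. -/
theorem height_of_comap_C_eq_bot {D : Type u} [CommRing D] [IsDomain D] {A : Type v} [Finite A]
    (P : Ideal (MvPolynomial A D)) [P.IsPrime] (h0 : P.comap C = ⊥)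
    (h1 : ∀ a, IsAlgebraic D (Ideal.Quotient.mk P (X a))) : P.height = Nat.card A := by
  let K := FractionRing D
  let M : Submonoid (MvPolynomial A D) := (nonZeroDivisors D).map (C (σ := A))
  have hd : Disjoint (M : Set (MvPolynomial A D)) P := by
    rw [Set.disjoint_left]
    rintro _ ⟨d, hd, rfl⟩ hP
    have : d ∈ P.comap C := hP
    rw [h0] at this
    exact nonZeroDivisors.ne_zero hd this
  let _ : Algebra (MvPolynomial A D) (MvPolynomial A K) := algebraMvPolynomial
  let P' := P.map (algebraMap (MvPolynomial A D) (MvPolynomial A K))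
  have hP' : P'.IsPrime := IsLocalization.isPrime_of_isPrime_disjoint M _ P ‹_› hd
  have hmax : P'.IsMaximal := by
    have hint : Algebra.IsIntegral K (MvPolynomial A K ⧸ P') := by
      have hA : ∀ a, IsIntegral K (Ideal.Quotient.mkₐ K P' (X a)) := by
        intro a
        rw [← isAlgebraic_iff_isIntegral]
        obtain ⟨p, hp, hp0⟩ := h1 a
        refine ⟨p.map (algebraMap D K), ?_, ?_⟩
        · exact (Polynomial.map_ne_zero_iff (IsFractionRing.injective D K)).2 hp
        · have hP : Polynomial.aeval (X a : MvPolynomial A D) p ∈ P := by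
            rw [← Ideal.Quotient.eq_zero_iff_mem, ← hp0, ← Ideal.Quotient.mkₐ_eq_mk D,
              Polynomial.aeval_algHom_apply]
          rw [Polynomial.aeval_algHom_apply, Ideal.Quotient.mkₐ_eq_mk,
            Ideal.Quotient.eq_zero_iff_mem]
          have := Ideal.mem_map_of_mem (algebraMap (MvPolynomial A D) (MvPolynomial A K)) hP
          convert this using 1
          rw [Polynomial.aeval_map_algebraMap, Polynomial.aeval_def, Polynomial.aeval_def,
            Polynomial.hom_eval₂]
          congr 1
          · refine RingHom.ext fun d => ?_
            exact (map_C (algebraMap D K) d).symm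
          · rw [algebraMap_def, map_X]
      have htop : integralClosure K (MvPolynomial A K ⧸ P') = ⊤ := by
        rw [eq_top_iff]
        rintro y -
        obtain ⟨f, rfl⟩ := Ideal.Quotient.mkₐ_surjective K P' y
        induction f using MvPolynomial.induction_on with
        | C a => exact Subalgebra.algebraMap_mem _ a
        | add p q hp hq => rw [map_add]; exact add_mem hp hq
        | mul_X p a hp => rw [map_mul]; exact mul_mem hp (hA a)
      exact integralClosure_eq_top_iff.1 htop
    refine Ideal.Quotient.maximal_of_isField _ ?_
    exact isField_of_isIntegral_of_isField' (R := K) (S := MvPolynomial A K ⧸ P') (Field.toIsField K)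
  rw [← height_of_isMaximal P', IsLocalization.height_map_of_disjoint M P hd]

/-- Coordinates generate the quotient, so a transcendence basis `B` can be chosen among them. Over
`k[B]` the prime `P` contains no nonzero constants, and the other coordinates are algebraic, so
`height_of_comap_C_eq_bot` counts them. -/
theorem exists_isTranscendenceBasis_height {k : Type u} [Field k] {σ : Type v} [Finite σ]
    (P : Ideal (MvPolynomial σ k)) [P.IsPrime] :
    ∃ B : Set σ, IsTranscendenceBasis k (fun p : B => Ideal.Quotient.mk P (X p.1)) ∧
      P.height = Nat.card (Bᶜ : Set σ) := by
  let y : σ → MvPolynomial σ k ⧸ P := fun s => Ideal.Quotient.mk P (X s)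
  have htop : Algebra.adjoin k (Set.range y) = ⊤ := by
    rw [Algebra.adjoin_range_eq_range_aeval, AlgHom.range_eq_top]
    have : aeval y = Ideal.Quotient.mkₐ k P := algHom_ext fun s => by simp [y]
    rw [this]
    exact Ideal.Quotient.mkₐ_surjective k P
  have halg : Algebra.IsAlgebraic (Algebra.adjoin k (Set.range y)) (MvPolynomial σ k ⧸ P) := by
    rw [htop]
    exact ⟨fun a => isAlgebraic_algebraMap (⟨a, trivial⟩ : (⊤ : Subalgebra k (MvPolynomial σ k ⧸ P)))⟩
  obtain ⟨t, hts, ht⟩ := exists_isTranscendenceBasis_subset (R := k) (Set.range y)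
  obtain ⟨B, -, hB⟩ := Set.surjOn_iff_exists_bijOn_subset.1
    (show Set.SurjOn y Set.univ t by simpa [Set.SurjOn] using hts)
  let x : B → MvPolynomial σ k ⧸ P := fun p => y p.1
  have hx : IsTranscendenceBasis k x := by
    have := ht.comp_equiv hB.equiv
    exact this
  refine ⟨B, hx, ?_⟩
  classical
  let e : MvPolynomial σ k ≃ₐ[k] MvPolynomial (Bᶜ : Set σ) (MvPolynomial B k) :=
    (renameEquiv k ((Equiv.sumComm _ _).trans (Equiv.Set.sumCompl B)).symm).trans
      (sumAlgEquiv k _ _)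
  have heB : ∀ b : B, e (X b.1) = C (X b) := fun b => by simp [e]
  have heX : ∀ b : (Bᶜ : Set σ), e (X b.1) = X b := fun b => by simp [e]
  let P' := P.comap e.symm.toRingEquiv
  have hP' : P'.IsPrime := Ideal.comap_isPrime _ _
  have hC : ∀ f : MvPolynomial B k, e.symm (C f) = rename Subtype.val f := by
    intro f
    rw [AlgEquiv.symm_apply_eq]
    have : (IsScalarTower.toAlgHom k (MvPolynomial B k) (MvPolynomial (Bᶜ : Set σ) (MvPolynomial B k))) = (e : MvPolynomial σ k →ₐ[k] MvPolynomial (Bᶜ : Set σ) (MvPolynomial B k)).comp (rename Subtype.val) := by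
      refine algHom_ext fun b => ?_
      rw [AlgHom.comp_apply, rename_X]
      exact (heB b).symm
    exact DFunLike.congr_fun this f
  have hmk : ∀ f : MvPolynomial B k, Ideal.Quotient.mk P (rename Subtype.val f) = aeval x f := by
    intro f
    have : (Ideal.Quotient.mkₐ k P).comp (rename Subtype.val) = aeval x :=
      algHom_ext fun b => by simp [x, y]
    exact DFunLike.congr_fun this f
  rw [← RingEquiv.height_comap e.symm.toRingEquiv P]
  refine height_of_comap_C_eq_bot P' ?_ ?_
  · rw [eq_bot_iff]
    intro f hf
    have hf : e.symm (C f) ∈ P := hf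
    rw [hC, ← Ideal.Quotient.eq_zero_iff_mem, hmk] at hf
    exact (injective_iff_map_eq_zero _).1 hx.1 f hf
  · intro a
    have hal := hx.isAlgebraic.isAlgebraic (y a)
    let g : MvPolynomial (Bᶜ : Set σ) (MvPolynomial B k) ⧸ P' →+* MvPolynomial σ k ⧸ P :=
      Ideal.quotientMap P (e.symm.toRingEquiv : MvPolynomial (Bᶜ : Set σ) (MvPolynomial B k) →+* MvPolynomial σ k) le_rfl
    have hg : Function.Injective g := Ideal.quotientMap_injective
    have hga : g (Ideal.Quotient.mk P' (X a)) = y a := by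
      refine (Ideal.quotientMap_mk).trans (congrArg (Ideal.Quotient.mk P) ?_)
      exact (AlgEquiv.symm_apply_eq _).2 (heX a).symm
    refine IsAlgebraic.of_ringHom_of_comp_eq (S := Algebra.adjoin k (Set.range x))
      (f := (hx.1.aevalEquiv : MvPolynomial B k →+* Algebra.adjoin k (Set.range x))) (g := g) (by rw [hga]; exact hal)
      hx.1.aevalEquiv.surjective hg ?_
    refine RingHom.ext fun f => ?_
    have : (algebraMap (MvPolynomial B k) (MvPolynomial (Bᶜ : Set σ) (MvPolynomial B k) ⧸ P')) f = Ideal.Quotient.mk P' (C f) := rfl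
    rw [RingHom.comp_apply, RingHom.comp_apply, this]
    refine (hx.1.algebraMap_aevalEquiv f).trans ((hmk f).symm.trans ?_)
    exact congrArg (Ideal.Quotient.mk P) (hC f).symm

theorem height_add_trdeg {k : Type u} [Field k] {σ : Type v} [Finite σ]
    (P : Ideal (MvPolynomial σ k)) [P.IsPrime] :
    P.height + (Algebra.trdeg k (MvPolynomial σ k ⧸ P)).toENat = Nat.card σ := by
  obtain ⟨B, hB, h⟩ := exists_isTranscendenceBasis_height P
  have h1 := congrArg Cardinal.toENat hB.lift_cardinalMk_eq_trdeg
  rw [Cardinal.toENat_lift, Cardinal.toENat_lift] at h1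
  rw [h, ← h1, ← ENat.card, ENat.card_eq_coe_natCard, ← Nat.cast_add, add_comm]
  classical
  rw [← Nat.card_sum, Nat.card_congr (Equiv.Set.sumCompl B)]

theorem card_add_height_le {k : Type u} [Field k] {σ : Type v} [Finite σ]
    (P : Ideal (MvPolynomial σ k)) [P.IsPrime] {B : Type w} {y : B → MvPolynomial σ k ⧸ P}
    (hy : AlgebraicIndependent k y) : ENat.card B + P.height ≤ Nat.card σ := by
  have h := OrderHomClass.mono Cardinal.toENat hy.lift_cardinalMk_le_trdeg
  rw [Cardinal.toENat_lift, Cardinal.toENat_lift] at h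
  rw [← height_add_trdeg P, add_comm]
  gcongr
  exact h

end Dimension

/-! ### The codimension of the raised variety -/

section DimensionOfRaise

universe u

variable {k : Type u} [Field k] {r n : ℕ}

/-- The matrix of coordinate functions modulo an ideal. -/
def coordMat (I : Ideal (CoordRing k r n)) (l : Fin r) (b : Fin n) : CoordRing k r n ⧸ I :=
  Ideal.Quotient.mk I (X (l, b))

/-- The comorphism of `(z, x) ↦ (x, z x)`, with `z` a `c × r` matrix. -/
def shearHom (k : Type u) [Field k] {Q : Type u} [CommRing Q] [Algebra k Q] (c : ℕ) {r n : ℕ}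
    (x : Fin r → Fin n → Q) : CoordRing k (r + c) n →ₐ[k] MvPolynomial (Fin c × Fin r) Q :=
  aeval fun p => Fin.addCases (motive := fun _ => MvPolynomial (Fin c × Fin r) Q)
    (fun i => C (x i p.2)) (fun j => ∑ l, C (x l p.2) * X (j, l)) p.1

section

variable {Q : Type u} [CommRing Q] [Algebra k Q] {c : ℕ} (x : Fin r → Fin n → Q)

theorem shearHom_castAdd (i : Fin r) (b : Fin n) :
    shearHom k c x (X (Fin.castAdd c i, b)) = C (x i b) := by simp [shearHom]

theorem shearHom_natAdd (j : Fin c) (b : Fin n) :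
    shearHom k c x (X (Fin.natAdd r j, b)) = ∑ l, C (x l b) * X (j, l) := by simp [shearHom]

/-- Specializing the top block of `a` to the identity and the bottom block to `z` turns `a x` into
`(x, z x)`. -/
theorem ker_mulHom_le_ker_shearHom :
    RingHom.ker (mulHom k (r + c) x) ≤ RingHom.ker (shearHom k c x) := by
  classical
  let ev : MvPolynomial (Fin (r + c) × Fin r) Q →ₐ[Q] MvPolynomial (Fin c × Fin r) Q :=
    aeval fun p => Fin.addCases (motive := fun _ => MvPolynomial (Fin c × Fin r) Q)
      (fun i => if p.2 = i then 1 else 0) (fun j => X (j, p.2)) p.1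
  have h : (ev.restrictScalars k).comp (mulHom k (r + c) x) = shearHom k c x := by
    refine algHom_ext fun p => ?_
    obtain ⟨i, b⟩ := p
    rw [AlgHom.comp_apply, mulHom_X, AlgHom.restrictScalars_apply, map_sum]
    refine Fin.addCases (fun i => ?_) (fun j => ?_) i
    · simp [shearHom_castAdd, ev, algebraMap_eq]
    · simp [shearHom_natAdd, ev, algebraMap_eq]
  intro f hf
  rw [RingHom.mem_ker] at hf ⊢
  rw [← h, AlgHom.comp_apply, hf, map_zero]

theorem C_mem_range_shearHom (hx : Algebra.adjoin k (Set.range fun p : Fin r × Fin n => x p.1 p.2) = ⊤)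
    (q : Q) : C q ∈ (shearHom k c x).range := by
  have h : (⊤ : Subalgebra k Q) ≤ (shearHom k c x).range.comap
      (IsScalarTower.toAlgHom k Q (MvPolynomial (Fin c × Fin r) Q)) := by
    rw [← hx, Algebra.adjoin_le_iff]
    rintro _ ⟨p, rfl⟩
    exact ⟨X (Fin.castAdd c p.1, p.2), shearHom_castAdd x _ _⟩
  exact h (x := q) trivial

variable [IsDomain Q]

/-- Where the rank condition enters. For a square submatrix `M` of `x` with nonzero determinant,
`det M · z = (z M) adj M`, so every entry of `z` is a quotient of elements of the image; the
appended rows `z x` thus carry `c r` independent parameters. -/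
theorem isAlgebraic_range_shearHom
    (hx : Algebra.adjoin k (Set.range fun p : Fin r × Fin n => x p.1 p.2) = ⊤)
    (b : Fin r → Fin n) (hb : (Matrix.of fun l j => x l (b j)).det ≠ 0) :
    Algebra.IsAlgebraic (shearHom k c x).range (MvPolynomial (Fin c × Fin r) Q) := by
  set S := (shearHom k c x).range
  set M : Matrix (Fin r) (Fin r) Q := Matrix.of fun l j => x l (b j) with hM
  have hX : ∀ p : Fin c × Fin r, IsAlgebraic S (X p : MvPolynomial (Fin c × Fin r) Q) := by
    rintro ⟨j, s⟩
    let Y : Matrix (Fin c) (Fin r) (MvPolynomial (Fin c × Fin r) Q) :=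
      Matrix.of fun j l => X (j, l)
    let M' : Matrix (Fin r) (Fin r) (MvPolynomial (Fin c × Fin r) Q) := M.map C
    have h1 : Y * M' * M'.adjugate = M'.det • Y := by
      rw [Matrix.mul_assoc, Matrix.mul_adjugate]; simp
    have hdet : M'.det = C M.det := by
      rw [RingHom.map_det]; rfl
    have h2 : ∀ a l, (Y * M') a l ∈ S := fun a l => by
      refine ⟨X (Fin.natAdd r a, b l), ?_⟩
      refine (shearHom_natAdd x _ _).trans ?_
      simp [Matrix.mul_apply, Y, M', hM, mul_comm]
    have h3 : ∀ a l, M'.adjugate a l ∈ S := fun a l => by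
      have : M'.adjugate = M.adjugate.map C := (RingHom.map_adjugate C M).symm
      rw [this]
      exact C_mem_range_shearHom x hx _
    have h4 : C M.det * X (j, s) ∈ S := by
      have := congrFun (congrFun h1 j) s
      rw [hdet, Matrix.smul_apply, smul_eq_mul] at this
      have h5 : Y j s = X (j, s) := rfl
      rw [← h5, ← this, Matrix.mul_apply]
      exact Subalgebra.sum_mem _ fun l _ => mul_mem (h2 _ _) (h3 _ _)
    refine ⟨Polynomial.C ⟨_, C_mem_range_shearHom x hx M.det⟩ * Polynomial.X
      - Polynomial.C ⟨_, h4⟩, ?_, ?_⟩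
    · intro h
      have := congrArg (fun p => Polynomial.coeff p 1) h
      simp only [Polynomial.coeff_sub, Polynomial.coeff_C_mul, Polynomial.coeff_X_one, mul_one,
        Polynomial.coeff_C_succ, sub_zero, Polynomial.coeff_zero] at this
      have := congrArg Subtype.val this
      exact hb ((C_eq_zero).1 this)
    · simp only [map_sub, map_mul, Polynomial.aeval_C, Polynomial.aeval_X]
      exact sub_self _
  refine ⟨fun f => ?_⟩
  rw [← Subalgebra.mem_algebraicClosure]
  induction f using MvPolynomial.induction_on with
  | C q =>
    exact Subalgebra.algebraMap_mem (Subalgebra.algebraicClosure S (MvPolynomial (Fin c × Fin r) Q))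
      (⟨C q, C_mem_range_shearHom x hx q⟩ : S)
  | add p q hp hq => exact add_mem hp hq
  | mul_X p a hp => exact mul_mem hp (hX a)

theorem trdeg_ker_shearHom
    (hx : Algebra.adjoin k (Set.range fun p : Fin r × Fin n => x p.1 p.2) = ⊤)
    (b : Fin r → Fin n) (hb : (Matrix.of fun l j => x l (b j)).det ≠ 0) :
    Algebra.trdeg k (CoordRing k (r + c) n ⧸ RingHom.ker (shearHom k c x))
      = Algebra.trdeg k Q + (c * r : ℕ) := by
  have := isAlgebraic_range_shearHom (c := c) x hx b hb
  rw [(Ideal.quotientKerEquivRange (shearHom k c x)).trdeg_eq]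
  have h1 := trdeg_add_eq (R := k) (S := (shearHom k c x).range) (A := MvPolynomial (Fin c × Fin r) Q)
  have h2 := trdeg_add_eq (R := k) (S := Q) (A := MvPolynomial (Fin c × Fin r) Q)
  rw [trdeg_eq_zero (R := (shearHom k c x).range), add_zero] at h1
  rw [h1, ← h2, MvPolynomial.trdeg_of_isDomain]
  simp

end

variable (I : Ideal (CoordRing k r n))

theorem adjoin_coordMat :
    Algebra.adjoin k (Set.range fun p : Fin r × Fin n => coordMat I p.1 p.2) = ⊤ := by
  rw [Algebra.adjoin_range_eq_range_aeval, AlgHom.range_eq_top]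
  have : aeval (fun p : Fin r × Fin n => coordMat I p.1 p.2) = Ideal.Quotient.mkₐ k I :=
    algHom_ext fun s => by simp [coordMat]
  rw [this]
  exact Ideal.Quotient.mkₐ_surjective k I

/-- With blocks `a₁`, `a₂` of `a` and `a₁` invertible, `a x = (a₁ x, z (a₁ x))` for `z = a₂ a₁⁻¹`:
the product is a value of the shear at the point `a₁ x`. The map `τ` says that `a₁ x` is again a
point of `X`. -/
theorem ker_shearHom_le {Q : Type u} [CommRing Q] [Algebra k Q] {c : ℕ} (x : Fin r → Fin n → Q)
    {F : Type u} [Field F] [Algebra k F] (ι : MvPolynomial (Fin (r + c) × Fin r) Q →ₐ[k] F)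
    (hι : Function.Injective ι) (τ : Q →ₐ[k] F)
    (hτ : ∀ l b, τ (x l b) = ∑ s, ι (C (x s b)) * ι (X (Fin.castAdd c l, s)))
    (hA : IsUnit (Matrix.of fun i l : Fin r => ι (X (Fin.castAdd c i, l))).det) :
    RingHom.ker (shearHom k c x) ≤ RingHom.ker (mulHom k (r + c) x) := by
  set A₁ : Matrix (Fin r) (Fin r) F := Matrix.of fun i l => ι (X (Fin.castAdd c i, l)) with hA₁
  let A₂ : Matrix (Fin c) (Fin r) F := Matrix.of fun i l => ι (X (Fin.natAdd r i, l))
  let x' : Matrix (Fin r) (Fin n) F := Matrix.of fun l b => ι (C (x l b))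
  have hτ' : ∀ l b, τ (x l b) = (A₁ * x') l b := by
    intro l b
    rw [hτ, Matrix.mul_apply]
    exact Finset.sum_congr rfl fun s _ => mul_comm _ _
  let N : Matrix (Fin c) (Fin r) F := A₂ * A₁⁻¹
  let θ : MvPolynomial (Fin c × Fin r) Q →+* F := eval₂Hom (τ : Q →+* F) fun p => N p.1 p.2
  have hθC : ∀ q, θ (C q) = τ q := fun q => eval₂Hom_C _ _ _
  have hθX : ∀ p, θ (X p) = N p.1 p.2 := fun p => eval₂Hom_X' _ _ _
  clear_value θ
  have hθ : ∀ f, θ (shearHom k c x f) = ι (mulHom k (r + c) x f) := by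
    intro f
    have : θ.comp (shearHom k c x : CoordRing k (r + c) n →+* MvPolynomial (Fin c × Fin r) Q) = (ι.comp (mulHom k (r + c) x) : CoordRing k (r + c) n →+* F) := by
      refine MvPolynomial.ringHom_ext (fun a => ?_) (fun p => ?_)
      · have h1 : shearHom k c x (C a) = C (algebraMap k Q a) := (shearHom k c x).commutes a
        have h2 : τ (algebraMap k Q a) = algebraMap k F a := τ.commutes a
        have h3 : (ι.comp (mulHom k (r + c) x)) (C a) = algebraMap k F a :=
          (ι.comp (mulHom k (r + c) x)).commutes a
        rw [RingHom.comp_apply, RingHom.coe_coe, RingHom.coe_coe, h1, h3, hθC, h2]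
      · obtain ⟨i, b⟩ := p
        rw [RingHom.comp_apply, RingHom.coe_coe, RingHom.coe_coe, AlgHom.comp_apply, mulHom_X,
          map_sum]
        refine Fin.addCases (fun i => ?_) (fun j => ?_) i
        · rw [shearHom_castAdd, hθC, hτ]
          exact Finset.sum_congr rfl fun s _ => (map_mul ι _ _).symm
        · rw [shearHom_natAdd, map_sum]
          have h1 : (N * (A₁ * x')) j b = (A₂ * x') j b := by
            rw [← Matrix.mul_assoc, Matrix.mul_assoc A₂, Matrix.nonsing_inv_mul _ hA, Matrix.mul_one]
          rw [Matrix.mul_apply, Matrix.mul_apply] at h1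
          refine Eq.trans ?_ (h1.trans ?_)
          · refine Finset.sum_congr rfl fun s _ => ?_
            rw [map_mul, mul_comm, hθX, hθC, hτ']
          · refine Finset.sum_congr rfl fun s _ => ?_
            rw [map_mul, mul_comm]
            rfl
    exact DFunLike.congr_fun this f
  intro f hf
  have hf : shearHom k c x f = 0 := hf
  have := hθ f
  rw [hf, map_zero] at this
  exact (map_eq_zero_iff ι hι).1 this.symm

theorem isUnit_det_block {Q F : Type*} [CommRing Q] [Nontrivial Q] [Field F] {c : ℕ}
    (ι : MvPolynomial (Fin (r + c) × Fin r) Q →+* F) (hι : Function.Injective ι) :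
    IsUnit (Matrix.of fun i l : Fin r => ι (X (Fin.castAdd c i, l))).det := by
  let f : Fin r × Fin r → Fin (r + c) × Fin r := Prod.map (Fin.castAdd c) id
  have hf : Function.Injective f := (Fin.castAdd_injective r c).prodMap Function.injective_id
  let g : MvPolynomial (Fin r × Fin r) Q →+* F := ι.comp (rename f : _ →ₐ[Q] _).toRingHom
  have hg : Function.Injective g := hι.comp (rename_injective f hf)
  have h1 : (Matrix.of fun i l : Fin r => ι (X (Fin.castAdd c i, l)))
      = (Matrix.mvPolynomialX (Fin r) (Fin r) Q).map g := by
    ext i l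
    simp [g, f]
  rw [isUnit_iff_ne_zero, h1]
  refine ne_of_eq_of_ne (RingHom.map_det g _).symm ?_
  rw [map_ne_zero_iff g hg]
  exact Matrix.det_mvPolynomialX_ne_zero _ _

theorem ker_shearHom_eq_of_lift {Q : Type u} [CommRing Q] [Algebra k Q] [IsDomain Q] (c : ℕ)
    (x : Fin r → Fin n → Q) (σ : Q →ₐ[k] MvPolynomial (Fin r × Fin r) Q)
    (hσ : ∀ l b, σ (x l b) = mulHom k r x (X (l, b)))
    {F : Type u} [Field F] [Algebra k F] (ι : MvPolynomial (Fin (r + c) × Fin r) Q →ₐ[k] F)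
    (hι : Function.Injective ι) :
    RingHom.ker (shearHom k c x) = RingHom.ker (mulHom k (r + c) x) := by
  refine le_antisymm ?_ (ker_mulHom_le_ker_shearHom _)
  let ren : MvPolynomial (Fin r × Fin r) Q →ₐ[Q] MvPolynomial (Fin (r + c) × Fin r) Q :=
    rename (Prod.map (Fin.castAdd c) id)
  refine ker_shearHom_le x ι hι ((ι.comp (ren.restrictScalars k)).comp σ) ?_
    (isUnit_det_block (ι : MvPolynomial (Fin (r + c) × Fin r) Q →+* F) hι)
  intro l b
  rw [AlgHom.comp_apply, hσ, mulHom_X, map_sum]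
  refine Finset.sum_congr rfl fun s _ => ?_
  rw [map_mul]
  simp [ren]

/-- The hypothesis on `I` says that `a x`, for generic square `a`, satisfies the equations of `I`;
this yields the map `τ` of `ker_shearHom_le`. -/
theorem ker_shearHom_eq [I.IsPrime] (hI : I ≤ RingHom.ker (mulHom k r (coordMat I))) (c : ℕ) :
    RingHom.ker (shearHom k c (coordMat I)) = RingHom.ker (mulHom k (r + c) (coordMat I)) :=
  ker_shearHom_eq_of_lift c (coordMat I)
    (Ideal.Quotient.liftₐ I (mulHom k r (coordMat I)) fun _ hf => hI hf)
    (fun _ _ => Ideal.Quotient.liftₐ_apply _ _ _ _)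
    (IsScalarTower.toAlgHom k (MvPolynomial (Fin (r + c) × Fin r) (CoordRing k r n ⧸ I))
      (FractionRing (MvPolynomial (Fin (r + c) × Fin r) (CoordRing k r n ⧸ I))))
    fun _ _ h =>
      IsFractionRing.injective (MvPolynomial (Fin (r + c) × Fin r) (CoordRing k r n ⧸ I)) _ h

theorem le_of_det_ne_zero {Q : Type*} [CommRing Q] {x : Fin r → Fin n → Q} (b : Fin r → Fin n)
    (hb : (Matrix.of fun l j => x l (b j)).det ≠ 0) : r ≤ n := by
  have hinj : Function.Injective b := fun i j he => by
    by_contra hij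
    exact hb (Matrix.det_zero_of_column_eq hij fun l => by simp [he])
  simpa using Fintype.card_le_of_injective b hinj

/-- The dimension grows by `c r`, the number of entries of `z`, and the ambient dimension by `c n`.
-/
theorem height_ker_mulHom [I.IsPrime] (hI : I ≤ RingHom.ker (mulHom k r (coordMat I)))
    (b : Fin r → Fin n) (hb : (Matrix.of fun l j => coordMat I l (b j)).det ≠ 0) (c : ℕ)
    {d : ℕ} (hd : I.height = d) :
    (RingHom.ker (mulHom k (r + c) (coordMat I))).height = (d + c * (n - r) : ℕ) := by
  have hrn : r ≤ n := le_of_det_ne_zero b hb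
  have hp : (RingHom.ker (mulHom k (r + c) (coordMat I))).IsPrime := RingHom.ker_isPrime _
  have h1 := height_add_trdeg (RingHom.ker (mulHom k (r + c) (coordMat I)))
  have h2 := height_add_trdeg I
  have h3 := trdeg_ker_shearHom (c := c) (coordMat I) (adjoin_coordMat I) b hb
  rw [ker_shearHom_eq I hI] at h3
  rw [h3] at h1
  rw [hd] at h2
  have hfin : Algebra.trdeg k (CoordRing k r n ⧸ I) < Cardinal.aleph0 :=
    trdeg_lt_aleph0_of_finiteType
  obtain ⟨t, ht⟩ := Cardinal.lt_aleph0.1 hfin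
  rw [ht] at h1 h2
  simp only [map_add, Cardinal.toENat_nat, Nat.card_prod, Nat.card_fin] at h1 h2
  have h2' : d + t = r * n := by exact_mod_cast h2
  generalize (RingHom.ker (mulHom k (r + c) (coordMat I))).height = H at h1 ⊢
  cases H with
  | top => exact absurd h1 (by rw [top_add]; exact ENat.top_ne_natCast _)
  | coe H =>
    have h1' : H + (t + c * r) = (r + c) * n := by exact_mod_cast h1
    obtain ⟨e, rfl⟩ := Nat.exists_eq_add_of_le hrn
    congr 1
    rw [Nat.add_sub_cancel_left]
    nlinarith

end DimensionOfRaise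

/-! ### The group action and the ideal of the raised variety -/

section Stable

universe u

variable {k : Type u} [Field k] {r n : ℕ}

theorem actHom_X (g : Matrix.GeneralLinearGroup (Fin r) k) (t : Fin n → kˣ) (p : Fin r × Fin n) :
    actHom g t (X p) = ∑ l, C (g.1 p.1 l * ((t p.2)⁻¹ : kˣ)) * X (l, p.2) := by
  simp [actHom]

theorem actHom_C (g : Matrix.GeneralLinearGroup (Fin r) k) (t : Fin n → kˣ) (a : k) :
    actHom g t (C a) = C a := (actHom g t).commutes a

theorem actHom_one_one : actHom (1 : Matrix.GeneralLinearGroup (Fin r) k) (1 : Fin n → kˣ)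
    = AlgHom.id k _ := by
  refine algHom_ext fun p => ?_
  rw [actHom_X, Finset.sum_eq_single p.1]
  · simp
  · intro l _ hl
    simp [Matrix.one_apply_ne hl.symm]
  · simp

theorem actHom_comp_actHom (g h : Matrix.GeneralLinearGroup (Fin r) k) (s t : Fin n → kˣ) :
    (actHom g s).comp (actHom h t) = actHom (h * g) (s * t) := by
  refine algHom_ext fun p => ?_
  rw [AlgHom.comp_apply, actHom_X, actHom_X, map_sum]
  simp only [map_mul (actHom g s), actHom_C, actHom_X, Finset.mul_sum]
  rw [Finset.sum_comm]
  refine Finset.sum_congr rfl fun l _ => ?_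
  rw [Units.val_mul, Matrix.mul_apply, Finset.sum_mul, map_sum, Finset.sum_mul]
  refine Finset.sum_congr rfl fun m _ => ?_
  rw [← mul_assoc, ← C_mul]
  congr 2
  simp only [Pi.mul_apply, mul_inv, Units.val_mul]
  ring

theorem embedHom_castAdd (c : ℕ) (i : Fin r) (b : Fin n) :
    embedHom k r n c (X (Fin.castAdd c i, b)) = X (i, b) := by simp [embedHom]

theorem embedHom_natAdd (c : ℕ) (j : Fin c) (b : Fin n) :
    embedHom k r n c (X (Fin.natAdd r j, b)) = 0 := by simp [embedHom]

theorem embedHom_comp_actHom_one (c : ℕ) (t : Fin n → kˣ) :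
    (embedHom k r n c).comp (actHom 1 t) = (actHom 1 t).comp (embedHom k r n c) := by
  refine algHom_ext fun p => ?_
  obtain ⟨i, b⟩ := p
  have h : ∀ {m : ℕ} (i : Fin m) (b : Fin n),
      actHom (1 : Matrix.GeneralLinearGroup (Fin m) k) t (X (i, b)) = C ((t b)⁻¹ : kˣ).1 * X (i, b) := by
    intro m i b
    rw [actHom_X, Finset.sum_eq_single i]
    · simp
    · intro l _ hl
      simp [Matrix.one_apply_ne hl.symm]
    · simp
  rw [AlgHom.comp_apply, AlgHom.comp_apply, h, map_mul,
    show embedHom k r n c (C ((t b)⁻¹ : kˣ).1) = C ((t b)⁻¹ : kˣ).1 from (embedHom k r n c).commutes _]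
  refine Fin.addCases (fun i => ?_) (fun j => ?_) i
  · rw [embedHom_castAdd, h]
  · rw [embedHom_natAdd, mul_zero, map_zero]

theorem act_act (g h : Matrix.GeneralLinearGroup (Fin r) k) (s t : Fin n → kˣ)
    (x : MatSpace k r n) : act h t (act g s x) = act (h * g) (s * t) x := by
  have he : (actHom g s).toRingHom.comp (actHom h t).toRingHom = (actHom (h * g) (s * t)).toRingHom :=
    RingHom.ext fun f => DFunLike.congr_fun (actHom_comp_actHom g h s t) f
  rw [act, act, act, ← PrimeSpectrum.comap_comp_apply, he]

theorem act_one_one (x : MatSpace k r n) : act 1 1 x = x := by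
  rw [act, actHom_one_one]
  rfl

theorem act_one_embed (c : ℕ) (t : Fin n → kˣ) (x : MatSpace k r n) :
    act 1 t (embed c x) = embed c (act 1 t x) := by
  have := congrArg (fun f : CoordRing k (r + c) n →ₐ[k] CoordRing k r n =>
    PrimeSpectrum.comap f.toRingHom x) (embedHom_comp_actHom_one (k := k) (r := r) c t)
  exact this

theorem continuous_act (g : Matrix.GeneralLinearGroup (Fin r) k) (t : Fin n → kˣ) :
    Continuous (act g t) := PrimeSpectrum.continuous_comap _

theorem isStable_raise (c : ℕ) {X : Set (MatSpace k r n)} (hX : IsStable X) :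
    IsStable (raise c X) := by
  intro h t
  refine (image_closure_subset_closure_image (continuous_act h t)).trans (closure_mono ?_)
  rintro _ ⟨y, hy, rfl⟩
  obtain ⟨g, hg⟩ := Set.mem_iUnion.1 hy
  obtain ⟨_, ⟨x, hx, rfl⟩, rfl⟩ := hg
  refine Set.mem_iUnion.2 ⟨h * g, ?_⟩
  refine ⟨embed c (act 1 t x), ⟨_, hX 1 t ⟨x, hx, rfl⟩, rfl⟩, ?_⟩
  rw [← act_one_embed, act_act, act_act]
  simp

theorem embed_subset_raise (c : ℕ) (X : Set (MatSpace k r n)) : embed c '' X ⊆ raise c X := by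
  refine Set.Subset.trans ?_ subset_closure
  intro y hy
  exact Set.mem_iUnion.2 ⟨1, y, hy, act_one_one y⟩

theorem raise_subset (c : ℕ) {X : Set (MatSpace k r n)} {Y : Set (MatSpace k (r + c) n)}
    (hY : IsClosed Y) (hs : IsStable Y) (h : embed c '' X ⊆ Y) : raise c X ⊆ Y := by
  refine closure_minimal (Set.iUnion_subset fun g => ?_) hY
  exact (Set.image_mono h).trans (hs g 1)

theorem actHom_mem_vanishingIdeal {X : Set (MatSpace k r n)} (hX : IsStable X)
    (g : Matrix.GeneralLinearGroup (Fin r) k) (t : Fin n → kˣ) {f : CoordRing k r n}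
    (hf : f ∈ PrimeSpectrum.vanishingIdeal X) : actHom g t f ∈ PrimeSpectrum.vanishingIdeal X := by
  rw [PrimeSpectrum.mem_vanishingIdeal] at hf ⊢
  intro x hx
  exact hf _ (hX g t ⟨x, hx, rfl⟩)

theorem mem_vanishingIdeal_raise (c : ℕ) {X : Set (MatSpace k r n)} {f : CoordRing k (r + c) n} :
    f ∈ PrimeSpectrum.vanishingIdeal (raise c X) ↔
      ∀ g, embedHom k r n c (actHom g 1 f) ∈ PrimeSpectrum.vanishingIdeal X := by
  rw [raise, PrimeSpectrum.vanishingIdeal_closure]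
  simp only [PrimeSpectrum.mem_vanishingIdeal, Set.mem_iUnion]
  constructor
  · intro h g x hx
    exact h _ ⟨g, _, ⟨x, hx, rfl⟩, rfl⟩
  · rintro h _ ⟨g, _, ⟨x, hx, rfl⟩, rfl⟩
    exact h g x hx

/-- Density of `GL_m(k)` in all matrices: times the generic determinant, the polynomial vanishes at
every matrix over the infinite field `k`, hence is zero. The map `φ` selects the columns of `g` that
occur. -/
theorem eq_zero_of_eval_gl {Q : Type*} [CommRing Q] [IsDomain Q] [Algebra k Q] [Infinite k] {m : ℕ}
    {φ : Fin r → Fin m} (hφ : Function.Injective φ) {p : MvPolynomial (Fin m × Fin r) Q}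
    (h : ∀ g : Matrix.GeneralLinearGroup (Fin m) k,
      eval (fun q => algebraMap k Q (g.1 q.1 (φ q.2))) p = 0) : p = 0 := by
  let f : Fin m × Fin r → Fin m × Fin m := Prod.map id φ
  have hf : Function.Injective f := Function.injective_id.prodMap hφ
  have hprod : rename f p * Matrix.det (Matrix.mvPolynomialX (Fin m) (Fin m) Q) = 0 := by
    refine funext_set (fun _ => Set.range (algebraMap k Q))
      (fun _ => Set.infinite_range_of_injective (algebraMap k Q).injective) fun y hy => ?_
    choose s hs using fun i => hy i trivial
    obtain rfl : (fun i => algebraMap k Q (s i)) = y := funext hs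
    rw [map_mul, map_zero, Matrix.eval_det_mvPolynomialX, eval_rename]
    by_cases hd : Matrix.det (Matrix.of fun i j : Fin m => s (i, j)) = 0
    · have : (Matrix.of fun i j : Fin m => algebraMap k Q (s (i, j))).det
          = algebraMap k Q (Matrix.of fun i j : Fin m => s (i, j)).det :=
        ((algebraMap k Q).map_det _).symm
      rw [this, hd, map_zero, mul_zero]
    · have := h (Matrix.GeneralLinearGroup.mkOfDetNeZero _ hd)
      rw [show eval ((fun i => algebraMap k Q (s i)) ∘ f) p = 0 from this, zero_mul]
  have := (mul_eq_zero.1 hprod).resolve_right (Matrix.det_mvPolynomialX_ne_zero _ _)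
  exact rename_injective f hf (this.trans (map_zero _).symm)

theorem eval_mulHom {Q : Type*} [CommRing Q] [Algebra k Q] {m : ℕ} (x : Fin r → Fin n → Q)
    (s : Fin m × Fin r → k) (f : CoordRing k m n) :
    eval (fun q => algebraMap k Q (s q)) (mulHom k m x f)
      = aeval (fun p : Fin m × Fin n => ∑ l, algebraMap k Q (s (p.1, l)) * x l p.2) f := by
  have : ((aeval (R := Q) fun q => algebraMap k Q (s q)).restrictScalars k).comp (mulHom k m x)
      = aeval (fun p : Fin m × Fin n => ∑ l, algebraMap k Q (s (p.1, l)) * x l p.2) := by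
    refine algHom_ext fun p => ?_
    rw [AlgHom.comp_apply, mulHom_X, AlgHom.restrictScalars_apply, map_sum, aeval_X]
    refine Finset.sum_congr rfl fun l _ => ?_
    rw [map_mul, aeval_X, aeval_C, mul_comm]
    rfl
  rw [← this]
  rfl

variable {X : Set (MatSpace k r n)}

theorem mk_embedHom_actHom (I : Ideal (CoordRing k r n)) (c : ℕ)
    (g : Matrix.GeneralLinearGroup (Fin (r + c)) k) (f : CoordRing k (r + c) n) :
    Ideal.Quotient.mk I (embedHom k r n c (actHom g 1 f))
      = eval (fun q => algebraMap k (CoordRing k r n ⧸ I) (g.1 q.1 (Fin.castAdd c q.2)))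
        (mulHom k (r + c) (coordMat I) f) := by
  rw [eval_mulHom (coordMat I) (fun q => g.1 q.1 (Fin.castAdd c q.2))]
  have : ((Ideal.Quotient.mkₐ k I).comp (embedHom k r n c)).comp (actHom g 1)
      = aeval (fun p : Fin (r + c) × Fin n => ∑ l : Fin r,
        algebraMap k (CoordRing k r n ⧸ I) (g.1 p.1 (Fin.castAdd c l)) * coordMat I l p.2) := by
    refine algHom_ext fun p => ?_
    rw [AlgHom.comp_apply, actHom_X, map_sum, Fin.sum_univ_add, aeval_X]
    simp only [map_mul, AlgHom.comp_apply, embedHom_castAdd, embedHom_natAdd, map_zero, mul_zero,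
      Finset.sum_const_zero, add_zero]
    refine Finset.sum_congr rfl fun l _ => ?_
    congr 1
    simp only [Pi.one_apply, inv_one, Units.val_one, map_one, mul_one]
    exact ((Ideal.Quotient.mkₐ k I).comp (embedHom k r n c)).commutes _
  exact DFunLike.congr_fun this f

theorem mk_actHom (I : Ideal (CoordRing k r n))
    (g : Matrix.GeneralLinearGroup (Fin r) k) (f : CoordRing k r n) :
    Ideal.Quotient.mk I (actHom g 1 f)
      = eval (fun q => algebraMap k (CoordRing k r n ⧸ I) (g.1 q.1 q.2))
        (mulHom k r (coordMat I) f) := by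
  rw [eval_mulHom (coordMat I) (fun q => g.1 q.1 q.2)]
  have : (Ideal.Quotient.mkₐ k I).comp (actHom g 1)
      = aeval (fun p : Fin r × Fin n => ∑ l : Fin r,
        algebraMap k (CoordRing k r n ⧸ I) (g.1 p.1 l) * coordMat I l p.2) := by
    refine algHom_ext fun p => ?_
    rw [AlgHom.comp_apply, actHom_X, map_sum, aeval_X]
    refine Finset.sum_congr rfl fun l _ => ?_
    rw [map_mul]
    congr 1
    simp only [Pi.one_apply, inv_one, Units.val_one, mul_one]
    exact (Ideal.Quotient.mkₐ k I).commutes _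
  exact DFunLike.congr_fun this f

/-- On `X` followed by zero rows, `g` acts through its first `r` columns only. By density these may
be replaced by a generic `(r + c) × r` matrix. -/
theorem vanishingIdeal_raise [Infinite k] (c : ℕ) (hX : IsIrreducible X) :
    PrimeSpectrum.vanishingIdeal (raise c X)
      = RingHom.ker (mulHom k (r + c) (coordMat (PrimeSpectrum.vanishingIdeal X))) := by
  have hI := PrimeSpectrum.isIrreducible_iff_vanishingIdeal_isPrime.1 hX
  ext f
  rw [mem_vanishingIdeal_raise, RingHom.mem_ker]
  simp only [← Ideal.Quotient.eq_zero_iff_mem, mk_embedHom_actHom]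
  constructor
  · exact fun h => eq_zero_of_eval_gl (Fin.castAdd_injective r c) h
  · intro h g
    rw [h, map_zero]

/-- Stability and density give one inclusion; specializing the generic matrix to the identity gives
the other. -/
theorem vanishingIdeal_eq_ker [Infinite k] (hX : IsIrreducible X) (hs : IsStable X) :
    PrimeSpectrum.vanishingIdeal X
      = RingHom.ker (mulHom k r (coordMat (PrimeSpectrum.vanishingIdeal X))) := by
  have hI := PrimeSpectrum.isIrreducible_iff_vanishingIdeal_isPrime.1 hX
  ext f
  rw [RingHom.mem_ker]
  constructor
  · intro hf
    refine eq_zero_of_eval_gl (k := k) (φ := id) Function.injective_id fun g => ?_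
    have := actHom_mem_vanishingIdeal hs g 1 hf
    rw [← Ideal.Quotient.eq_zero_iff_mem, mk_actHom] at this
    exact this
  · intro h
    have := mk_actHom (PrimeSpectrum.vanishingIdeal X) 1 f
    rw [h, map_zero, Ideal.Quotient.eq_zero_iff_mem, actHom_one_one] at this
    exact this

theorem isLeast_raise [Infinite k] (c : ℕ) (hX : IsIrreducible X) (hs : IsStable X) :
    IsLeast {Y : Set (MatSpace k (r + c) n) |
      IsClosed Y ∧ IsIrreducible Y ∧ IsStable Y ∧ embed c '' X ⊆ Y} (raise c X) := by
  have hI := PrimeSpectrum.isIrreducible_iff_vanishingIdeal_isPrime.1 hX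
  refine ⟨⟨isClosed_closure, ?_, isStable_raise c hs, embed_subset_raise c X⟩, ?_⟩
  · rw [PrimeSpectrum.isIrreducible_iff_vanishingIdeal_isPrime, vanishingIdeal_raise c hX]
    exact RingHom.ker_isPrime _
  · rintro Y ⟨h1, -, h3, h4⟩
    exact raise_subset c h1 h3 h4

theorem exists_minor_ne_zero (hX : ¬ X ⊆ lowRankLocus k r n) : ∃ b : Fin r → Fin n,
    (Matrix.of fun l j => coordMat (PrimeSpectrum.vanishingIdeal X) l (b j)).det ≠ 0 := by
  rw [lowRankLocus, PrimeSpectrum.subset_zeroLocus_iff_subset_vanishingIdeal] at hX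
  obtain ⟨_, ⟨b, rfl⟩, hb⟩ := Set.not_subset.1 hX
  refine ⟨b, fun h => hb ?_⟩
  rw [SetLike.mem_coe, ← Ideal.Quotient.eq_zero_iff_mem, RingHom.map_det]
  exact h

end Stable

/-! ### Torus stability and multihomogeneity of the ideal -/

section Torus

universe u

variable {k : Type u} [Field k] {r n : ℕ}

/-- The comorphism of the torus action `(s, x, t) ↦ s x t`, with `s` and `t` diagonal. -/
def torusHom (I : Ideal (CoordRing k r n)) :
    CoordRing k r n →ₐ[k] MvPolynomial (Fin r ⊕ Fin n) (CoordRing k r n ⧸ I) :=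
  aeval fun p => monomial (varDegree r n p) (coordMat I p.1 p.2)

theorem torusHom_monomial (I : Ideal (CoordRing k r n)) (e : Fin r × Fin n →₀ ℕ) (a : k) :
    torusHom I (monomial e a) = monomial (Finsupp.weight (varDegree r n) e)
      (Ideal.Quotient.mk I (monomial e a)) := by
  have h1 : ∀ e, torusHom I (monomial e 1) = monomial (Finsupp.weight (varDegree r n) e)
      (Ideal.Quotient.mk I (monomial e 1)) := by
    intro e
    induction e using Finsupp.induction_linear with
    | zero => simp
    | add e e' h h' =>
      rw [← one_mul (1 : k), ← monomial_mul, map_mul, h, h', monomial_mul, map_add,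
        map_mul (Ideal.Quotient.mk I)]
    | single p j =>
      rw [← X_pow_eq_monomial, map_pow, torusHom, aeval_X, monomial_pow,
        map_pow (Ideal.Quotient.mk I), Finsupp.weight_single]
      rfl
  have h2 : (monomial e a : CoordRing k r n) = a • monomial e 1 := by
    rw [smul_monomial, smul_eq_mul, mul_one]
  rw [h2, map_smul, h1]
  rw [← Ideal.Quotient.mkₐ_eq_mk k, map_smul]
  exact smul_monomial _

theorem coeff_torusHom (I : Ideal (CoordRing k r n)) (D : (Fin r ⊕ Fin n) →₀ ℕ)
    (f : CoordRing k r n) : coeff D (torusHom I f)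
      = Ideal.Quotient.mk I (weightedHomogeneousComponent (varDegree r n) D f) := by
  classical
  induction f using MvPolynomial.induction_on' with
  | monomial e a =>
    rw [torusHom_monomial, coeff_monomial]
    have hm := isWeightedHomogeneous_monomial (varDegree r n) e a rfl
    split_ifs with h
    · rw [(h ▸ hm : IsWeightedHomogeneous (varDegree r n) (monomial e a) D).weightedHomogeneousComponent_same]
    · rw [hm.weightedHomogeneousComponent_ne D (Ne.symm h), map_zero]
  | add p q hp hq => rw [map_add, coeff_add, hp, hq, map_add, map_add]

theorem eval_torusHom (I : Ideal (CoordRing k r n)) (s : Fin r → kˣ) (t : Fin n → kˣ)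
    (f : CoordRing k r n) :
    eval (fun v => algebraMap k (CoordRing k r n ⧸ I) (Sum.elim s t v).1) (torusHom I f)
      = Ideal.Quotient.mk I (actHom (Matrix.GeneralLinearGroup.mkOfDetNeZero
        (Matrix.diagonal fun i => (s i).1)
        (by rw [Matrix.det_diagonal]; exact Finset.prod_ne_zero_iff.2 fun i _ => (s i).ne_zero))
          t⁻¹ f) := by
  set g := Matrix.GeneralLinearGroup.mkOfDetNeZero (Matrix.diagonal fun i => (s i).1)
    (by rw [Matrix.det_diagonal]; exact Finset.prod_ne_zero_iff.2 fun i _ => (s i).ne_zero) with hg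
  have h : ((aeval (R := CoordRing k r n ⧸ I) fun v =>
      algebraMap k (CoordRing k r n ⧸ I) (Sum.elim s t v).1).restrictScalars k).comp (torusHom I)
      = (Ideal.Quotient.mkₐ k I).comp (actHom g t⁻¹) := by
    refine algHom_ext fun p => ?_
    rw [AlgHom.comp_apply, AlgHom.comp_apply, actHom_X, Finset.sum_eq_single p.1]
    · rw [torusHom, aeval_X, AlgHom.restrictScalars_apply, aeval_monomial, map_mul]
      have h1 : g.1 p.1 p.1 = (s p.1).1 := Matrix.diagonal_apply_eq _ _
      rw [h1, mul_comm]
      congr 1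
      rw [varDegree, Finsupp.prod_add_index (by simp) (by intros; rw [pow_add])]
      rw [Finsupp.prod_single_index (by simp), Finsupp.prod_single_index (by simp)]
      simp only [Sum.elim_inl, Sum.elim_inr, pow_one, Pi.inv_apply, inv_inv, ← map_mul]
      exact ((Ideal.Quotient.mkₐ k I).commutes _).symm
    · intro l _ hl
      have h1 : g.1 p.1 l = 0 := Matrix.diagonal_apply_ne _ hl.symm
      rw [h1, zero_mul, C_0, zero_mul]
    · simp
  exact DFunLike.congr_fun h f

/-- The multihomogeneous components of `f` modulo the ideal are the coefficients of `torusHom`. This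
polynomial vanishes at all points of the torus by stability, and `kˣ` is infinite, so it is zero. -/
theorem weightedHomogeneousComponent_mem [Infinite k] {X : Set (MatSpace k r n)}
    (hX : IsIrreducible X) (hs : IsStable X) {f : CoordRing k r n}
    (hf : f ∈ PrimeSpectrum.vanishingIdeal X) (D : (Fin r ⊕ Fin n) →₀ ℕ) :
    weightedHomogeneousComponent (varDegree r n) D f ∈ PrimeSpectrum.vanishingIdeal X := by
  have hI := PrimeSpectrum.isIrreducible_iff_vanishingIdeal_isPrime.1 hX
  rw [← Ideal.Quotient.eq_zero_iff_mem, ← coeff_torusHom]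
  suffices h : torusHom (PrimeSpectrum.vanishingIdeal X) f = 0 by rw [h, coeff_zero]
  have hinj : Function.Injective fun a : kˣ =>
      algebraMap k (CoordRing k r n ⧸ PrimeSpectrum.vanishingIdeal X) a.1 :=
    (algebraMap k _).injective.comp Units.val_injective
  have hinf : Infinite kˣ := (unitsEquivNeZero (G₀ := k)).infinite_iff.2
    (Set.infinite_coe_iff.2 (Set.finite_singleton (0 : k)).infinite_compl)
  refine funext_set (fun _ => Set.range fun a : kˣ =>
    algebraMap k (CoordRing k r n ⧸ PrimeSpectrum.vanishingIdeal X) a.1)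
      (fun _ => Set.infinite_range_of_injective hinj) fun y hy => ?_
  choose s hs' using fun i => hy i trivial
  have hy' : y = fun v => algebraMap k (CoordRing k r n ⧸ PrimeSpectrum.vanishingIdeal X)
      (Sum.elim (s ∘ Sum.inl) (s ∘ Sum.inr) v).1 := by
    funext v
    rw [← hs' v]
    cases v <;> rfl
  rw [hy', eval_torusHom, map_zero, Ideal.Quotient.eq_zero_iff_mem]
  exact actHom_mem_vanishingIdeal hs _ _ hf

end Torus

/-! ### Symmetry of the `K`-polynomial in the row variables -/

section Symmetry

variable {k : Type*} [Field k] {Q : Type*} [CommRing Q] [Algebra k Q] {m r n : ℕ}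
  (x : Fin r → Fin n → Q)

theorem mulHom_rename_perm (σ : Equiv.Perm (Fin m)) (f : CoordRing k m n) :
    mulHom k m x (rename (Prod.map σ id) f) = rename (Prod.map σ id) (mulHom k m x f) := by
  have h : (mulHom k m x).comp (rename (Prod.map σ id))
      = ((rename (Prod.map σ id) : MvPolynomial (Fin m × Fin r) Q →ₐ[Q] _).restrictScalars k).comp
        (mulHom k m x) := by
    refine algHom_ext fun p => ?_
    simp [mulHom_X]
  exact DFunLike.congr_fun h f

theorem mem_ker_mulHom_rename_perm (σ : Equiv.Perm (Fin m)) (f : CoordRing k m n) :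
    rename (Prod.map σ id) f ∈ RingHom.ker (mulHom k m x) ↔ f ∈ RingHom.ker (mulHom k m x) := by
  rw [RingHom.mem_ker, RingHom.mem_ker, mulHom_rename_perm,
    map_eq_zero_iff _ (rename_injective _ (σ.injective.prodMap Function.injective_id))]

theorem weight_mapDomain_perm (σ : Equiv.Perm (Fin m)) (e : Fin m × Fin n →₀ ℕ) :
    Finsupp.weight (varDegree m n) (e.mapDomain (Prod.map σ id))
      = (Finsupp.weight (varDegree m n) e).mapDomain (Sum.map σ id) := by
  induction e using Finsupp.induction_linear with
  | zero => simp
  | add e e' h h' => rw [Finsupp.mapDomain_add, map_add, map_add, h, h', Finsupp.mapDomain_add]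
  | single p j =>
    rw [Finsupp.mapDomain_single, Finsupp.weight_single, Finsupp.weight_single,
      Finsupp.mapDomain_smul]
    simp [varDegree, Finsupp.mapDomain_add, Finsupp.mapDomain_single]

theorem map_rename_weightedHomogeneousSubmodule (σ : Equiv.Perm (Fin m)) (D : (Fin m ⊕ Fin n) →₀ ℕ) :
    weightedHomogeneousSubmodule k (varDegree m n) (D.mapDomain (Sum.map σ id))
      = (weightedHomogeneousSubmodule k (varDegree m n) D).map
        (rename (Prod.map σ id) : CoordRing k m n →ₐ[k] CoordRing k m n).toLinearMap := by
  have hinj : Function.Injective (Prod.map σ (id : Fin n → Fin n)) :=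
    σ.injective.prodMap Function.injective_id
  have key : ∀ (σ : Equiv.Perm (Fin m)) (D : (Fin m ⊕ Fin n) →₀ ℕ) (f : CoordRing k m n),
      IsWeightedHomogeneous (varDegree m n) f D →
      IsWeightedHomogeneous (varDegree m n) (rename (Prod.map σ id) f) (D.mapDomain (Sum.map σ id)) := by
    intro σ D f hf e he
    obtain ⟨e', rfl, he'⟩ := coeff_rename_ne_zero _ _ _ he
    rw [weight_mapDomain_perm, hf he']
  refine le_antisymm ?_ ?_
  · intro f hf
    refine ⟨rename (Prod.map σ.symm id) f, ?_, ?_⟩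
    · have := key σ.symm _ _ hf
      rw [← Finsupp.mapDomain_comp, Sum.map_comp_map] at this
      simpa using this
    · simp [rename_rename, Prod.map_comp_map]
  · rintro _ ⟨f, hf, rfl⟩
    exact key σ D f hf

theorem hilb_apply_perm {I : Ideal (CoordRing k m n)} (σ : Equiv.Perm (Fin m))
    (hI : ∀ f, rename (Prod.map σ id) f ∈ I ↔ f ∈ I) (D : (Fin m ⊕ Fin n) →₀ ℕ) :
    MvPowerSeries.coeff (D.mapDomain (Sum.map σ id)) (hilb I) = MvPowerSeries.coeff D (hilb I) := by
  change ((Module.finrank k _ : ℕ) : ℤ) = ((Module.finrank k _ : ℕ) : ℤ)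
  rw [map_rename_weightedHomogeneousSubmodule, ← Submodule.map_comp]
  congr 1
  refine finrank_map_eq_of_ker _ _ _ fun f _ => ?_
  simp only [LinearMap.comp_apply, AlgHom.toLinearMap_apply, Ideal.Quotient.mkₐ_eq_mk,
    Ideal.Quotient.eq_zero_iff_mem]
  exact hI f

theorem rename_kPolynomial {I : Ideal (CoordRing k m n)} (σ : Equiv.Perm (Fin m))
    (hI : ∀ f, rename (Prod.map σ id) f ∈ I ↔ f ∈ I) {K : MvPolynomial (Fin m ⊕ Fin n) ℤ}
    (hK : IsKPolynomial I K) : rename (Sum.map σ id) K = K := by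
  let e : (Fin m ⊕ Fin n) ↪ (Fin m ⊕ Fin n) :=
    ⟨Sum.map σ id, σ.injective.sumMap Function.injective_id⟩
  have hh : MvPowerSeries.rename e (hilb I) = hilb I := by
    ext D
    obtain ⟨D', rfl⟩ : ∃ D', D'.mapDomain (Sum.map σ id) = D :=
      ⟨D.mapDomain (Sum.map σ.symm id), by
        rw [← Finsupp.mapDomain_comp, Sum.map_comp_map]; simp⟩
    rw [hilb_apply_perm σ hI, ← MvPowerSeries.coeff_embDomain_rename e (hilb I),
      Finsupp.embDomain_eq_mapDomain]
    rfl
  apply MvPolynomial.coe_injective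
  have := congrArg (MvPowerSeries.rename e) hK
  rw [map_mul, hh, map_prod] at this
  simp only [map_sub, map_mul, map_one, MvPowerSeries.rename_X] at this
  rw [hK]
  refine Eq.trans ?_ (this.trans ?_)
  · exact (MvPowerSeries.rename_coe e K).symm
  · congr 1
    exact (Equiv.prodCongr σ (Equiv.refl (Fin n))).prod_comp
      (fun p => (1 - MvPowerSeries.X (Sum.inl p.1) * MvPowerSeries.X (Sum.inr p.2) :
        MvPowerSeries (Fin m ⊕ Fin n) ℤ))

theorem sumAlgEquiv_rename (σ : Equiv.Perm (Fin m)) (p : MvPolynomial (Fin m ⊕ Fin n) ℤ) :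
    sumAlgEquiv ℤ (Fin m) (Fin n) (rename (Sum.map σ id) p)
      = rename σ (sumAlgEquiv ℤ (Fin m) (Fin n) p) := by
  have h : (sumAlgEquiv ℤ (Fin m) (Fin n)).toAlgHom.comp (rename (Sum.map σ id))
      = ((rename σ : MvPolynomial (Fin m) (MvPolynomial (Fin n) ℤ) →ₐ[MvPolynomial (Fin n) ℤ] _).restrictScalars ℤ).comp
        (sumAlgEquiv ℤ (Fin m) (Fin n)).toAlgHom := by
    refine algHom_ext fun s => ?_
    rcases s with s | s <;> simp
  exact DFunLike.congr_fun h p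

theorem oneSub_rename (σ : Equiv.Perm (Fin m)) (p : MvPolynomial (Fin m ⊕ Fin n) ℤ) :
    oneSub m n (rename (Sum.map σ id) p) = rename (Sum.map σ id) (oneSub m n p) := by
  have h : (oneSub m n).comp (rename (Sum.map σ id)) = (rename (Sum.map σ id)).comp (oneSub m n) :=
    algHom_ext fun s => by simp [oneSub]
  exact DFunLike.congr_fun h p

/-- The part of degree `d` of `K(1 - u, 1 - t)`, for `K` symmetric in `u`. -/
def lowComponent (K : MvPolynomial (Fin m ⊕ Fin n) ℤ)
    (hK : ∀ σ : Equiv.Perm (Fin m), rename (Sum.map σ id) K = K) (d : ℕ) :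
    symmetricSubalgebra (Fin m) (MvPolynomial (Fin n) ℤ) :=
  ⟨sumAlgEquiv ℤ (Fin m) (Fin n) (homogeneousComponent d (oneSub m n K)), fun σ => by
    rw [← sumAlgEquiv_rename, rename_homogeneousComponent, ← oneSub_rename, hK]⟩

end Symmetry

/-! ### Anticommuting row insertion operators -/

section RowOperators

variable {n m : ℕ}

/-- Evaluation of a polynomial in one variable over `ℤ[t]` at `u_i`. -/
def evRow {m n : ℕ} (i : Fin m) :
    Polynomial (MvPolynomial (Fin n) ℤ) →+* MvPolynomial (Fin m ⊕ Fin n) ℤ :=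
  Polynomial.eval₂RingHom (rename Sum.inr : MvPolynomial (Fin n) ℤ →ₐ[ℤ] _).toRingHom
    (X (Sum.inl i))

@[simp] theorem evRow_X (i : Fin m) :
    evRow i (Polynomial.X : Polynomial (MvPolynomial (Fin n) ℤ)) = X (Sum.inl i) := by
  simp [evRow]

@[simp] theorem evRow_C (i : Fin m) (a : MvPolynomial (Fin n) ℤ) :
    evRow i (Polynomial.C a) = rename Sum.inr a := by
  simp [evRow]

theorem rename_skip_evRow (i : Fin (m + 1)) (j : Fin m) (G : Polynomial (MvPolynomial (Fin n) ℤ)) :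
    rename (skip n i) (evRow j G) = evRow (i.succAbove j) G := by
  have h : (rename (skip n i) : _ →ₐ[ℤ] MvPolynomial (Fin (m + 1) ⊕ Fin n) ℤ).toRingHom.comp (evRow j)
      = evRow (i.succAbove j) := by
    refine Polynomial.ringHom_ext (fun a => ?_) ?_
    · simp only [RingHom.comp_apply, evRow_C, AlgHom.toRingHom_eq_coe, RingHom.coe_coe,
        rename_rename]
      rfl
    · simp
  exact RingHom.congr_fun h G

/-- The operator `p ↦ ∑ (-1)^i G(u_i) p(u_0, …, u_(i-1), u_(i+1), …, u_m)`. -/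
def rowOp (G : Polynomial (MvPolynomial (Fin n) ℤ)) :
    MvPolynomial (Fin m ⊕ Fin n) ℤ →+ MvPolynomial (Fin (m + 1) ⊕ Fin n) ℤ where
  toFun := insertOp fun i => evRow i G
  map_zero' := by simp [insertOp]
  map_add' p q := by simp only [insertOp, map_add, mul_add, Finset.sum_add_distrib]

theorem rowOp_apply (G : Polynomial (MvPolynomial (Fin n) ℤ)) (p : MvPolynomial (Fin m ⊕ Fin n) ℤ) :
    rowOp G p = ∑ i : Fin (m + 1), (-1) ^ (i : ℕ) * evRow i G * rename (skip n i) p := rfl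

theorem rowOp_sum {ι : Type*} (s : Finset ι) (G : ι → Polynomial (MvPolynomial (Fin n) ℤ))
    (p : MvPolynomial (Fin m ⊕ Fin n) ℤ) : rowOp (∑ i ∈ s, G i) p = ∑ i ∈ s, rowOp (G i) p := by
  simp only [rowOp_apply, map_sum, Finset.mul_sum, Finset.sum_mul]
  exact Finset.sum_comm

theorem rowOp_C_mul (a : MvPolynomial (Fin n) ℤ) (G : Polynomial (MvPolynomial (Fin n) ℤ))
    (p : MvPolynomial (Fin m ⊕ Fin n) ℤ) :
    rowOp (Polynomial.C a * G) p = rename Sum.inr a * rowOp G p := by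
  simp only [rowOp_apply, map_mul, evRow_C, Finset.mul_sum]
  exact Finset.sum_congr rfl fun i _ => by ring

theorem rowOp_rename_mul (a : MvPolynomial (Fin n) ℤ) (G : Polynomial (MvPolynomial (Fin n) ℤ))
    (p : MvPolynomial (Fin m ⊕ Fin n) ℤ) :
    rowOp G (rename Sum.inr a * p) = rename Sum.inr a * rowOp G p := by
  simp only [rowOp_apply, map_mul, rename_rename, Finset.mul_sum]
  refine Finset.sum_congr rfl fun i _ => ?_
  have : skip n i ∘ Sum.inr = (Sum.inr : Fin n → Fin (m + 1) ⊕ Fin n) := rfl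
  rw [this]
  ring

/-- Both composites sum over the ordered pairs of inserted variables. Exchanging the two variables
leaves the remaining ones in place and reverses the sign. -/
theorem rowOp_rowOp (G H : Polynomial (MvPolynomial (Fin n) ℤ))
    (p : MvPolynomial (Fin m ⊕ Fin n) ℤ) : rowOp G (rowOp H p) = -rowOp H (rowOp G p) := by
  have key : ∀ G H : Polynomial (MvPolynomial (Fin n) ℤ), rowOp G (rowOp H p)
      = ∑ q : Fin (m + 2) × Fin (m + 1), (-1) ^ (q.1 + q.2 : ℕ) *
        (evRow q.1 G * evRow (q.1.succAbove q.2) H) * rename (skip n q.1 ∘ skip n q.2) p := by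
    intro G H
    rw [rowOp_apply, Fintype.sum_prod_type]
    refine Finset.sum_congr rfl fun i _ => ?_
    rw [rowOp_apply, map_sum, Finset.mul_sum]
    refine Finset.sum_congr rfl fun j _ => ?_
    simp only [map_mul, map_pow, map_neg, map_one, rename_skip_evRow, rename_rename]
    ring
  -- A pair `(i, j)` encodes the inserted variables `i` and `i.succAbove j`; `e` exchanges the two.
  let e : Fin (m + 2) × Fin (m + 1) → Fin (m + 2) × Fin (m + 1) :=
    fun q => (q.1.succAbove q.2, q.2.predAbove q.1)
  have he : Function.Involutive e := fun q => by
    simp [e, Fin.succAbove_succAbove_predAbove, Fin.predAbove_predAbove_succAbove]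
  rw [key G H, key H G, ← Finset.sum_neg_distrib, ← Equiv.sum_comp he.toPerm]
  refine Finset.sum_congr rfl fun q _ => ?_
  change (-1) ^ ((q.1.succAbove q.2 : ℕ) + (q.2.predAbove q.1 : ℕ)) *
    (evRow (q.1.succAbove q.2) G * evRow ((q.1.succAbove q.2).succAbove (q.2.predAbove q.1)) H) *
      rename (skip n (q.1.succAbove q.2) ∘ skip n (q.2.predAbove q.1)) p = _
  have hs : skip n (q.1.succAbove q.2) ∘ skip n (q.2.predAbove q.1) = skip n q.1 ∘ skip n q.2 := by
    funext s
    rcases s with s | s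
    · simp [Fin.succAbove_succAbove_succAbove_predAbove]
    · simp
  rw [hs, Fin.neg_one_pow_succAbove_add_predAbove, Fin.succAbove_succAbove_predAbove]
  ring

theorem rowOp_self (G : Polynomial (MvPolynomial (Fin n) ℤ))
    (p : MvPolynomial (Fin m ⊕ Fin n) ℤ) : rowOp G (rowOp G p) = 0 :=
  self_eq_neg.1 (rowOp_rowOp G G p)

/-- The product `∏ w(u_i)`. -/
def prodRow (m : ℕ) {n : ℕ} (w : Polynomial (MvPolynomial (Fin n) ℤ)) :
    MvPolynomial (Fin m ⊕ Fin n) ℤ := ∏ i, evRow i w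

/-- The product over all variables splits into the factor at the inserted variable, which joins the
weight, and the product over the rest. -/
theorem prodRow_mul_rowOp (w G : Polynomial (MvPolynomial (Fin n) ℤ))
    (p : MvPolynomial (Fin m ⊕ Fin n) ℤ) :
    prodRow (m + 1) w * rowOp G p = rowOp (w * G) (prodRow m w * p) := by
  rw [rowOp_apply, rowOp_apply, Finset.mul_sum]
  refine Finset.sum_congr rfl fun i _ => ?_
  rw [prodRow, Fin.prod_univ_succAbove _ i, map_mul, map_mul, prodRow, map_prod]
  simp only [rename_skip_evRow]
  ring

/-- The composite of the operators `rowOp (G 0)`, …, `rowOp (G (c - 1))`, the first one first. -/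
def rowComp (G : ℕ → Polynomial (MvPolynomial (Fin n) ℤ)) :
    (c : ℕ) → MvPolynomial (Fin m ⊕ Fin n) ℤ → MvPolynomial (Fin (m + c) ⊕ Fin n) ℤ
  | 0, p => p
  | c + 1, p => rowOp (G c) (rowComp G c p)

/-- The `c`-fold iterate of the operators `p ↦ rowOp G (∏ w(u_i) * p)`. -/
def rowIter (G w : Polynomial (MvPolynomial (Fin n) ℤ)) :
    (c : ℕ) → MvPolynomial (Fin m ⊕ Fin n) ℤ → MvPolynomial (Fin (m + c) ⊕ Fin n) ℤ
  | 0, p => p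
  | c + 1, p => rowOp G (prodRow (m + c) w * rowIter G w c p)

theorem prodRow_pow_mul_rowComp (w : Polynomial (MvPolynomial (Fin n) ℤ)) (j : ℕ)
    (G : ℕ → Polynomial (MvPolynomial (Fin n) ℤ)) (c : ℕ) (p : MvPolynomial (Fin m ⊕ Fin n) ℤ) :
    prodRow (m + c) w ^ j * rowComp G c p = rowComp (fun i => w ^ j * G i) c (prodRow m w ^ j * p) := by
  have hp : ∀ m, (prodRow m w : MvPolynomial (Fin m ⊕ Fin n) ℤ) ^ j = prodRow m (w ^ j) := by
    intro m; simp [prodRow, Finset.prod_pow]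
  induction c with
  | zero => rfl
  | succ c ih =>
    rw [rowComp, rowComp, ← ih, hp, hp]
    exact prodRow_mul_rowOp _ _ _

theorem rowOp_rowComp_of_eq (G : ℕ → Polynomial (MvPolynomial (Fin n) ℤ)) (c i : ℕ) (hi : i < c)
    (p : MvPolynomial (Fin m ⊕ Fin n) ℤ) : rowOp (G i) (rowComp G c p) = 0 := by
  induction c with
  | zero => omega
  | succ c ih =>
    rw [rowComp]
    rcases Nat.lt_succ_iff_lt_or_eq.1 hi with h | rfl
    · rw [rowOp_rowOp, ih h, map_zero, neg_zero]
    · exact rowOp_self _ _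

theorem rowOp_rowComp_succ (G : ℕ → Polynomial (MvPolynomial (Fin n) ℤ)) (c : ℕ)
    (p : MvPolynomial (Fin m ⊕ Fin n) ℤ) :
    rowOp (G 0) (rowComp (fun i => G (i + 1)) c p) = (-1) ^ c * rowComp G (c + 1) p := by
  induction c with
  | zero => simp [rowComp]
  | succ c ih =>
    rw [show rowComp G (c + 1 + 1) p = rowOp (G (c + 1)) (rowComp G (c + 1) p) from rfl, rowComp,
      rowOp_rowOp, ih]
    have : ((-1) ^ c * rowComp G (c + 1) p : MvPolynomial (Fin (m + c + 1) ⊕ Fin n) ℤ)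
        = rename Sum.inr ((-1) ^ c) * rowComp G (c + 1) p := by simp
    rw [this, rowOp_rename_mul, map_pow, map_neg, map_one]
    ring

/-- Pushing every product inwards past the earlier insertions multiplies their weights by `w`, so
the first insertion ends with `w ^ (c - 1)` and the last with `w ^ 0`. Reversing the order of the
`c` anticommuting operators costs `(-1) ^ (c (c - 1) / 2)`. -/
theorem rowIter_eq (Q w : Polynomial (MvPolynomial (Fin n) ℤ)) (c : ℕ)
    (p : MvPolynomial (Fin m ⊕ Fin n) ℤ) :
    rowIter Q w c p = (-1) ^ (∑ i ∈ Finset.range c, i) *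
      rowComp (fun i => w ^ i * Q) c (prodRow m w ^ c * p) := by
  induction c with
  | zero => simp [rowIter, rowComp]
  | succ c ih =>
    have h1 := rowOp_rowComp_succ (fun i => w ^ i * Q) c (prodRow m w ^ (c + 1) * p)
    have h2 := prodRow_pow_mul_rowComp w 1 (fun i => w ^ i * Q) c (prodRow m w ^ c * p)
    have h3 : (fun i => w ^ 1 * (w ^ i * Q)) = fun i => w ^ (i + 1) * Q := by funext i; ring
    rw [h3, pow_one, pow_one, ← mul_assoc, ← pow_succ'] at h2
    rw [rowIter, ih, mul_left_comm, h2]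
    set R := rowComp (fun i => w ^ (i + 1) * Q) c (prodRow m w ^ (c + 1) * p)
    have h4 : ((-1) ^ (∑ i ∈ Finset.range c, i) * R : MvPolynomial (Fin (m + c) ⊕ Fin n) ℤ)
        = rename Sum.inr ((-1) ^ (∑ i ∈ Finset.range c, i)) * R := by simp
    rw [h4, rowOp_rename_mul, Finset.sum_range_succ, pow_add, mul_assoc, ← h1]
    simp

/-- In the expansion of `(1 - X) ^ c` every power below `c` gives an operator that was already
applied, and a repeated operator is zero. Only `(-1) ^ c X ^ c` survives, as in column operations on
a Vandermonde matrix. -/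
theorem rowComp_one_sub (Q : Polynomial (MvPolynomial (Fin n) ℤ)) (c : ℕ)
    (p : MvPolynomial (Fin m ⊕ Fin n) ℤ) :
    rowComp (fun i => (1 - Polynomial.X) ^ i * Q) c p = (-1) ^ (∑ i ∈ Finset.range c, i) *
      rowComp (fun i => Polynomial.X ^ i * Q) c p := by
  induction c with
  | zero => simp [rowComp]
  | succ c ih =>
    rw [rowComp, ih]
    set R := rowComp (fun i => Polynomial.X ^ i * Q) c p with hR
    have h4 : ((-1) ^ (∑ i ∈ Finset.range c, i) * R : MvPolynomial (Fin (m + c) ⊕ Fin n) ℤ)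
        = rename Sum.inr ((-1) ^ (∑ i ∈ Finset.range c, i)) * R := by simp
    have h5 : (1 - Polynomial.X) ^ c * Q = ∑ i ∈ Finset.range (c + 1),
        Polynomial.C ((-1) ^ i * (c.choose i : MvPolynomial (Fin n) ℤ)) * (Polynomial.X ^ i * Q) := by
      rw [sub_eq_neg_add, add_pow, Finset.sum_mul]
      refine Finset.sum_congr rfl fun i _ => ?_
      rw [neg_pow]
      simp
      ring
    have h6 : ∑ i ∈ Finset.range c, rowOp (Polynomial.C ((-1) ^ i *
        (c.choose i : MvPolynomial (Fin n) ℤ)) * (Polynomial.X ^ i * Q)) R = 0 := by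
      refine Finset.sum_eq_zero fun i hi => ?_
      rw [rowOp_C_mul, hR, rowOp_rowComp_of_eq (fun i => Polynomial.X ^ i * Q) c i
        (Finset.mem_range.1 hi), mul_zero]
    rw [h4, rowOp_rename_mul, h5, rowOp_sum, Finset.sum_range_succ, h6, zero_add, rowOp_C_mul,
      Finset.sum_range_succ, pow_add]
    simp [rowComp, mul_assoc, hR]

end RowOperators

/-! ### The raising operators as row insertions -/

section RhoOperators

variable {n m : ℕ}

theorem sumAlgEquiv_symm_alternant (α : Fin m → ℕ) :
    (sumAlgEquiv ℤ (Fin m) (Fin n)).symm (alternant α)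
      = Matrix.det (Matrix.of fun i j => (X (Sum.inl i) : MvPolynomial (Fin m ⊕ Fin n) ℤ) ^ α j) := by
  rw [AlgEquiv.symm_apply_eq, ← AlgEquiv.coe_toAlgHom, AlgHom.map_det, alternant]
  congr 1
  ext1 i j
  simp

theorem sumAlgEquiv_symm_C (a : MvPolynomial (Fin n) ℤ) :
    (sumAlgEquiv ℤ (Fin m) (Fin n)).symm (C a) = rename Sum.inr a := by
  rw [AlgEquiv.symm_apply_eq]
  exact (DFunLike.congr_fun (sumAlgEquiv_comp_rename_inr ℤ (Fin m) (Fin n)) a).symm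

theorem sumAlgEquiv_symm_vdm :
    (sumAlgEquiv ℤ (Fin m) (Fin n)).symm (alternant (delta m)) = vdm m n :=
  sumAlgEquiv_symm_alternant _

theorem vdm_ne_zero : vdm m n ≠ 0 := by
  rw [← sumAlgEquiv_symm_vdm]
  exact (map_ne_zero_iff _ (AlgEquiv.injective _)).2 alternant_delta_ne_zero

/-- A symmetric polynomial in `u` with coefficients in `ℤ[t]`, as a polynomial in `u` and `t`. -/
def flat (f : symmetricSubalgebra (Fin m) (MvPolynomial (Fin n) ℤ)) :
    MvPolynomial (Fin m ⊕ Fin n) ℤ := (sumAlgEquiv ℤ (Fin m) (Fin n)).symm f.1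

theorem flat_add (f g : symmetricSubalgebra (Fin m) (MvPolynomial (Fin n) ℤ)) :
    flat (f + g) = flat f + flat g := map_add _ _ _

theorem flat_mul (f g : symmetricSubalgebra (Fin m) (MvPolynomial (Fin n) ℤ)) :
    flat (f * g) = flat f * flat g := map_mul _ _ _

theorem flat_sum {ι : Type*} (s : Finset ι)
    (f : ι → symmetricSubalgebra (Fin m) (MvPolynomial (Fin n) ℤ)) :
    flat (∑ i ∈ s, f i) = ∑ i ∈ s, flat (f i) := by
  rw [flat, AddSubmonoidClass.coe_finsetSum, map_sum]
  rfl

theorem flat_smul (a : MvPolynomial (Fin n) ℤ)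
    (f : symmetricSubalgebra (Fin m) (MvPolynomial (Fin n) ℤ)) :
    flat (a • f) = rename Sum.inr a * flat f := by
  rw [flat, SetLike.val_smul, smul_eq_C_mul, map_mul, sumAlgEquiv_symm_C, flat]

theorem flat_neg_one_pow_mul (j : ℕ) (f : symmetricSubalgebra (Fin m) (MvPolynomial (Fin n) ℤ)) :
    flat ((-1) ^ j * f) = (-1) ^ j * flat f := by
  rw [flat_mul, flat]
  congr 1
  simp

theorem flat_eTop : flat (eTop (MvPolynomial (Fin n) ℤ) m) = prodRow m Polynomial.X := by
  rw [flat, coe_eTop, map_prod, prodRow]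
  refine Finset.prod_congr rfl fun i _ => ?_
  rw [evRow_X, sumAlgEquiv_symm_X]

theorem flat_pow (j : ℕ) (f : symmetricSubalgebra (Fin m) (MvPolynomial (Fin n) ℤ)) :
    flat (f ^ j) = flat f ^ j := by
  rw [flat, SubmonoidClass.coe_pow, map_pow, flat]

/-- On the Schur basis this is Laplace expansion of the alternant along its last column, the one
with exponent `k`. The other columns have their exponents raised by one, whence the product of the
variables. -/
theorem vdm_mul_flat_rhoOp (k : ℕ) (f : symmetricSubalgebra (Fin m) (MvPolynomial (Fin n) ℤ)) :
    vdm (m + 1) n * flat (rhoOp (MvPolynomial (Fin n) ℤ) m k f)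
      = (-1) ^ m * rowOp (Polynomial.X ^ k) (prodRow m Polynomial.X * (vdm m n * flat f)) := by
  have hf := (schurBasis (MvPolynomial (Fin n) ℤ) m).mem_span f
  induction hf using Submodule.span_induction with
  | zero =>
    have h : ∀ m, flat (0 : symmetricSubalgebra (Fin m) (MvPolynomial (Fin n) ℤ)) = 0 :=
      fun m => map_zero _
    simp [h]
  | add x y _ _ hx hy =>
    rw [map_add, flat_add, mul_add, hx, hy, flat_add, mul_add, mul_add, map_add, mul_add]
  | smul a x _ hx =>
    rw [map_smul, flat_smul, mul_left_comm, hx, flat_smul, mul_left_comm (vdm m n),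
      mul_left_comm (prodRow m _) (rename Sum.inr a), rowOp_rename_mul]
    ring
  | mem x hx =>
    obtain ⟨μ, rfl⟩ := hx
    have h1 : ∀ {m : ℕ} (ν : Fin m → ℕ), vdm m n * flat (schurPoly (MvPolynomial (Fin n) ℤ) ν)
        = Matrix.det (Matrix.of fun i j =>
          (X (Sum.inl i) : MvPolynomial (Fin m ⊕ Fin n) ℤ) ^ (ν + delta m) j) := by
      intro m ν
      rw [← sumAlgEquiv_symm_vdm, flat, ← map_mul, mul_comm, schurPoly_mul,
        sumAlgEquiv_symm_alternant]
    have h2 : ∀ i : Fin (m + 1), rename (skip n i) (prodRow m Polynomial.X *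
        (vdm m n * flat (schurPoly (MvPolynomial (Fin n) ℤ) μ.1)))
        = Matrix.det (Matrix.of fun a b : Fin m =>
          (X (Sum.inl (i.succAbove a)) : MvPolynomial (Fin (m + 1) ⊕ Fin n) ℤ)
            ^ (μ.1 b + delta m b + 1)) := by
      intro i
      rw [h1, prodRow, ← Matrix.det_mul_column, AlgHom.map_det]
      congr 1
      ext1 a b
      simp [pow_succ']
    rw [schurBasis_apply, rhoOp_schur, h1, Matrix.det_succ_column _ (Fin.last m), rowOp_apply,
      Finset.mul_sum]
    refine Finset.sum_congr rfl fun i _ => ?_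
    rw [h2]
    have h3 : ((Matrix.of fun (i : Fin (m + 1)) j => (X (Sum.inl i) : MvPolynomial (Fin (m + 1) ⊕ Fin n) ℤ)
        ^ ((Fin.snoc μ.1 k : Fin (m + 1) → ℕ) + delta (m + 1)) j).submatrix i.succAbove
          (Fin.last m).succAbove) = Matrix.of fun a b : Fin m =>
          (X (Sum.inl (i.succAbove a)) : MvPolynomial (Fin (m + 1) ⊕ Fin n) ℤ)
            ^ (μ.1 b + delta m b + 1) := by
      ext1 a b
      simp only [Matrix.submatrix_apply, Matrix.of_apply, Fin.succAbove_last, Pi.add_apply,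
        Fin.snoc_castSucc, delta_castSucc, add_assoc]
    rw [h3]
    simp only [Matrix.of_apply, Pi.add_apply, Fin.snoc_last, delta_last, add_zero, Fin.val_last,
      map_pow, evRow_X]
    ring

theorem vdm_mul_flat_rhoComp (N : ℕ) (c : ℕ)
    (f : symmetricSubalgebra (Fin m) (MvPolynomial (Fin n) ℤ)) :
    vdm (m + c) n * flat (∑ κ : Fin c → Fin (n + 1), (∏ i, esymm (Fin n) ℤ (κ i)) •
      rhoComp (MvPolynomial (Fin n) ℤ) m c (fun i => N - κ i) f)
      = (-1) ^ (c * m + ∑ i ∈ Finset.range c, i) *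
        rowIter (∑ κ : Fin (n + 1), Polynomial.C (esymm (Fin n) ℤ κ) * Polynomial.X ^ (N - κ))
          Polynomial.X c (vdm m n * flat f) := by
  induction c with
  | zero => simp [rowIter, rhoComp]
  | succ c ih =>
    set G := ∑ κ : Fin (n + 1), Polynomial.C (esymm (Fin n) ℤ κ) * Polynomial.X ^ (N - (κ : ℕ))
      with hG
    set F := ∑ κ : Fin c → Fin (n + 1), (∏ i, esymm (Fin n) ℤ (κ i)) •
      rhoComp (MvPolynomial (Fin n) ℤ) m c (fun i => N - κ i) f with hF
    -- Splitting off the last index, which belongs to the operator applied last, factors the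
    -- multiple sum into a composite of single sums.
    have h1 : (∑ κ : Fin (c + 1) → Fin (n + 1), (∏ i, esymm (Fin n) ℤ (κ i)) •
        rhoComp (MvPolynomial (Fin n) ℤ) m (c + 1) (fun i => N - κ i) f)
        = ∑ κ : Fin (n + 1), esymm (Fin n) ℤ κ •
          rhoOp (MvPolynomial (Fin n) ℤ) (m + c) (N - κ) F := by
      rw [← (Fin.snocEquiv fun _ => Fin (n + 1)).sum_comp, Fintype.sum_prod_type]
      refine Finset.sum_congr rfl fun κ _ => ?_
      rw [hF, map_sum, Finset.smul_sum]
      refine Finset.sum_congr rfl fun κ' _ => ?_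
      rw [map_smul, smul_smul, Fin.prod_univ_castSucc, mul_comm]
      simp [Fin.snocEquiv, rhoComp]
    rw [h1, flat_sum, Finset.mul_sum]
    have h2 : ∀ κ : Fin (n + 1), vdm (m + (c + 1)) n * flat (esymm (Fin n) ℤ κ •
        rhoOp (MvPolynomial (Fin n) ℤ) (m + c) (N - κ) F)
        = (-1) ^ (m + c) * rowOp (Polynomial.C (esymm (Fin n) ℤ κ) * Polynomial.X ^ (N - (κ : ℕ)))
          (prodRow (m + c) Polynomial.X * (vdm (m + c) n * flat F)) := by
      intro κ
      rw [flat_smul, mul_left_comm]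
      refine (congrArg (rename Sum.inr (esymm (Fin n) ℤ κ) * ·)
        (vdm_mul_flat_rhoOp (m := m + c) (N - κ) F)).trans ?_
      rw [rowOp_C_mul]
      ring
    rw [Finset.sum_congr rfl fun κ _ => h2 κ, ← Finset.mul_sum, ← rowOp_sum, ← hG, ih, rowIter,
      mul_left_comm (prodRow (m + c) _)]
    set R := prodRow (m + c) Polynomial.X * rowIter G Polynomial.X c (vdm m n * flat f)
    have h4 : ∀ j, ((-1) ^ j * R : MvPolynomial (Fin (m + c) ⊕ Fin n) ℤ)
        = rename Sum.inr ((-1) ^ j) * R := by simp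
    rw [h4, rowOp_rename_mul, map_pow, map_neg, map_one, ← mul_assoc, ← pow_add,
      Finset.sum_range_succ]
    congr 2
    ring

/-- By the generating function of the `e_k(t)` the weight is `u^c ∏_b (u + t_b)`. The `u^c` in the
weights and the inner product of variables left by `rowIter_eq` together form `e_(m+c)(u)^c`, which
cancels the denominator; all signs cancel too. -/
theorem vdm_mul_flat_rhoH (c : ℕ) (f : symmetricSubalgebra (Fin m) (MvPolynomial (Fin n) ℤ)) :
    vdm (m + c) n * flat (rhoH n c f)
      = rowComp (fun i => Polynomial.X ^ i * ∏ b, (Polynomial.X + Polynomial.C (X b))) c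
        (vdm m n * flat f) := by
  have hE : (prodRow (m + c) Polynomial.X : MvPolynomial (Fin (m + c) ⊕ Fin n) ℤ) ^ c ≠ 0 := by
    refine pow_ne_zero _ (Finset.prod_ne_zero_iff.2 fun i _ => ?_)
    rw [evRow_X]
    exact X_ne_zero _
  apply mul_left_cancel₀ hE
  have h1 := congrArg flat (eTop_pow_mul_rhoH n c f)
  rw [flat_mul, flat_pow, flat_eTop, flat_neg_one_pow_mul, rhoHSum] at h1
  have hG : (∑ κ : Fin (n + 1), Polynomial.C (esymm (Fin n) ℤ κ) * Polynomial.X ^ (n + c - (κ : ℕ)))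
      = Polynomial.X ^ c * ∏ b, (Polynomial.X + Polynomial.C (X b)) := by
    rw [MvPolynomial.prod_C_add_X_eq_sum_esymm, Finset.mul_sum, Fintype.card_fin,
      Fin.sum_univ_eq_sum_range (fun j => Polynomial.C (esymm (Fin n) ℤ j) *
        Polynomial.X ^ (n + c - j))]
    refine Finset.sum_congr rfl fun j hj => ?_
    have : n + c - j = c + (n - j) := by have := Finset.mem_range.1 hj; omega
    rw [this, pow_add]
    ring
  rw [mul_left_comm, h1, mul_left_comm, vdm_mul_flat_rhoComp, hG, rowIter_eq,
    prodRow_pow_mul_rowComp]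
  have h2 : (fun i => Polynomial.X ^ i * (Polynomial.X ^ c *
      ∏ b : Fin n, (Polynomial.X + Polynomial.C (X b : MvPolynomial (Fin n) ℤ))))
      = fun i => Polynomial.X ^ c * (Polynomial.X ^ i *
      ∏ b : Fin n, (Polynomial.X + Polynomial.C (X b))) := by
    funext i; ring
  rw [h2, ← mul_assoc, ← mul_assoc, ← pow_add, ← pow_add]
  have h3 : ((-1) ^ (c * m + (c * m + ∑ i ∈ Finset.range c, i) + ∑ i ∈ Finset.range c, i) :
      MvPolynomial (Fin (m + c) ⊕ Fin n) ℤ) = 1 := by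
    refine Even.neg_one_pow ⟨c * m + ∑ i ∈ Finset.range c, i, by ring⟩
  rw [h3, one_mul]

end RhoOperators

/-! ### Lowest components of the recursion at `u = t = 1` -/

section LowestComponent

variable {σ τ A : Type*} [CommRing A]

theorem OrdGe.rename (f : σ → τ) {d : ℕ} {p : MvPolynomial σ A}
    (hp : OrdGe d p) : OrdGe d (rename f p) := by
  rw [ordGe_iff_homogeneousComponent] at hp ⊢
  intro j hj
  rw [← rename_homogeneousComponent, hp j hj, map_zero]

theorem homogeneousComponent_isHomogeneous_mul {d e : ℕ} {p : MvPolynomial σ A}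
    (hp : p.IsHomogeneous d) (q : MvPolynomial σ A) :
    homogeneousComponent (d + e) (p * q) = p * homogeneousComponent e q := by
  classical
  induction q using MvPolynomial.induction_on' with
  | monomial s a =>
    have h1 : (monomial s a : MvPolynomial σ A).IsHomogeneous s.degree :=
      isHomogeneous_monomial a rfl
    rw [homogeneousComponent_of_mem (hp.mul h1), homogeneousComponent_of_mem h1]
    by_cases h : e = s.degree
    · simp [h]
    · simp [h]
  | add q q' h h' => rw [mul_add, map_add, h, h', map_add, mul_add]

theorem homogeneousComponent_prod {ι : Type*} (s : Finset ι) {d : ι → ℕ}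
    {p q : ι → MvPolynomial σ A} (hp : ∀ i ∈ s, OrdGe (d i) (p i))
    (hq : ∀ i ∈ s, homogeneousComponent (d i) (p i) = q i) :
    homogeneousComponent (∑ i ∈ s, d i) (∏ i ∈ s, p i) = ∏ i ∈ s, q i := by
  classical
  induction s using Finset.induction_on with
  | empty => simp [homogeneousComponent_zero]
  | insert a s ha ih =>
    rw [Finset.sum_insert ha, Finset.prod_insert ha, Finset.prod_insert ha,
      homogeneousComponent_mul (hp a (Finset.mem_insert_self _ _))
        (OrdGe.prod s fun i hi => hp i (Finset.mem_insert_of_mem hi)),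
      hq a (Finset.mem_insert_self _ _), ih (fun i hi => hp i (Finset.mem_insert_of_mem hi))
        (fun i hi => hq i (Finset.mem_insert_of_mem hi))]

variable {m n : ℕ}

theorem rowOp_lowest {G H : Polynomial (MvPolynomial (Fin n) ℤ)} {d e : ℕ}
    {p : MvPolynomial (Fin m ⊕ Fin n) ℤ} (hp : OrdGe d p)
    (hG : ∀ i : Fin (m + 1), OrdGe e (evRow i G))
    (hH : ∀ i : Fin (m + 1), homogeneousComponent e (evRow i G) = evRow i H) :
    OrdGe (d + e) (rowOp G p) ∧
      homogeneousComponent (d + e) (rowOp G p) = rowOp H (homogeneousComponent d p) := by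
  have h1 : ∀ i : Fin (m + 1), OrdGe d (rename (skip n i) p) := fun i =>
    hp.rename (skip n i)
  have h2 : ∀ i : Fin (m + 1), OrdGe e ((-1) ^ (i : ℕ) * evRow i G) := fun i => by
    simpa using (OrdGe.zero ((-1) ^ (i : ℕ) : MvPolynomial (Fin (m + 1) ⊕ Fin n) ℤ)).mul (hG i)
  have h3 : ∀ i : Fin (m + 1), homogeneousComponent e ((-1) ^ (i : ℕ) * evRow i G)
      = (-1) ^ (i : ℕ) * evRow i H := fun i => by
    have h := homogeneousComponent_isHomogeneous_mul (e := e)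
      (isHomogeneous_C (Fin (m + 1) ⊕ Fin n) ((-1 : ℤ) ^ (i : ℕ))) (evRow i G)
    rw [zero_add, hH] at h
    simpa using h
  constructor
  · rw [rowOp_apply]
    refine OrdGe.sum _ fun i _ => ?_
    rw [add_comm d e]
    exact (h2 i).mul (h1 i)
  · rw [rowOp_apply, map_sum, rowOp_apply]
    refine Finset.sum_congr rfl fun i _ => ?_
    rw [add_comm d, homogeneousComponent_mul (h2 i) (h1 i), h3, rename_homogeneousComponent]

theorem rowComp_lowest {G H : ℕ → Polynomial (MvPolynomial (Fin n) ℤ)} {e : ℕ → ℕ} {d : ℕ}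
    {p : MvPolynomial (Fin m ⊕ Fin n) ℤ} (hp : OrdGe d p)
    (hG : ∀ j {m : ℕ} (i : Fin m), OrdGe (e j) (evRow i (G j)))
    (hH : ∀ j {m : ℕ} (i : Fin m), homogeneousComponent (e j) (evRow i (G j)) = evRow i (H j))
    (c : ℕ) : OrdGe (d + ∑ j ∈ Finset.range c, e j) (rowComp G c p) ∧
      homogeneousComponent (d + ∑ j ∈ Finset.range c, e j) (rowComp G c p)
        = rowComp H c (homogeneousComponent d p) := by
  induction c with
  | zero => exact ⟨hp, rfl⟩
  | succ c ih =>
    rw [Finset.sum_range_succ, ← add_assoc d]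
    have h := rowOp_lowest (G := G c) (H := H c) (e := e c) ih.1 (fun i => hG c i) fun i => hH c i
    rw [ih.2] at h
    exact h

theorem evRow_shift_lowest (j : ℕ) (i : Fin m) :
    OrdGe (j + n) (evRow i (Polynomial.X ^ j * ∏ b : Fin n, (Polynomial.X + Polynomial.C (X b)
      - Polynomial.X * Polynomial.C (X b)))) ∧
    homogeneousComponent (j + n) (evRow i (Polynomial.X ^ j * ∏ b : Fin n,
      (Polynomial.X + Polynomial.C (X b) - Polynomial.X * Polynomial.C (X b))))
      = evRow i (Polynomial.X ^ j * ∏ b : Fin n, (Polynomial.X + Polynomial.C (X b))) := by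
  let v : Fin n → MvPolynomial (Fin m ⊕ Fin n) ℤ :=
    fun b => X (Sum.inl i) + X (Sum.inr b) - X (Sum.inl i) * X (Sum.inr b)
  have hlin : ∀ b : Fin n, ((X (Sum.inl i) + X (Sum.inr b) :
      MvPolynomial (Fin m ⊕ Fin n) ℤ)).IsHomogeneous 1 := fun b =>
    (isHomogeneous_X _ _).add (isHomogeneous_X _ _)
  have hquad : ∀ b : Fin n, ((X (Sum.inl i) * X (Sum.inr b) :
      MvPolynomial (Fin m ⊕ Fin n) ℤ)).IsHomogeneous (1 + 1) := fun b =>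
    (isHomogeneous_X _ _).mul (isHomogeneous_X _ _)
  have hv : ∀ b, OrdGe 1 (v b) := fun b => by
    have h1 := (hlin b).ordGe
    have h2 := (hquad b).neg.ordGe.mono (show 1 ≤ 1 + 1 by omega)
    simpa [v, sub_eq_add_neg] using h1.add h2
  have hv' : ∀ b, homogeneousComponent 1 (v b) = X (Sum.inl i) + X (Sum.inr b) := fun b => by
    rw [map_sub, homogeneousComponent_of_mem (hlin b), homogeneousComponent_of_mem (hquad b)]
    simp
  have hX : ((X (Sum.inl i) : MvPolynomial (Fin m ⊕ Fin n) ℤ) ^ j).IsHomogeneous j := by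
    simpa using (isHomogeneous_X ℤ (Sum.inl i : Fin m ⊕ Fin n)).pow j
  have hev : evRow i (Polynomial.X ^ j * ∏ b : Fin n, (Polynomial.X + Polynomial.C (X b)
      - Polynomial.X * Polynomial.C (X b))) = X (Sum.inl i) ^ j * ∏ b, v b := by
    simp only [v, map_mul, map_pow, map_prod, map_sub, map_add, evRow_X, evRow_C, rename_X]
  have hev' : evRow i (Polynomial.X ^ j * ∏ b : Fin n, (Polynomial.X + Polynomial.C (X b)))
      = X (Sum.inl i) ^ j * ∏ b, (X (Sum.inl i) + X (Sum.inr b)) := by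
    simp
  have hP : OrdGe n (∏ b, v b) := by
    simpa using OrdGe.prod Finset.univ (d := fun _ => 1) fun b _ => hv b
  have hP' : homogeneousComponent n (∏ b, v b) = ∏ b : Fin n, (X (Sum.inl i) + X (Sum.inr b)) := by
    simpa using homogeneousComponent_prod Finset.univ (d := fun _ => 1) (fun b _ => hv b)
      (fun b _ => hv' b)
  rw [hev, hev']
  exact ⟨hX.ordGe.mul hP, by rw [homogeneousComponent_isHomogeneous_mul hX, hP']⟩

theorem exists_vdm_eq (m n : ℕ) : ∃ ε : ℤ, vdm m n = C ε *
    ∏ i : Fin m, ∏ j ∈ Finset.Ioi i, (X (Sum.inl j) - X (Sum.inl i)) := by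
  refine ⟨Equiv.Perm.sign (Fin.revPerm : Equiv.Perm (Fin m)), ?_⟩
  have h : vdm m n = ((Matrix.vandermonde fun i : Fin m =>
      (X (Sum.inl i) : MvPolynomial (Fin m ⊕ Fin n) ℤ)).submatrix id Fin.revPerm).det := by
    rw [vdm]
    congr 1
    ext1 i j
    simp only [delta, Matrix.of_apply, Matrix.submatrix_apply, id_eq, Fin.revPerm_apply,
      Matrix.vandermonde_apply, Fin.val_rev]
    congr 1
    omega
  rw [h, Matrix.det_permute', Matrix.det_vandermonde]
  simp

theorem sum_card_Ioi (m : ℕ) : ∑ i : Fin m, (Finset.Ioi i).card = ∑ i ∈ Finset.range m, i := by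
  simp only [Fin.card_Ioi]
  rw [Fin.sum_univ_eq_sum_range (fun i => m - 1 - i), Finset.sum_range_reflect (fun i => i)]

theorem isHomogeneous_vdm (m n : ℕ) : (vdm m n).IsHomogeneous (∑ i ∈ Finset.range m, i) := by
  obtain ⟨ε, h⟩ := exists_vdm_eq m n
  rw [h, ← sum_card_Ioi, ← zero_add (∑ i : Fin m, (Finset.Ioi i).card)]
  refine (isHomogeneous_C _ _).mul (IsHomogeneous.prod _ _ _ fun i _ => ?_)
  rw [Finset.card_eq_sum_ones]
  exact IsHomogeneous.prod _ _ _ fun j _ => (isHomogeneous_X _ _).sub (isHomogeneous_X _ _)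

theorem oneSub_vdm (m n : ℕ) :
    oneSub m n (vdm m n) = (-1) ^ (∑ i ∈ Finset.range m, i) * vdm m n := by
  obtain ⟨ε, h⟩ := exists_vdm_eq m n
  have h1 : ∀ i j : Fin m, oneSub m n (X (Sum.inl j) - X (Sum.inl i))
      = (-1) * (X (Sum.inl j) - X (Sum.inl i)) := fun i j => by
    simp [oneSub]
  have h2 : oneSub m n (C ε) = C ε := (oneSub m n).commutes ε
  rw [h, map_mul, h2, map_prod]
  simp only [map_prod, h1, Finset.prod_mul_distrib, Finset.prod_const]
  rw [Finset.prod_pow_eq_pow_sum, sum_card_Ioi]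
  ring

theorem oneSub_rename_skip (i : Fin (m + 1)) (p : MvPolynomial (Fin m ⊕ Fin n) ℤ) :
    oneSub (m + 1) n (rename (skip n i) p) = rename (skip n i) (oneSub m n p) := by
  have h : (oneSub (m + 1) n).comp (rename (skip n i)) = (rename (skip n i)).comp (oneSub m n) :=
    algHom_ext fun s => by simp [oneSub]
  exact DFunLike.congr_fun h p

theorem oneSub_prodU : oneSub m n (prodU m n) = prodRow m (1 - Polynomial.X) := by
  simp [prodU, prodRow, oneSub]

theorem oneSub_insertOp (p : MvPolynomial (Fin m ⊕ Fin n) ℤ) :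
    oneSub (m + 1) n (insertOp (fun i => ∏ b, (1 - X (Sum.inl i) * X (Sum.inr b))) p)
      = rowOp (∏ b : Fin n, (Polynomial.X + Polynomial.C (X b) - Polynomial.X * Polynomial.C (X b)))
        (oneSub m n p) := by
  rw [insertOp, map_sum, rowOp_apply]
  refine Finset.sum_congr rfl fun i _ => ?_
  rw [map_mul, map_mul, oneSub_rename_skip, map_prod, map_prod]
  congr 2
  · simp
  · refine Finset.prod_congr rfl fun b _ => ?_
    simp [oneSub]
    ring

theorem coeff_zero_prodRow (c : ℕ) : homogeneousComponent 0
    ((prodRow m (1 - Polynomial.X) : MvPolynomial (Fin m ⊕ Fin n) ℤ) ^ c) = 1 := by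
  rw [homogeneousComponent_zero, ← constantCoeff_eq]
  simp [prodRow]

variable {k : Type*} [Field k] [CharZero k] {Q : Type*} [CommRing Q] [Algebra k Q] {r : ℕ}
  (x : Fin r → Fin n → Q)

/-- Iterating `vdm_mul_kPolynomial` after `u ↦ 1 - u`, `t ↦ 1 - t`. The substitution multiplies the
Vandermonde determinants by signs whose quotient is exactly the `(-1) ^ (r + c)` of the recursion.
-/
theorem vdm_mul_oneSub_kPolynomial {K : ∀ m, MvPolynomial (Fin m ⊕ Fin n) ℤ}
    (hK : ∀ m, IsKPolynomial (RingHom.ker (mulHom k m x)) (K m)) (c : ℕ) :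
    vdm (r + c) n * oneSub (r + c) n (K (r + c))
      = rowIter (∏ b : Fin n, (Polynomial.X + Polynomial.C (X b) - Polynomial.X * Polynomial.C (X b)))
        (1 - Polynomial.X) c (vdm r n * oneSub r n (K r)) := by
  induction c with
  | zero => rfl
  | succ c ih =>
    have h := congrArg (oneSub (r + c + 1) n)
      (vdm_mul_kPolynomial x (show r ≤ r + c by omega) (hK (r + c)) (hK (r + c + 1)))
    rw [map_mul, oneSub_vdm, map_mul, oneSub_insertOp, map_mul (oneSub (r + c) n),
      map_mul (oneSub (r + c) n), oneSub_vdm, oneSub_prodU,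
      Finset.sum_range_succ, pow_add] at h
    set R := prodRow (r + c) (1 - Polynomial.X) * (vdm (r + c) n * oneSub (r + c) n (K (r + c)))
      with hR
    have h4 : prodRow (r + c) (1 - Polynomial.X) *
        ((-1) ^ (∑ i ∈ Finset.range (r + c), i) * vdm (r + c) n * oneSub (r + c) n (K (r + c)))
        = rename Sum.inr ((-1) ^ (∑ i ∈ Finset.range (r + c), i)) * R := by
      rw [hR]; simp; ring
    have h5 : oneSub (r + c + 1) n ((-1) ^ (r + c)) = (-1) ^ (r + c) := by simp
    rw [h4, rowOp_rename_mul, h5] at h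
    simp only [map_pow, map_neg, map_one] at h
    have h6 : ((-1) ^ (∑ i ∈ Finset.range (r + c), i) * (-1) ^ (r + c) :
        MvPolynomial (Fin (r + c + 1) ⊕ Fin n) ℤ) ≠ 0 :=
      mul_ne_zero (pow_ne_zero _ (by simp)) (pow_ne_zero _ (by simp))
    rw [rowIter, ← ih, ← hR]
    apply mul_left_cancel₀ h6
    rw [← mul_assoc]
    refine h.trans ?_
    ring

/-- The sign from reordering the insertions cancels the sign from trading `1 - u` for `u`. The
surviving factor `∏ (1 - u_i) ^ c` has constant term `1` and so drops out in lowest degree, while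
each `u + t_b - u t_b` contributes `u + t_b`. -/
theorem vdm_mul_lowest {K : ∀ m, MvPolynomial (Fin m ⊕ Fin n) ℤ}
    (hK : ∀ m, IsKPolynomial (RingHom.ker (mulHom k m x)) (K m)) {d : ℕ}
    (hd : OrdGe d (oneSub r n (K r))) (hrn : r ≤ n) (c : ℕ) :
    vdm (r + c) n * homogeneousComponent (d + c * (n - r)) (oneSub (r + c) n (K (r + c)))
      = rowComp (fun i => Polynomial.X ^ i * ∏ b, (Polynomial.X + Polynomial.C (X b))) c
        (vdm r n * homogeneousComponent d (oneSub r n (K r))) := by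
  have h1 := vdm_mul_oneSub_kPolynomial x hK c
  rw [rowIter_eq, rowComp_one_sub, ← mul_assoc, ← pow_add,
    Even.neg_one_pow ⟨∑ i ∈ Finset.range c, i, rfl⟩, one_mul] at h1
  have hv := (isHomogeneous_vdm r n).ordGe.mul hd
  have hp := (OrdGe.zero (prodRow r (1 - Polynomial.X) ^ c)).mul hv
  have h2 := (rowComp_lowest (e := fun j => j + n) hp (fun j _ i => (evRow_shift_lowest j i).1)
    (fun j _ i => (evRow_shift_lowest j i).2) c).2
  rw [homogeneousComponent_mul (OrdGe.zero _) hv, coeff_zero_prodRow, one_mul,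
    homogeneousComponent_isHomogeneous_mul (isHomogeneous_vdm r n), ← h1] at h2
  rw [← h2, ← homogeneousComponent_isHomogeneous_mul (isHomogeneous_vdm (r + c) n)]
  congr 2
  -- The degree count: the `j`-th insertion raises the degree by `j + n`, and the Vandermonde degree
  -- grows by `c r + ∑_(j < c) j`, leaving `c (n - r)`.
  obtain ⟨e, rfl⟩ := Nat.exists_eq_add_of_le hrn
  rw [Nat.add_sub_cancel_left, Finset.sum_range_add, Finset.sum_add_distrib, Finset.sum_add_distrib]
  simp
  ring

end LowestComponent

/-! ### The codimension bounds the order of the `K`-polynomial -/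

section Codimension

universe u

variable {k : Type u} [Field k] {r n : ℕ}

theorem ordGe_kPolynomial (I : Ideal (CoordRing k r n)) [I.IsPrime]
    (hI : ∀ f ∈ I, ∀ D, weightedHomogeneousComponent (varDegree r n) D f ∈ I)
    {d : ℕ} (hd : I.height = d) {K : MvPolynomial (Fin r ⊕ Fin n) ℤ} (hK : IsKPolynomial I K) :
    OrdGe d (oneSub r n K) := by
  obtain ⟨K', hK', h⟩ := exists_kPolynomial I
  obtain rfl : K = K' := MvPolynomial.coe_injective _ _ (hK.trans hK'.symm)
  refine h d hI fun B hB => ?_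
  have := card_add_height_le I hB
  rw [hd, ENat.card_eq_coe_natCard] at this
  simp only [Nat.card_eq_fintype_card, Fintype.card_coe, Fintype.card_prod, Fintype.card_fin] at this
  exact_mod_cast this

end Codimension

end MatrixStabilization

end

theorem proposition8p2 {k : Type*} [Field k] [CharZero k] (r n c : ℕ) (hc : 1 ≤ c)
    (X : Set (MatSpace k r n)) (hX_closed : IsClosed X) (hX_irred : IsIrreducible X)
    (hX_stable : IsStable X) (hX_rank : ¬ X ⊆ lowRankLocus k r n) :
    IsLeast {Y : Set (MatSpace k (r + c) n) |
      IsClosed Y ∧ IsIrreducible Y ∧ IsStable Y ∧ embed c '' X ⊆ Y} (raise c X) ∧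
    ∃ γ : symmetricSubalgebra (Fin r) (MvPolynomial (Fin n) ℤ),
      IsEquivariantClass X γ ∧ IsEquivariantClass (raise c X) (rhoH n c γ) := by
  have hinf : Infinite k := CharZero.infinite k
  refine ⟨isLeast_raise c hX_irred hX_stable, ?_⟩
  have hprime := PrimeSpectrum.isIrreducible_iff_vanishingIdeal_isPrime.1 hX_irred
  have hker := vanishingIdeal_eq_ker hX_irred hX_stable
  have hraise := vanishingIdeal_raise c hX_irred
  obtain ⟨b, hb⟩ := exists_minor_ne_zero hX_rank
  have hhom := fun f hf D => weightedHomogeneousComponent_mem hX_irred hX_stable (f := f) hf D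
  set I := PrimeSpectrum.vanishingIdeal X with hI
  obtain ⟨d, hd⟩ := ENat.ne_top_iff_exists.1 (Ideal.height_ne_top (I := I) hprime.ne_top)
  -- The recursion passes through all row numbers between `r` and `r + c`, so a `K`-polynomial is
  -- fixed for every `m`.
  choose K hK using fun m => exists_kPolynomial (RingHom.ker (mulHom k m (coordMat I)))
  have hK' : ∀ m, IsKPolynomial (RingHom.ker (mulHom k m (coordMat I))) (K m) := fun m => (hK m).1
  have hKI : IsKPolynomial I (K r) := hker ▸ hK' r
  have hsymm : ∀ σ : Equiv.Perm (Fin r), rename (Sum.map σ id) (K r) = K r := fun σ =>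
    rename_kPolynomial σ (mem_ker_mulHom_rename_perm (coordMat I) σ) (hK' r)
  refine ⟨lowComponent (K r) hsymm d, ⟨K r, d, hKI, hd.symm, rfl⟩,
    ⟨K (r + c), d + c * (n - r), hraise ▸ hK' (r + c), ?_, ?_⟩⟩
  · rw [hraise]
    exact height_ker_mulHom I hker.le b hb c hd.symm
  · have hflat : flat (lowComponent (K r) hsymm d)
        = homogeneousComponent d (oneSub r n (K r)) := AlgEquiv.symm_apply_apply _ _
    have h1 := vdm_mul_lowest (coordMat I) hK' (ordGe_kPolynomial I hhom hd.symm hKI)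
      (le_of_det_ne_zero b hb) c
    rw [← hflat, ← vdm_mul_flat_rhoH] at h1
    -- Both classes, times the Vandermonde determinant in `r + c` variables, are the same composite
    -- of row insertions.
    have h2 := mul_left_cancel₀ vdm_ne_zero h1
    exact ((AlgEquiv.symm_apply_eq _).1 h2.symm)
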